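/- Let $M$ be a compact smooth manifold of dimension $n$, possibly with boundary, and let $\varphi \colon M \to \mathbb{R}$ be a Morse function: $\varphi$ is smooth, its critical points are nondegenerate, and it is locally constant and regular along $\partial M$. Let $\nu$ be an adapted gradient of $\varphi$: a smooth vector field with $\nu\cdot\varphi>0$ away from the critical points and such that, near each critical point $a$, there are Morse coordinates $(q_1,\dots,q_n)$ centered on $a$ with $\varphi = \varphi(a)+\sum_j \epsilon_j q_j^2$, $\epsilon_j\in\{-1,1\}$, and $\nu = 2\sum_j \epsilon_j q_j\partial_{q_j}$. Fix a Riemannian metric on $M$ for which $\nu=\nabla\varphi$ and which is the Euclidean metric in some Morse coordinates near each critical point, and a smooth function $\chi \colon M \to [0,1]$ equal to $1$ near the critical points of $\varphi$. On $T^*M\cong TM$ define $$h^0(p,q) = \varphi(q) - \tfrac12\,\chi(q)\,\nabla^2\varphi_q(p,p) + i\langle p,\nu(q)\rangle, \qquad f^0 = \operatorname{Re} h^0,$$ where $\nabla^2\varphi$ is the covariant second derivative, and set $W_r=\{|p|\le r\}$, $V_r=\{|p|=r\}$. Let $\lambda=\sum_j p_j\,dq_j$ and $\omega=d\lambda=\sum_j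 dp_j\wedge dq_j$ be the canonical forms of $T^*M$; let $\tilde\nu$ be the Hamiltonian lift of $\nu$ (the vector field with $\tilde\nu\lrcorner\,\omega=-d\langle p,\nu\rangle$, i.e. the lift of $\nu$ to $T^*M$ preserving $\lambda$) and $\bar\nu$ the contact lift (the projection of $\tilde\nu$ along the radial direction to vector fields tangent to the $V_r$, $r>0$). A smooth function $f$ is a Lyapunov function for a vector field $X$ on $W$ if there is a smooth isomorphism $L\colon TW\to T^*W$ with $\langle L\eta,\eta\rangle>0$ for all $\eta\neq0$ and $LX=df$. Then there exists $\delta>0$ such that: 1. in $W_\delta$, the critical points of $h^0$ (the points where $dh^0$ is not onto) are exactly the critical points of $\varphi$, viewed in the zero-section, and they are of complex Morse type: each is the center of complex coordinates $(z_1,\dots,z_n)$ in which $h^0 = h^0(0)+\sum_j z_j^2$ and in which the canonical symplectic form, taken with the sign $-\omega=\sum_j dq_j\wedge dp_j$, is a positive $(1,1)$-form at $0$; 2. in $W_\delta$, $f^0$ is a Lyapunov function for $\tilde\nu$; 3. for every $0<r\le\delta$, the restriction of $f^0$ to $V_r$ is a Morse–Bott function (its critical locus is a union of submanifolds along which its Hessian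 is transversely nondegenerate) and a Lyapunov function for $\bar\nu$; moreover, if $\chi$ vanishes near $\partial M$, this restriction is locally constant along $\partial V_r$. -/

import Mathlib

open Set Topology Bundle
open scoped Manifold ContDiff

noncomputable section

namespace CoarseComplexification

/-! ### Vector fields, forms and special functions on a general manifold -/

section General

variable {F : Type*} [NormedAddCommGroup F] [NormedSpace ℝ F]
  {K : Type*} [TopologicalSpace K] {J : ModelWithCorners ℝ F K}
  {W : Type*} [TopologicalSpace W] [ChartedSpace K W]

/-- The differential of a real function at `x`, as a covector. -/
def diff (J : ModelWithCorners ℝ F K) {W : Type*} [TopologicalSpace W] [ChartedSpace K W]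
    (f : W → ℝ) (x : W) : TangentSpace J x →L[ℝ] ℝ :=
  mfderiv J 𝓘(ℝ, ℝ) f x

/-- Smooth coordinates on an open subset of a manifold: `e` is a diffeomorphism from the open set
`e.source` onto an open subset of the vector space `G`. -/
def IsSmoothCoord (J : ModelWithCorners ℝ F K) {W : Type*} [TopologicalSpace W] [ChartedSpace K W]
    {G : Type*} [NormedAddCommGroup G] [NormedSpace ℝ G] (e : OpenPartialHomeomorph W G) : Prop :=
  ContMDiffOn J 𝓘(ℝ, G) ∞ e e.source ∧ ContMDiffOn 𝓘(ℝ, G) J ∞ e.symm e.target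

/-- Let `S` be a subset of `W` which is a domain or a submanifold, with tangent spaces
`TS x ⊆ T_x W` (`x ∈ S`), and let `X` be a vector field along `S`. The function `f|_S` is a
Lyapunov function for `X` if `X` is tangent to `S` and there is a smooth isomorphism
`L : TS → T*S` which is positive (`⟨L η, η⟩ > 0` for all nonzero `η`, so that `L` is automatically
invertible) and which sends `X` to `d(f|_S)`. The form `L x` is the restriction to `TS x` of a
bilinear form on `T_x W` which depends smoothly on `x ∈ S`. -/
def IsLyapunovOn [IsManifold J 1 W] (S : Set W) (TS : ∀ x : W, Submodule ℝ (TangentSpace J x))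
    (X : ∀ x : W, TangentSpace J x) (f : W → ℝ) : Prop :=
  ContMDiffOn J 𝓘(ℝ, ℝ) ∞ f S ∧
  (∀ x ∈ S, X x ∈ TS x) ∧
  ∃ L : ∀ x : W, TangentSpace J x →L[ℝ] TangentSpace J x →L[ℝ] ℝ,
    ContMDiffOn J (J.prod 𝓘(ℝ, F →L[ℝ] F →L[ℝ] ℝ)) ∞
      (fun x ↦ TotalSpace.mk' (F →L[ℝ] F →L[ℝ] ℝ)
        (E := fun x : W ↦ TangentSpace J x →L[ℝ] TangentSpace J x →L[ℝ] ℝ) x (L x)) S ∧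
    (∀ x ∈ S, ∀ η ∈ TS x, η ≠ 0 → 0 < L x η η) ∧
    ∀ x ∈ S, ∀ w ∈ TS x, L x (X x) w = diff J f x w

/-- The critical points of `f|_S`, where `S` has tangent spaces `TS`. -/
def critOn (S : Set W) (TS : ∀ x : W, Submodule ℝ (TangentSpace J x)) (f : W → ℝ) : Set W :=
  {x ∈ S | ∀ w ∈ TS x, diff J f x w = 0}

/-- The function `f|_S` is Morse--Bott: near each of its critical points `c` there are smooth
coordinates `e` of the ambient manifold, centred at `c`, in which `S` is a linear subspace `A`, the
critical locus of `f|_S` is a linear subspace `B ⊆ A` (so it is a submanifold of `S`), and the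
kernel of the Hessian of `f|_A` at the origin is exactly `B` (so the Hessian is nondegenerate
transversely to the critical locus). -/
def IsMorseBottOn (S : Set W) (TS : ∀ x : W, Submodule ℝ (TangentSpace J x)) (f : W → ℝ) : Prop :=
  ContMDiffOn J 𝓘(ℝ, ℝ) ∞ f S ∧
  ∀ c ∈ critOn S TS f, ∃ (e : OpenPartialHomeomorph W F) (A B : Submodule ℝ F),
    IsSmoothCoord J e ∧ c ∈ e.source ∧ e c = 0 ∧ B ≤ A ∧
    (∀ x ∈ e.source, x ∈ S ↔ e x ∈ A) ∧
    (∀ x ∈ e.source, x ∈ critOn S TS f ↔ e x ∈ B) ∧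
    ∀ v ∈ A, (∀ w ∈ A, fderiv ℝ (fderiv ℝ (f ∘ e.symm)) 0 v w = 0) ↔ v ∈ B

/-- The point `x` is a critical point of complex Morse type of `h : W → ℂ`, with respect to the
field of bilinear forms `σ`: it is the centre of complex coordinates `z = (z₁, …, zₙ)` in which
`h = h x + ∑ zⱼ²` and in which `σ` is, at the centre, a positive `(1,1)`-form, namely
`σ (i ξ, i η) = σ (ξ, η)` for all `ξ, η` and `σ (ξ, i ξ) > 0` for all `ξ ≠ 0`. -/
def IsComplexMorsePoint (n : ℕ) (σ : ∀ x : W, TangentSpace J x →L[ℝ] TangentSpace J x →L[ℝ] ℝ)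
    (h : W → ℂ) (x : W) : Prop :=
  ∃ z : OpenPartialHomeomorph W (Fin n → ℂ),
    IsSmoothCoord J z ∧ x ∈ z.source ∧ z x = 0 ∧
    (∀ y ∈ z.source, h y = h x + ∑ j, z y j ^ 2) ∧
    let T := mfderiv 𝓘(ℝ, Fin n → ℂ) J z.symm 0
    let pullback : (Fin n → ℂ) → (Fin n → ℂ) → ℝ := fun ξ η ↦ σ (z.symm 0) (T ξ) (T η)
    (∀ ξ η, pullback (Complex.I • ξ) (Complex.I • η) = pullback ξ η) ∧
    ∀ ξ, ξ ≠ 0 → 0 < pullback ξ (Complex.I • ξ)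

/-- The bilinear form `((q̇, ṗ), (q̇', ṗ')) ↦ ⟨ṗ, q̇'⟩`, that is, `∑ dpⱼ ⊗ dqⱼ`. -/
def dpdq (E : Type*) [NormedAddCommGroup E] [NormedSpace ℝ E] :
    (E × (E →L[ℝ] ℝ)) →L[ℝ] (E × (E →L[ℝ] ℝ)) →L[ℝ] ℝ :=
  ((ContinuousLinearMap.compL ℝ (E × (E →L[ℝ] ℝ)) E ℝ).flip
    (ContinuousLinearMap.fst ℝ E (E →L[ℝ] ℝ))).comp (ContinuousLinearMap.snd ℝ E (E →L[ℝ] ℝ))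

/-- The antisymmetrization `(u, v) ↦ B(u, v) - B(v, u)` of a bilinear form. -/
def antisymm {V : Type*} [NormedAddCommGroup V] [NormedSpace ℝ V] (B : V →L[ℝ] V →L[ℝ] ℝ) :
    V →L[ℝ] V →L[ℝ] ℝ :=
  B - B.flip

/-- The standard symplectic form `∑ dpⱼ ∧ dqⱼ` on `E × E*`. -/
def stdForm (E : Type*) [NormedAddCommGroup E] [NormedSpace ℝ E] :
    (E × (E →L[ℝ] ℝ)) →L[ℝ] (E × (E →L[ℝ] ℝ)) →L[ℝ] ℝ :=
  antisymm (dpdq E)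

theorem stdForm_apply {E : Type*} [NormedAddCommGroup E] [NormedSpace ℝ E]
    (u v : E × (E →L[ℝ] ℝ)) : stdForm E u v = u.2 v.1 - v.2 u.1 := rfl

/-- An injective linear map `V → V*` is invertible in finite dimension. -/
theorem isInvertible_of_injective {V : Type*} [NormedAddCommGroup V] [NormedSpace ℝ V]
    [FiniteDimensional ℝ V] (B : V →L[ℝ] V →L[ℝ] ℝ) (hB : ∀ v, B v = 0 → v = 0) :
    B.IsInvertible := by
  have h1 : Function.Injective B.toLinearMap :=
    (injective_iff_map_eq_zero B.toLinearMap).2 hB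
  have h2 : Module.finrank ℝ V = Module.finrank ℝ (V →L[ℝ] ℝ) := by
    rw [← (LinearMap.toContinuousLinearMap (𝕜 := ℝ) (E := V) (F' := ℝ)).finrank_eq,
      Subspace.dual_finrank_eq]
  refine ⟨(LinearEquiv.ofInjectiveOfFinrankEq B.toLinearMap h1 h2).toContinuousLinearEquiv, ?_⟩
  ext v
  rfl

theorem stdForm_isInvertible {E : Type*} [NormedAddCommGroup E] [NormedSpace ℝ E]
    [FiniteDimensional ℝ E] : (stdForm E).IsInvertible := by
  refine isInvertible_of_injective _ fun u hu ↦ ?_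
  have h1 : ∀ v, u.2 v = 0 := fun v ↦ by
    simpa [stdForm_apply] using DFunLike.congr_fun hu (v, 0)
  have h2 : ∀ f : E →L[ℝ] ℝ, f u.1 = 0 := fun f ↦ by
    simpa [stdForm_apply] using DFunLike.congr_fun hu (0, f)
  refine Prod.ext ?_ (ContinuousLinearMap.ext h1)
  by_contra h
  obtain ⟨f, hf⟩ := SeparatingDual.exists_ne_zero (R := ℝ) h
  exact hf (h2 f)

/-- For the derivative `D` of a field of symmetric bilinear forms `G`, the covector
`u ↦ ½ (∂_v G(w, u) + ∂_w G(v, u) - ∂_u G(v, w))`. -/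
def christoffelForm {E : Type*} [NormedAddCommGroup E] [NormedSpace ℝ E]
    (D : E →L[ℝ] E →L[ℝ] E →L[ℝ] ℝ) (v w : E) : E →L[ℝ] ℝ :=
  (1 / 2 : ℝ) • (D v w + D w v - (D.flip v).flip w)

theorem christoffelForm_apply {E : Type*} [NormedAddCommGroup E] [NormedSpace ℝ E]
    (D : E →L[ℝ] E →L[ℝ] E →L[ℝ] ℝ) (v w u : E) :
    christoffelForm D v w u = 1 / 2 * (D v w u + D w v u - D u v w) := rfl

end General

/-! ### Morse functions, adapted gradients and adapted metrics -/

/-- The coordinate space `ℝⁿ`. -/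
abbrev Coord (n : ℕ) := EuclideanSpace ℝ (Fin n)

section Morse

variable {n : ℕ} {H : Type*} [TopologicalSpace H] (I : ModelWithCorners ℝ (Coord n) H)
  {M : Type*} [TopologicalSpace M] [ChartedSpace H M]

/-- The critical locus of a function on `M`. -/
def critSet (φ : M → ℝ) : Set M := {a | diff I φ a = 0}

/-- The matrix of second derivatives of `φ` at `q`, in the preferred chart at `q`. (Mathlib
identifies `T_q M` with the coordinate space `ℝⁿ` through this chart.) -/
def chartHessian (φ : M → ℝ) (q : M) : Coord n →L[ℝ] Coord n →L[ℝ] ℝ :=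
  fderivWithin ℝ (fderivWithin ℝ (φ ∘ (extChartAt I q).symm) (range I)) (range I) (extChartAt I q q)

/-- A Morse function on a manifold `M`, possibly with boundary: a smooth function whose critical
points are nondegenerate and which is locally constant and regular along `∂M`. -/
structure IsMorse (φ : M → ℝ) : Prop where
  smooth : ContMDiff I 𝓘(ℝ, ℝ) ∞ φ
  nondegenerate : ∀ a ∈ critSet I φ, ∀ v, (∀ w, chartHessian I φ a v w = 0) → v = 0
  regular_boundary : ∀ q ∈ I.boundary M, q ∉ critSet I φ
  locallyConst_boundary : ∀ q ∈ I.boundary M, ∀ᶠ q' in 𝓝[I.boundary M] q, φ q' = φ q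

/-- The coordinates `e` are Morse coordinates for `φ`, centred at `a`, with signs `ε`. -/
def IsMorseCoord (φ : M → ℝ) (a : M) (e : OpenPartialHomeomorph M (Coord n)) (ε : Fin n → ℝ) :
    Prop :=
  IsSmoothCoord I e ∧ a ∈ e.source ∧ e a = 0 ∧ (∀ j, ε j = 1 ∨ ε j = -1) ∧
    ∀ q ∈ e.source, φ q = φ a + ∑ j, ε j * e q j ^ 2

/-- The smooth vector field `ν` is an adapted gradient of `φ`: one has `ν · φ > 0` away from the
critical points and, near each critical point, `ν = 2 ∑ εⱼ qⱼ ∂_{qⱼ}` in some Morse coordinates. -/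
structure IsAdaptedGradient [IsManifold I 1 M] (φ : M → ℝ) (ν : ∀ q : M, TangentSpace I q) :
    Prop where
  smooth : ContMDiff I I.tangent ∞ (fun q ↦ (⟨q, ν q⟩ : TangentBundle I M))
  pos : ∀ q, q ∉ critSet I φ → 0 < diff I φ q (ν q)
  local_form : ∀ a ∈ critSet I φ, ∃ e ε, IsMorseCoord I φ a e ε ∧
    ∀ q ∈ e.source, mfderiv I 𝓘(ℝ, Coord n) e q (ν q) = WithLp.toLp 2 (fun j ↦ 2 * ε j * e q j)

/-- Smooth Riemannian metrics on `M`. -/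
abbrev Metric [IsManifold I ∞ M] :=
  ContMDiffRiemannianMetric I ∞ (Coord n) (fun q : M ↦ TangentSpace I q)

variable {I} [IsManifold I ∞ M]

/-- The metric `g` is adapted to `(φ, ν)`: `ν` is the gradient of `φ` for `g`, and `g` is the
Euclidean metric in some Morse coordinates near each critical point of `φ`. -/
structure IsAdaptedMetric (g : Metric I (M := M)) (φ : M → ℝ) (ν : ∀ q : M, TangentSpace I q) :
    Prop where
  gradient : ∀ q w, g.inner q (ν q) w = diff I φ q w
  euclidean : ∀ a ∈ critSet I φ, ∃ e ε, IsMorseCoord I φ a e ε ∧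
    ∀ q ∈ e.source, ∀ v w, g.inner q v w =
      inner ℝ (mfderiv I 𝓘(ℝ, Coord n) e q v : Coord n) (mfderiv I 𝓘(ℝ, Coord n) e q w : Coord n)

/-- The isomorphism `T*_q M ≅ T_q M` given by the metric. -/
def sharp (g : Metric I (M := M)) (q : M) (p : TangentSpace I q →L[ℝ] ℝ) : TangentSpace I q :=
  (g.inner q).inverse p

theorem inner_sharp (g : Metric I (M := M)) (q : M) (p : TangentSpace I q →L[ℝ] ℝ) :
    g.inner q (sharp g q p) = p := by
  refine (isInvertible_of_injective (V := Coord n) (g.inner q) fun v hv ↦ ?_).self_apply_inverse p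
  by_contra h0
  exact (g.pos q v h0).ne' (DFunLike.congr_fun hv v)

/-- The metric in the preferred chart at `q`, as a function on the chart domain in `ℝⁿ`. -/
def chartMetric (g : Metric I (M := M)) (q : M) (y : Coord n) : Coord n →L[ℝ] Coord n →L[ℝ] ℝ :=
  let T : Coord n →L[ℝ] Coord n := mfderivWithin 𝓘(ℝ, Coord n) I (extChartAt I q).symm (range I) y
  let G : Coord n →L[ℝ] Coord n →L[ℝ] ℝ := g.inner ((extChartAt I q).symm y)
  G.bilinearComp T T

/-- The Christoffel symbol `Γ(v, w) = ∑ Γᵏᵢⱼ vᵢ wⱼ ∂_k` at `q` of the Levi-Civita connection, in the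
preferred chart at `q`: `g(Γ(v, w), u) = ½ (∂_v g(w, u) + ∂_w g(v, u) - ∂_u g(v, w))`. -/
def christoffel (g : Metric I (M := M)) (q : M) (v w : Coord n) : TangentSpace I q :=
  sharp g q (christoffelForm
    (fderivWithin ℝ (chartMetric g q) (range I) (extChartAt I q q)) v w)

/-- The covariant second derivative `∇²φ_q (v, w)`. -/
def covHessian (g : Metric I (M := M)) (φ : M → ℝ) (q : M) (v w : TangentSpace I q) : ℝ :=
  chartHessian I φ q v w - diff I φ q (christoffel g q v w)

end Morse

/-! ### The cotangent bundle -/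

section Cotangent

variable {n : ℕ} {H : Type*} [TopologicalSpace H] (I : ModelWithCorners ℝ (Coord n) H)
  (M : Type*) [TopologicalSpace M] [ChartedSpace H M]

/-- The cotangent bundle `T*M`, whose elements are the pairs `x = ⟨q, p⟩` with `p ∈ T*_q M`. It is
a manifold modelled on `I.prod 𝓘(ℝ, Coord n →L[ℝ] ℝ)`; its preferred charts are the cotangent
coordinates `(q, p)` associated with the preferred charts of `M`, and accordingly a tangent vector
at `x` is a pair `(q̇, ṗ)` in
`Coord n × (Coord n →L[ℝ] ℝ)`. -/
abbrev Cotangent [IsManifold I 1 M] :=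
  TotalSpace (Coord n →L[ℝ] ℝ) (fun q : M ↦ TangentSpace I q →L[ℝ] ℝ)

/-- The model with corners of `T*M`. -/
abbrev coModel := I.prod 𝓘(ℝ, Coord n →L[ℝ] ℝ)

variable {M} {I} [IsManifold I ∞ M]

/-- The inclusion of `M` in `T*M` as the zero-section. -/
def zeroSec (q : M) : Cotangent I M := ⟨q, 0⟩

/-- The canonical symplectic form `ω = dλ = ∑ dpⱼ ∧ dqⱼ` of `T*M`, where `λ = ∑ pⱼ dqⱼ`, in the
cotangent coordinates at `x`. -/
def omega (x : Cotangent I M) :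
    TangentSpace (coModel I) x →L[ℝ] TangentSpace (coModel I) x →L[ℝ] ℝ :=
  stdForm (Coord n)

/-- The canonical Liouville form `λ = p ∘ dπ`, where `π : T*M → M` is the projection. -/
def liouvilleForm (x : Cotangent I M) : TangentSpace (coModel I) x →L[ℝ] ℝ :=
  x.2.comp (mfderiv (coModel I) I (TotalSpace.proj : Cotangent I M → M) x)

/-- The vector field `X` with `X ⌟ ω = α`. -/
def symplecticDual (x : Cotangent I M) (α : TangentSpace (coModel I) x →L[ℝ] ℝ) :
    TangentSpace (coModel I) x :=
  (omega x).inverse α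

theorem omega_symplecticDual (x : Cotangent I M) (α : TangentSpace (coModel I) x →L[ℝ] ℝ) :
    omega x (symplecticDual x α) = α :=
  (stdForm_isInvertible (E := Coord n)).self_apply_inverse α

/-- The Liouville vector field, `X ⌟ ω = λ`. -/
def liouvilleField (x : Cotangent I M) : TangentSpace (coModel I) x :=
  symplecticDual x (liouvilleForm x)

/-- The function `(p, q) ↦ ⟨p, ν(q)⟩`. -/
def momentum (ν : ∀ q : M, TangentSpace I q) (x : Cotangent I M) : ℝ := x.2 (ν x.1)

/-- The Hamiltonian lift `ν̃` of `ν` to `T*M`: the lift of `ν` which preserves `λ`, i.e. the vector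
field with `ν̃ ⌟ ω = -d⟨p, ν⟩`. In cotangent coordinates, it is
`∑ νⱼ ∂_{qⱼ} - ∑ pᵢ (∂νᵢ/∂qⱼ) ∂_{pⱼ}`. -/
def hamLift (ν : ∀ q : M, TangentSpace I q) (x : Cotangent I M) : TangentSpace (coModel I) x :=
  symplecticDual x (-diff (coModel I) (momentum ν) x)

/-- The kinetic energy `ρ = ½ |p|²`. -/
def kinetic (g : Metric I (M := M)) (x : Cotangent I M) : ℝ := (1 / 2) * x.2 (sharp g x.1 x.2)

/-- The norm `|p|` of the covector `x = ⟨q, p⟩`. -/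
def coNorm (g : Metric I (M := M)) (x : Cotangent I M) : ℝ := √(x.2 (sharp g x.1 x.2))

/-- The contact lift `ν̄` of `ν`, viewed as a vector field on `T*M - M` tangent to each sphere
bundle `V_r`: the image of `ν̃` under the projection along the radial (Liouville) direction, i.e.
`ν̄ = ν̃ - υ X`, where `X` is the Liouville field and `υ` is the function for which `ν̄ · ρ = 0`. -/
def contactLift (g : Metric I (M := M)) (ν : ∀ q : M, TangentSpace I q) (x : Cotangent I M) :
    TangentSpace (coModel I) x :=
  hamLift ν x -
    (diff (coModel I) (kinetic g) x (hamLift ν x) /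
      diff (coModel I) (kinetic g) x (liouvilleField x)) • liouvilleField x

/-- The closed tube `W_r = {|p| ≤ r}`. -/
def tube (g : Metric I (M := M)) (r : ℝ) : Set (Cotangent I M) := {x | coNorm g x ≤ r}

/-- The sphere bundle `V_r = {|p| = r}`. -/
def sphereBundle (g : Metric I (M := M)) (r : ℝ) : Set (Cotangent I M) := {x | coNorm g x = r}

/-- The tangent space at `x` of the sphere bundle through `x` (when `p ≠ 0`): the kernel of `dρ`. -/
def sphereTangent (g : Metric I (M := M)) (x : Cotangent I M) :
    Submodule ℝ (TangentSpace (coModel I) x) :=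
  LinearMap.ker (diff (coModel I) (kinetic g) x).toLinearMap

/-- The first-order complexification
`h⁰(p, q) = φ(q) - ½ χ(q) ∇²φ_q (p, p) + i ⟨p, ν(q)⟩`, where `χ` is a cut-off function. -/
def complexification (g : Metric I (M := M)) (φ : M → ℝ) (ν : ∀ q : M, TangentSpace I q)
    (χ : M → ℝ) (x : Cotangent I M) : ℂ :=
  ((φ x.1 - (1 / 2) * χ x.1 * covHessian g φ x.1 (sharp g x.1 x.2) (sharp g x.1 x.2) : ℝ) : ℂ) +
    Complex.I * (momentum ν x : ℝ)

/-- The real part `f⁰` of `h⁰`. -/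
def complexificationRe (g : Metric I (M := M)) (φ : M → ℝ) (ν : ∀ q : M, TangentSpace I q)
    (χ : M → ℝ) (x : Cotangent I M) : ℝ :=
  (complexification g φ ν χ x).re

/-- A cut-off function on `M` with values in `[0, 1]`, equal to `1` near the critical points. -/
structure IsCutoff (I : ModelWithCorners ℝ (Coord n) H) (φ χ : M → ℝ) : Prop where
  smooth : ContMDiff I 𝓘(ℝ, ℝ) ∞ χ
  mem_Icc : ∀ q, χ q ∈ Icc (0 : ℝ) 1
  eq_one : ∀ a ∈ critSet I φ, ∀ᶠ q in 𝓝 a, χ q = 1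

end Cotangent

end CoarseComplexification

end

/-!
The proof rests on the identity `∇²φ (p♯, p♯) = -dρ(ν̃)`, where `ρ = ½ |p|²` and `ν̃` is the
Hamiltonian lift of `ν = ∇φ` (`covHessian_gsharp`): the covariant Hessian of `φ` is half the Lie
derivative of the metric along `ν`. Hence `f⁰ = φ + ½ χ dρ(ν̃)` is smooth on `T*M` and does not
depend on coordinates, and `dρ(ν̃)` is quadratic along the fibres.

Near a critical point `a` of `φ`, where `χ = 1`, Morse coordinates `y` in which the metric is
Euclidean have a cotangent lift `(y, P)` (`coCoord`). This lift is symplectic, and in it all the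
objects take their model form: `ρ = ½ |P|²`, `⟨p, ν⟩ = 2 ∑ εⱼ yⱼ Pⱼ`,
`ν̃ = 2 ∑ εⱼ (yⱼ ∂_{yⱼ} - Pⱼ ∂_{Pⱼ})` and `f⁰ = φ(a) + ∑ εⱼ (yⱼ² - Pⱼ²)`. Therefore `ν̃` is there
the gradient of `f⁰` for the Euclidean metric of `T*M`, the contact lift `ν̄` is tangentially to the
spheres the gradient of the restriction of `f⁰`, and `h⁰ = φ(a) + ∑ εⱼ (yⱼ + i Pⱼ)²`.

Away from the critical points of `φ`, one has `df⁰(ν̃) = dφ(ν) > 0` along the zero-section, and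
`df⁰(ν̄)` differs from `df⁰(ν̃)` by `χ dρ(ν̃)² / 2ρ`, which is `O(ρ)` since the tubes `W_r` are
compact and `dρ(ν̃)` is quadratic. So both derivatives are positive near the zero-section, and
wherever `X · f > 0` there is a positive form which sends `X` to `df` (`lyapForm`). The two kinds of
points form an open set `goodSet` which contains the zero-section, hence a tube `W_δ`. As the
conditions on the form `L` in the definition of a Lyapunov function are convex, local solutions are
glued with a partition of unity (`isLyapunovOn_of_local`).

The critical points of `h⁰` are the zeros of `ν̃`. Indeed, `d⟨p, ν⟩ = -ν̃ ⌟ ω` vanishes with `ν̃`,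
and is zero on `ν̃`, while `df⁰(ν̃) > 0` where `ν̃ ≠ 0`. A critical point of `f⁰|_{V_r}` is a zero of
`ν̄`: it lies over a critical point of `φ`, and its momentum `P` is an eigenvector of
`diag(ε₁, …, εₙ)`. Replacing the component of `P` in this direction with `½ (|P|² - r²)` makes `V_r`
a hyperplane and `f⁰` a quadratic polynomial (`reCpx_eq_sphereCoord`), for which the Morse-Bott
property is linear algebra (`normalForm_eq_zero_iff`).
-/

noncomputable section

namespace CoarseComplexification

set_option synthInstance.maxHeartbeats 200000

/-! ### Frames and smooth tensor fields -/

section Frames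

variable {F : Type*} [NormedAddCommGroup F] [NormedSpace ℝ F]
  {K : Type*} [TopologicalSpace K] (J : ModelWithCorners ℝ F K)
  {W : Type*} [TopologicalSpace W] [ChartedSpace K W]

/-- The frame of the tangent bundle near `x₀` induced by the preferred chart at `x₀`, that is, the
inverse of the corresponding trivialization. -/
def frame [IsManifold J 1 W] (x₀ x : W) : F →L[ℝ] F :=
  (trivializationAt F (TangentSpace J) x₀).symmL ℝ x

/-- The trivialization of the tangent bundle near `x₀`, inverse to `frame`. -/
def coframe [IsManifold J 1 W] (x₀ x : W) : F →L[ℝ] F :=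
  (trivializationAt F (TangentSpace J) x₀).continuousLinearMapAt ℝ x

/-- The differential at `x` of a map to a vector space. Here, as below, the tangent space at `x` is
written as the model space `F`, with which it is identified through the preferred chart at `x`. -/
def vdiff {V : Type*} [NormedAddCommGroup V] [NormedSpace ℝ V] (f : W → V) (x : W) :
    F →L[ℝ] V :=
  mfderiv J 𝓘(ℝ, V) f x

variable {J}

theorem frame_coframe [IsManifold J 1 W] {x₀ x : W} (hx : x ∈ (chartAt K x₀).source)
    (v : F) : frame J x₀ x (coframe J x₀ x v) = v :=
  (trivializationAt F (TangentSpace J) x₀).symmL_continuousLinearMapAt hx v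

theorem coframe_frame [IsManifold J 1 W] {x₀ x : W} (hx : x ∈ (chartAt K x₀).source)
    (v : F) : coframe J x₀ x (frame J x₀ x v) = v :=
  (trivializationAt F (TangentSpace J) x₀).continuousLinearMapAt_symmL hx v

theorem frame_self [IsManifold J 1 W] (x : W) (v : F) : frame J x x v = v := by
  rw [frame, TangentBundle.symmL_trivializationAt_eq_core (mem_chart_source K x)]
  exact (tangentBundleCore J W).coordChange_self (achart K x) x (mem_chart_source K x) v

theorem coframe_self [IsManifold J 1 W] (x : W) (v : F) : coframe J x x v = v := by
  rw [coframe, TangentBundle.continuousLinearMapAt_trivializationAt_eq_core (mem_chart_source K x)]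
  exact (tangentBundleCore J W).coordChange_self (achart K x) x (mem_chart_source K x) v

variable [IsManifold J ∞ W]

/-- The differential of a smooth map, read in the frame at `x₀`, is smooth. -/
theorem contMDiffAt_vdiff_frame {V : Type*} [NormedAddCommGroup V] [NormedSpace ℝ V]
    {f : W → V} {x₀ : W} (hf : ContMDiffAt J 𝓘(ℝ, V) ∞ f x₀) :
    ContMDiffAt J 𝓘(ℝ, F →L[ℝ] V) ∞ (fun x ↦ (vdiff J f x).comp (frame J x₀ x)) x₀ := by
  have h := hf.mfderiv_const (m := ∞) le_rfl
  refine h.congr_of_eventuallyEq ?_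
  filter_upwards [(chartAt K x₀).open_source.mem_nhds (mem_chart_source K x₀)] with x hx
  simp only [inTangentCoordinates, ContinuousLinearMap.inCoordinates, frame, id]
  rw [TangentBundle.continuousLinearMapAt_model_space]
  rfl

/-- A section of the bundle of bilinear forms is smooth when it is so in the frame at `x₀`. -/
theorem contMDiffWithinAt_bilin_iff
    {L : ∀ x : W, TangentSpace J x →L[ℝ] TangentSpace J x →L[ℝ] ℝ} {S : Set W} {x₀ : W} :
    ContMDiffWithinAt J (J.prod 𝓘(ℝ, F →L[ℝ] F →L[ℝ] ℝ)) ∞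
      (fun x ↦ TotalSpace.mk' (F →L[ℝ] F →L[ℝ] ℝ)
        (E := fun x : W ↦ TangentSpace J x →L[ℝ] TangentSpace J x →L[ℝ] ℝ) x (L x)) S x₀ ↔
    ContMDiffWithinAt J 𝓘(ℝ, F →L[ℝ] F →L[ℝ] ℝ) ∞
      (fun x ↦ (show F →L[ℝ] F →L[ℝ] ℝ from L x).bilinearComp
        (frame J x₀ x) (frame J x₀ x)) S x₀ := by
  rw [contMDiffWithinAt_totalSpace]
  have key : ∀ x ∈ (chartAt K x₀).source,
      (trivializationAt (F →L[ℝ] F →L[ℝ] ℝ)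
        (fun x : W ↦ TangentSpace J x →L[ℝ] TangentSpace J x →L[ℝ] ℝ) x₀
        (TotalSpace.mk' (F →L[ℝ] F →L[ℝ] ℝ)
          (E := fun x : W ↦ TangentSpace J x →L[ℝ] TangentSpace J x →L[ℝ] ℝ) x (L x))).2 =
      (show F →L[ℝ] F →L[ℝ] ℝ from L x).bilinearComp (frame J x₀ x) (frame J x₀ x) := by
    intro x hx
    ext v w
    rw [hom_trivializationAt_apply]
    have := inCoordinates_apply_eq₂ (F₁ := F) (E₁ := fun x : W ↦ TangentSpace J x) (F₂ := F)
      (F₃ := ℝ) (E₂ := fun x : W ↦ TangentSpace J x) (E₃ := fun _ ↦ ℝ) (𝕜 := ℝ) (x₀ := x₀) (x := x) (ϕ := L x)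
      (v := v) (w := w) hx hx (by trivial)
    refine this.trans ?_
    simp only [Trivial.linearMapAt_trivialization, Trivial.fiberBundle_trivializationAt',
      LinearMap.id_coe, id_eq]
    change L x _ _ = L x ((trivializationAt F (TangentSpace J) x₀).symmL ℝ x v)
      ((trivializationAt F (TangentSpace J) x₀).symmL ℝ x w)
    rw [(trivializationAt F (TangentSpace J) x₀).symmL_apply hx,
      (trivializationAt F (TangentSpace J) x₀).symmL_apply hx]
  have h1 : ContMDiffWithinAt J J ∞ (fun x : W ↦ x) S x₀ := contMDiffWithinAt_id
  refine (and_iff_right h1).trans ⟨fun h ↦ ?_, fun h ↦ ?_⟩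
  · refine h.congr_of_eventuallyEq ?_ (key _ (mem_chart_source K x₀)).symm
    filter_upwards [nhdsWithin_le_nhds ((chartAt K x₀).open_source.mem_nhds (mem_chart_source K x₀))]
      with x hx using (key x hx).symm
  · refine h.congr_of_eventuallyEq ?_ (key _ (mem_chart_source K x₀))
    filter_upwards [nhdsWithin_le_nhds ((chartAt K x₀).open_source.mem_nhds (mem_chart_source K x₀))]
      with x hx using (key x hx)

omit [IsManifold J ∞ W] in
theorem contDiff_bilinearComp {E V : Type*} [NormedAddCommGroup E] [NormedSpace ℝ E]
    [NormedAddCommGroup V] [NormedSpace ℝ V] :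
    ContDiff ℝ ∞ (fun p : (V →L[ℝ] V →L[ℝ] ℝ) × (E →L[ℝ] V) ↦ p.1.bilinearComp p.2 p.2) := by
  have h : (fun p : (V →L[ℝ] V →L[ℝ] ℝ) × (E →L[ℝ] V) ↦ p.1.bilinearComp p.2 p.2) =
      fun p ↦ (ContinuousLinearMap.flipₗᵢ ℝ E E ℝ)
        (((ContinuousLinearMap.flipₗᵢ ℝ E V ℝ) (p.1.comp p.2)).comp p.2) := by
    ext p v w
    rfl
  rw [h]
  fun_prop

variable (J) in
/-- Smoothness at `x₀` of a field of bilinear forms on the tangent spaces, expressed in the frame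
at `x₀`. -/
def SmoothFormAt (L : W → F →L[ℝ] F →L[ℝ] ℝ) (x₀ : W) : Prop :=
  ContMDiffAt J 𝓘(ℝ, F →L[ℝ] F →L[ℝ] ℝ) ∞
    (fun x ↦ (L x).bilinearComp (frame J x₀ x) (frame J x₀ x)) x₀

variable (J) in
/-- Smoothness at `x₀` of a vector field, expressed in the frame at `x₀`. -/
def SmoothFieldAt (X : W → F) (x₀ : W) : Prop :=
  ContMDiffAt J 𝓘(ℝ, F) ∞ (fun x ↦ coframe J x₀ x (X x)) x₀

theorem eventually_frame_coframe (x₀ : W) :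
    ∀ᶠ x in 𝓝 x₀, (frame J x₀ x).comp (coframe J x₀ x) = ContinuousLinearMap.id ℝ F ∧
      (coframe J x₀ x).comp (frame J x₀ x) = ContinuousLinearMap.id ℝ F := by
  filter_upwards [(chartAt K x₀).open_source.mem_nhds (mem_chart_source K x₀)] with x hx
  exact ⟨ContinuousLinearMap.ext (frame_coframe hx), ContinuousLinearMap.ext (coframe_frame hx)⟩

theorem smoothFormAt_pullback {V : Type*} [NormedAddCommGroup V] [NormedSpace ℝ V]
    {f : W → V} {x₀ : W} (hf : ContMDiffAt J 𝓘(ℝ, V) ∞ f x₀) {B : W → V →L[ℝ] V →L[ℝ] ℝ}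
    (hB : ContMDiffAt J 𝓘(ℝ, V →L[ℝ] V →L[ℝ] ℝ) ∞ B x₀) :
    SmoothFormAt J (fun x ↦ (B x).bilinearComp (vdiff J f x) (vdiff J f x)) x₀ := by
  have h := (contDiff_bilinearComp (E := F) (V := V)).contMDiff.contMDiffAt.comp x₀
    (hB.prodMk_space (contMDiffAt_vdiff_frame hf))
  refine h.congr_of_eventuallyEq (Filter.Eventually.of_forall fun x ↦ ?_)
  ext v w
  rfl

theorem SmoothFieldAt.contMDiffAt_vdiff {V : Type*} [NormedAddCommGroup V] [NormedSpace ℝ V]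
    {f : W → V} {X : W → F} {x₀ : W} (hf : ContMDiffAt J 𝓘(ℝ, V) ∞ f x₀)
    (hX : SmoothFieldAt J X x₀) : ContMDiffAt J 𝓘(ℝ, V) ∞ (fun x ↦ vdiff J f x (X x)) x₀ := by
  refine (ContMDiffAt.clm_apply (contMDiffAt_vdiff_frame hf) hX).congr_of_eventuallyEq ?_
  filter_upwards [eventually_frame_coframe (J := J) x₀] with x hx
  exact congrArg (vdiff J f x) (DFunLike.congr_fun hx.1 (X x)).symm

theorem SmoothFieldAt.sub_smul {X Y : W → F} {c : W → ℝ} {x₀ : W} (hX : SmoothFieldAt J X x₀)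
    (hY : SmoothFieldAt J Y x₀) (hc : ContMDiffAt J 𝓘(ℝ, ℝ) ∞ c x₀) :
    SmoothFieldAt J (fun x ↦ X x - c x • Y x) x₀ := by
  have h := ContMDiffAt.sub hX (hc.smul hY)
  refine h.congr_of_eventuallyEq (Filter.Eventually.of_forall fun x ↦ ?_)
  simp

/-- A field which solves `L X = α`, where the bilinear forms `L x` are invertible and both `L` and
`α` depend smoothly on the point, is smooth. -/
theorem SmoothFieldAt.of_form [FiniteDimensional ℝ F] {X : W → F} {L : W → F →L[ℝ] F →L[ℝ] ℝ}
    {α : W → F →L[ℝ] ℝ} {x₀ : W} (hL : SmoothFormAt J L x₀)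
    (hα : ContMDiffAt J 𝓘(ℝ, F →L[ℝ] ℝ) ∞ (fun x ↦ (α x).comp (frame J x₀ x)) x₀)
    (hX : ∀ x, L x (X x) = α x) (hinv : ∀ x v, L x v = 0 → v = 0) : SmoothFieldAt J X x₀ := by
  have : CompleteSpace F := FiniteDimensional.complete ℝ F
  have hinj : ∀ x, (frame J x₀ x).comp (coframe J x₀ x) = ContinuousLinearMap.id ℝ F ∧
      (coframe J x₀ x).comp (frame J x₀ x) = ContinuousLinearMap.id ℝ F →
      ((L x).bilinearComp (frame J x₀ x) (frame J x₀ x)).IsInvertible := by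
    rintro x ⟨h1, h2⟩
    refine isInvertible_of_injective _ fun v hv ↦ ?_
    have h3 : L x (frame J x₀ x v) = 0 := by
      ext w
      have h4 := DFunLike.congr_fun hv (coframe J x₀ x w)
      have h5 : frame J x₀ x (coframe J x₀ x w) = w := DFunLike.congr_fun h1 w
      simpa [h5] using h4
    have h6 := hinv x _ h3
    have h7 : coframe J x₀ x (frame J x₀ x v) = v := DFunLike.congr_fun h2 v
    rw [← h7, h6, map_zero]
  have hsm := (ContinuousLinearMap.IsInvertible.contDiffAt_map_inverse (n := ∞)
    (hinj x₀ (eventually_frame_coframe x₀).self_of_nhds)).contMDiffAt.comp x₀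
      (f := fun x ↦ (L x).bilinearComp (frame J x₀ x) (frame J x₀ x)) hL
  refine (hsm.clm_apply hα).congr_of_eventuallyEq ?_
  filter_upwards [eventually_frame_coframe (J := J) x₀] with x hx
  have h5 : frame J x₀ x (coframe J x₀ x (X x)) = X x := DFunLike.congr_fun hx.1 (X x)
  have h8 : (α x).comp (frame J x₀ x) =
      (L x).bilinearComp (frame J x₀ x) (frame J x₀ x) (coframe J x₀ x (X x)) := by
    ext w
    simp [h5, hX]
  simp only [h8, Function.comp_apply]
  exact ((hinj x hx).inverse_apply_self _).symm

end Frames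

/-! ### Lyapunov functions -/

section LyapForm

variable {F : Type*} [NormedAddCommGroup F] [NormedSpace ℝ F]

/-- Given a covector `α`, a vector `X` with `α X > 0` and a positive form `G`, the positive form
`α ⊗ α / α X + P^* G`, where `P` is the projection to `ker α` along `X`. It sends `X` to `α`. -/
def lyapForm (α : F →L[ℝ] ℝ) (X : F) (G : F →L[ℝ] F →L[ℝ] ℝ) : F →L[ℝ] F →L[ℝ] ℝ :=
  (α X)⁻¹ • α.smulRight α + G.bilinearComp
    (ContinuousLinearMap.id ℝ F - (α X)⁻¹ • α.smulRight X)
    (ContinuousLinearMap.id ℝ F - (α X)⁻¹ • α.smulRight X)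

theorem lyapForm_apply (α : F →L[ℝ] ℝ) (X : F) (G : F →L[ℝ] F →L[ℝ] ℝ) (u w : F) :
    lyapForm α X G u w = (α X)⁻¹ * (α u * α w) +
      G (u - (α X)⁻¹ • α u • X) (w - (α X)⁻¹ • α w • X) := by
  simp [lyapForm]

theorem lyapForm_apply_self {α : F →L[ℝ] ℝ} {X : F} (G : F →L[ℝ] F →L[ℝ] ℝ) (h : α X ≠ 0) :
    lyapForm α X G X = α := by
  ext w
  rw [lyapForm_apply, smul_smul, inv_mul_cancel₀ h]
  simp [h]

theorem lyapForm_pos {α : F →L[ℝ] ℝ} {X : F} {G : F →L[ℝ] F →L[ℝ] ℝ} (h : 0 < α X)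
    (hG : ∀ v, v ≠ 0 → 0 < G v v) {η : F} (hη : η ≠ 0) : 0 < lyapForm α X G η η := by
  have hG' : ∀ v, 0 ≤ G v v := fun v ↦ by
    rcases eq_or_ne v 0 with rfl | hv
    · simp
    · exact (hG v hv).le
  rw [lyapForm_apply]
  rcases eq_or_ne (α η) 0 with h0 | h0
  · simpa [h0] using hG η hη
  · have := hG' (η - (α X)⁻¹ • α η • X)
    have h2 : 0 < (α X)⁻¹ * (α η * α η) := mul_pos (inv_pos.2 h) (mul_self_pos.2 h0)
    linarith

theorem contDiff_smulRight (F V : Type*) [NormedAddCommGroup F] [NormedSpace ℝ F]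
    [NormedAddCommGroup V] [NormedSpace ℝ V] :
    ContDiff ℝ ∞ (fun p : (F →L[ℝ] ℝ) × V ↦ p.1.smulRight p.2) := by
  have h : IsBoundedBilinearMap ℝ (fun p : (F →L[ℝ] ℝ) × V ↦ p.1.smulRight p.2) :=
    isBoundedBilinearMap_smulRight
  exact h.contDiff

theorem contMDiffAt_lyapForm {E : Type*} [NormedAddCommGroup E] [NormedSpace ℝ E]
    {K : Type*} [TopologicalSpace K] {J : ModelWithCorners ℝ E K}
    {W : Type*} [TopologicalSpace W] [ChartedSpace K W] {α : W → F →L[ℝ] ℝ} {X : W → F}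
    {G : W → F →L[ℝ] F →L[ℝ] ℝ} {x₀ : W} (hα : ContMDiffAt J 𝓘(ℝ, F →L[ℝ] ℝ) ∞ α x₀)
    (hX : ContMDiffAt J 𝓘(ℝ, F) ∞ X x₀) (hG : ContMDiffAt J 𝓘(ℝ, F →L[ℝ] F →L[ℝ] ℝ) ∞ G x₀)
    (h : α x₀ (X x₀) ≠ 0) :
    ContMDiffAt J 𝓘(ℝ, F →L[ℝ] F →L[ℝ] ℝ) ∞ (fun x ↦ lyapForm (α x) (X x) (G x)) x₀ := by
  have h1 : ContMDiffAt J 𝓘(ℝ, ℝ) ∞ (fun x ↦ (α x (X x))⁻¹) x₀ :=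
    (contDiffAt_inv ℝ h).contMDiffAt.comp x₀ (hα.clm_apply hX)
  have h2 := (contDiff_smulRight F F).contMDiff.contMDiffAt.comp x₀ (hα.prodMk_space hX)
  have h3 := (contDiff_smulRight F (F →L[ℝ] ℝ)).contMDiff.contMDiffAt.comp x₀
    (hα.prodMk_space hα)
  have h4 : ContMDiffAt J 𝓘(ℝ, F →L[ℝ] F) ∞
      (fun x ↦ ContinuousLinearMap.id ℝ F - (α x (X x))⁻¹ • (α x).smulRight (X x)) x₀ :=
    contMDiffAt_const.sub (h1.smul h2)
  have h5 : ContMDiffAt J 𝓘(ℝ, F →L[ℝ] F →L[ℝ] ℝ) ∞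
      (fun x ↦ (α x (X x))⁻¹ • (α x).smulRight (α x)) x₀ := h1.smul h3
  have h6 := (contDiff_bilinearComp (E := F) (V := F)).contMDiff.contMDiffAt.comp x₀
    (hG.prodMk_space h4)
  exact h5.add h6

theorem lyapForm_bilinearComp {α : F →L[ℝ] ℝ} {X : F} {G : F →L[ℝ] F →L[ℝ] ℝ}
    {S T : F →L[ℝ] F}
    (h : S.comp T = ContinuousLinearMap.id ℝ F) :
    (lyapForm α X G).bilinearComp S S = lyapForm (α.comp S) (T X) (G.bilinearComp S S) := by
  have h1 : ∀ v, S (T v) = v := fun v ↦ DFunLike.congr_fun h v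
  ext u w
  simp [lyapForm_apply, h1]

/-- A finite-dimensional space has a positive definite form. -/
theorem exists_posForm (F : Type*) [NormedAddCommGroup F] [NormedSpace ℝ F]
    [FiniteDimensional ℝ F] : ∃ G : F →L[ℝ] F →L[ℝ] ℝ, ∀ v, v ≠ 0 → 0 < G v v := by
  refine ⟨(innerSL ℝ : EuclideanSpace ℝ (Fin (Module.finrank ℝ F)) →L[ℝ] _).bilinearComp
    (toEuclidean (E := F)).toContinuousLinearMap (toEuclidean (E := F)).toContinuousLinearMap,
    fun v hv ↦ ?_⟩
  simp [hv]

end LyapForm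

section Lyapunov

variable {F : Type*} [NormedAddCommGroup F] [NormedSpace ℝ F] [FiniteDimensional ℝ F]
  {K : Type*} [TopologicalSpace K] {J : ModelWithCorners ℝ F K}
  {W : Type*} [TopologicalSpace W] [ChartedSpace K W] [IsManifold J ∞ W]

omit [FiniteDimensional ℝ F] in
theorem smoothFormAt_lyapForm {α : W → F →L[ℝ] ℝ} {X : W → F} {G : W → F →L[ℝ] F →L[ℝ] ℝ}
    {x₀ : W}
    (hα : ContMDiffAt J 𝓘(ℝ, F →L[ℝ] ℝ) ∞ (fun x ↦ (α x).comp (frame J x₀ x)) x₀)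
    (hX : SmoothFieldAt J X x₀) (hG : SmoothFormAt J G x₀) (h : α x₀ (X x₀) ≠ 0) :
    SmoothFormAt J (fun x ↦ lyapForm (α x) (X x) (G x)) x₀ := by
  have h1 := (eventually_frame_coframe (J := J) x₀).self_of_nhds
  have h2 : (α x₀).comp (frame J x₀ x₀) (coframe J x₀ x₀ (X x₀)) ≠ 0 := by
    have : frame J x₀ x₀ (coframe J x₀ x₀ (X x₀)) = X x₀ := DFunLike.congr_fun h1.1 (X x₀)
    simpa [this] using h
  have h3 := contMDiffAt_lyapForm hα hX hG h2
  refine h3.congr_of_eventuallyEq ?_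
  filter_upwards [eventually_frame_coframe (J := J) x₀] with x hx
  exact lyapForm_bilinearComp hx.1

/-- Where `X · f > 0`, there is locally a positive form which sends `X` to `df`. -/
theorem exists_lyapForm_of_pos {U : Set W} (hU : IsOpen U) {f : W → ℝ} {X : W → F}
    (hf : ∀ x ∈ U, ContMDiffAt J 𝓘(ℝ, ℝ) ∞ f x) (hX : ∀ x ∈ U, SmoothFieldAt J X x)
    (hpos : ∀ x ∈ U, 0 < vdiff J f x (X x)) {x₀ : W} (hx₀ : x₀ ∈ U) :
    ∃ V ∈ 𝓝 x₀, ∃ L : W → F →L[ℝ] F →L[ℝ] ℝ, ∀ x ∈ V, SmoothFormAt J L x ∧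
      (∀ η, η ≠ 0 → 0 < L x η η) ∧ L x (X x) = vdiff J f x := by
  obtain ⟨G, hG⟩ := exists_posForm F
  refine ⟨U ∩ (chartAt K x₀).source, Filter.inter_mem (hU.mem_nhds hx₀)
    ((chartAt K x₀).open_source.mem_nhds (mem_chart_source K x₀)),
    fun x ↦ lyapForm (vdiff J f x) (X x)
      (G.bilinearComp (vdiff J (extChartAt J x₀) x) (vdiff J (extChartAt J x₀) x)), ?_⟩
  rintro x ⟨hxU, hx⟩
  refine ⟨smoothFormAt_lyapForm (contMDiffAt_vdiff_frame (hf x hxU)) (hX x hxU)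
    (smoothFormAt_pullback (contMDiffAt_extChartAt' hx) contMDiffAt_const) (hpos x hxU).ne',
    fun η hη ↦ lyapForm_pos (hpos x hxU) (fun v hv ↦ ?_) hη,
    lyapForm_apply_self _ (hpos x hxU).ne'⟩
  refine hG _ fun h ↦ hv ?_
  have h1 := TangentBundle.continuousLinearMapAt_trivializationAt (I := J) hx
  have h2 : coframe (W := W) J x₀ x v = 0 := by
    rw [coframe, h1]
    exact h
  rw [← frame_coframe (J := J) hx v, h2, map_zero]

set_option maxHeartbeats 1600000 in
set_option synthInstance.maxHeartbeats 400000 in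
/-- Lyapunov functions are recognized locally: the conditions on the form `L x` are convex, so that
local solutions can be glued with a partition of unity. -/
theorem isLyapunovOn_of_local [T2Space W] [SigmaCompactSpace W] {S : Set W} (hS : IsClosed S)
    {TS : ∀ x : W, Submodule ℝ (TangentSpace J x)} {X : ∀ x : W, TangentSpace J x} {f : W → ℝ}
    (hf : ContMDiff J 𝓘(ℝ, ℝ) ∞ f) (hX : ∀ x ∈ S, X x ∈ TS x)
    (hloc : ∀ x₀ ∈ S, ∃ V ∈ 𝓝 x₀, ∃ L : W → F →L[ℝ] F →L[ℝ] ℝ, ∀ x ∈ V, SmoothFormAt J L x ∧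
      (x ∈ S → (∀ η ∈ TS x, η ≠ 0 → 0 < L x η η) ∧ ∀ w ∈ TS x, L x (X x) w = vdiff J f x w)) :
    IsLyapunovOn S TS X f := by
  refine ⟨hf.contMDiffOn, hX, ?_⟩
  have hconv : ∀ x, Convex ℝ {L : TangentSpace J x →L[ℝ] TangentSpace J x →L[ℝ] ℝ | x ∈ S →
      (∀ η ∈ TS x, η ≠ 0 → 0 < L η η) ∧ ∀ w ∈ TS x, L (X x) w = diff J f x w} := by
    intro x L₁ h₁ L₂ h₂ a b ha hb hab hx
    obtain ⟨p₁, e₁⟩ := h₁ hx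
    obtain ⟨p₂, e₂⟩ := h₂ hx
    refine ⟨fun η hη h0 ↦ ?_, fun w hw ↦ ?_⟩
    · change 0 < a * L₁ η η + b * L₂ η η
      have q₁ := p₁ η hη h0
      have q₂ := p₂ η hη h0
      rcases ha.eq_or_lt with rfl | ha
      · have : b = 1 := by linarith
        simpa [this] using q₂
      · have := mul_pos ha q₁
        have := mul_nonneg hb q₂.le
        linarith
    · change a * L₁ (X x) w + b * L₂ (X x) w = _
      rw [e₁ w hw, e₂ w hw, ← add_mul, hab, one_mul]
  obtain ⟨s, hs⟩ := exists_contMDiffSection_forall_mem_convex_of_local J (n := ⊤)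
    (F_fiber := F →L[ℝ] F →L[ℝ] ℝ)
    (fun x : W ↦ TangentSpace J x →L[ℝ] TangentSpace J x →L[ℝ] ℝ) _ hconv (by
    intro x₀
    by_cases hx₀ : x₀ ∈ S
    · obtain ⟨V, hV, L, hL⟩ := hloc x₀ hx₀
      exact ⟨V, hV, L, fun x hx ↦ contMDiffWithinAt_bilin_iff.2 (hL x hx).1.contMDiffWithinAt,
        fun x hx ↦ (hL x hx).2⟩
    · refine ⟨Sᶜ, hS.isOpen_compl.mem_nhds hx₀, fun x ↦ (0 : F →L[ℝ] F →L[ℝ] ℝ), fun x _ ↦ ?_,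
        fun x hx h ↦ absurd h hx⟩
      refine contMDiffWithinAt_bilin_iff.2 ?_
      refine (contMDiffWithinAt_const (c := (0 : F →L[ℝ] F →L[ℝ] ℝ))).congr (fun y _ ↦ ?_) ?_ <;>
      · ext v w
        rfl)
  exact ⟨s, s.contMDiff.contMDiffOn, fun x hx ↦ (hs x hx).1, fun x hx ↦ (hs x hx).2⟩

end Lyapunov

/-! ### Coordinates on the cotangent bundle -/

section Cotangent

variable {n : ℕ} {H : Type*} [TopologicalSpace H] {I : ModelWithCorners ℝ (Coord n) H}
  {M : Type*} [TopologicalSpace M] [ChartedSpace H M] [IsManifold I ∞ M]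

/-- The covector of a point of `T*M`, seen through the preferred chart at its base point. -/
def fib (x : Cotangent I M) : Coord n →L[ℝ] ℝ := x.2

/-- The point `(q, p)` of `T*M`. -/
def cov (q : M) (p : Coord n →L[ℝ] ℝ) : Cotangent I M := ⟨q, p⟩

theorem cov_fib (x : Cotangent I M) : cov x.1 (fib x) = x := rfl

@[simp] theorem cov_proj (q : M) (p : Coord n →L[ℝ] ℝ) : (cov q p : Cotangent I M).1 = q := rfl

@[simp] theorem fib_cov (q : M) (p : Coord n →L[ℝ] ℝ) : fib (cov q p : Cotangent I M) = p := rfl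

theorem cotangent_trivializationAt_apply (q₀ : M) (x : Cotangent I M) :
    trivializationAt (Coord n →L[ℝ] ℝ) (fun q : M ↦ TangentSpace I q →L[ℝ] ℝ) q₀ x =
      (x.1, (fib x).comp (frame I q₀ x.1)) := by
  rw [hom_trivializationAt_apply]
  refine Prod.ext rfl ?_
  ext v
  simp [ContinuousLinearMap.inCoordinates, frame, fib]
  rfl

theorem mem_cotangent_chart_source {x₀ x : Cotangent I M} :
    x ∈ (chartAt (ModelProd H (Coord n →L[ℝ] ℝ)) x₀).source ↔ x.1 ∈ (chartAt H x₀.1).source := by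
  rw [FiberBundle.chartedSpace_chartAt]
  simp only [mfld_simps]
  refine ⟨fun h ↦ h.1.1, fun h ↦ ⟨⟨h, mem_univ _⟩, ?_⟩⟩
  rwa [cotangent_trivializationAt_apply]

theorem cotangent_extChartAt_apply (x₀ x : Cotangent I M) :
    extChartAt (coModel I) x₀ x = (extChartAt I x₀.1 x.1, (fib x).comp (frame I x₀.1 x.1)) := by
  rw [FiberBundle.extChartAt]
  simp [cotangent_trivializationAt_apply]

/-- A map to `T*M` is smooth when its projection to `M` is, as well as its covector component in a
frame of the base. -/
theorem contMDiffWithinAt_cotangent {E : Type*} [NormedAddCommGroup E] [NormedSpace ℝ E]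
    {K : Type*} [TopologicalSpace K] {J : ModelWithCorners ℝ E K}
    {N : Type*} [TopologicalSpace N] [ChartedSpace K N] {f : N → Cotangent I M} {s : Set N} {z : N} :
    ContMDiffWithinAt J (coModel I) ∞ f s z ↔ ContMDiffWithinAt J I ∞ (fun y ↦ (f y).1) s z ∧
      ContMDiffWithinAt J 𝓘(ℝ, Coord n →L[ℝ] ℝ) ∞
        (fun y ↦ (fib (f y)).comp (frame I (f z).1 (f y).1)) s z := by
  rw [contMDiffWithinAt_totalSpace]
  simp only [cotangent_trivializationAt_apply]

theorem smoothFieldAt_of_contMDiff {ν : ∀ q : M, TangentSpace I q}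
    (hν : ContMDiff I I.tangent ∞ (fun q ↦ (⟨q, ν q⟩ : TangentBundle I M))) (q₀ : M) :
    SmoothFieldAt I (W := M) ν q₀ := by
  have h := (contMDiffAt_totalSpace.1 (hν q₀)).2
  refine h.congr_of_eventuallyEq ?_
  filter_upwards [(chartAt H q₀).open_source.mem_nhds (mem_chart_source H q₀)] with q hq
  have h1 := Trivialization.coe_linearMapAt_of_mem (R := ℝ)
    (trivializationAt (Coord n) (TangentSpace I) q₀) hq
  exact congrFun h1 (ν q)

theorem contMDiff_proj_cotangent :
    ContMDiff (coModel I) I ∞ (fun x : Cotangent I M ↦ x.1) :=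
  contMDiff_proj (F := Coord n →L[ℝ] ℝ) (fun q : M ↦ TangentSpace I q →L[ℝ] ℝ)

theorem contMDiffAt_fib_frame (x₀ : Cotangent I M) :
    ContMDiffAt (coModel I) 𝓘(ℝ, Coord n →L[ℝ] ℝ) ∞
      (fun x : Cotangent I M ↦ (fib x).comp (frame I x₀.1 x.1)) x₀ :=
  (contMDiffWithinAt_cotangent.1 (contMDiffAt_id (x := x₀)).contMDiffWithinAt).2.contMDiffAt
    Filter.univ_mem

/-- The function `⟨p, ν⟩` on `T*M`. -/
def mom (ν : M → Coord n) (x : Cotangent I M) : ℝ := fib x (ν x.1)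

theorem contMDiff_mom {ν : M → Coord n} (hν : ∀ q, SmoothFieldAt I ν q) :
    ContMDiff (coModel I) 𝓘(ℝ, ℝ) ∞ (mom ν : Cotangent I M → ℝ) := by
  intro x₀
  have h1 := ContMDiffAt.comp x₀ (hν x₀.1) contMDiff_proj_cotangent.contMDiffAt
  refine ((contMDiffAt_fib_frame x₀).clm_apply h1).congr_of_eventuallyEq ?_
  have h2 := contMDiff_proj_cotangent.continuous.continuousAt.eventually
    (eventually_frame_coframe (J := I) x₀.1)
  filter_upwards [h2] with x hx
  exact congrArg (fib x) (DFunLike.congr_fun hx.1 (ν x.1)).symm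

/-- The metric `g` as a field of bilinear forms on the coordinate space. -/
def gform (g : Metric I (M := M)) (q : M) : Coord n →L[ℝ] Coord n →L[ℝ] ℝ := g.inner q

/-- The vector `p♯` metrically dual to the covector `p`. -/
def gsharp (g : Metric I (M := M)) (x : Cotangent I M) : Coord n := sharp g x.1 x.2

theorem gform_gsharp (g : Metric I (M := M)) (x : Cotangent I M) :
    gform g x.1 (gsharp g x) = fib x := inner_sharp g x.1 x.2

theorem kinetic_eq_gsharp (g : Metric I (M := M)) (x : Cotangent I M) :
    kinetic g x = 1 / 2 * fib x (gsharp g x) := rfl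

theorem gform_symm (g : Metric I (M := M)) (q : M) (v w : Coord n) :
    gform g q v w = gform g q w v := g.symm q v w

theorem gform_pos (g : Metric I (M := M)) (q : M) {v : Coord n} (hv : v ≠ 0) :
    0 < gform g q v v := g.pos q v hv

theorem gform_injective (g : Metric I (M := M)) (q : M) (v : Coord n) (h : gform g q v = 0) :
    v = 0 := by
  by_contra hv
  exact (gform_pos g q hv).ne' (DFunLike.congr_fun h v)

theorem gsharp_eq (g : Metric I (M := M)) (x : Cotangent I M) {v : Coord n}
    (h : gform g x.1 v = fib x) : gsharp g x = v := by
  refine sub_eq_zero.1 (gform_injective g x.1 _ ?_)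
  rw [map_sub, gform_gsharp, h, sub_self]

theorem smoothFormAt_gform (g : Metric I (M := M)) (q₀ : M) : SmoothFormAt I (gform g) q₀ :=
  (contMDiffWithinAt_bilin_iff.1 (g.contMDiff q₀).contMDiffWithinAt).contMDiffAt Filter.univ_mem

theorem isInvertible_bilinearComp (B : Coord n →L[ℝ] Coord n →L[ℝ] ℝ)
    (hB : ∀ v, v ≠ 0 → 0 < B v v)
    {S T : Coord n →L[ℝ] Coord n} (h : T.comp S = ContinuousLinearMap.id ℝ (Coord n)) :
    (B.bilinearComp S S).IsInvertible := by
  refine isInvertible_of_injective _ fun v hv ↦ ?_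
  by_contra h0
  have h1 : S v ≠ 0 := fun h2 ↦ h0 (by
    have h3 : T (S v) = v := DFunLike.congr_fun h v
    rw [← h3, h2, map_zero])
  exact (hB _ h1).ne' (DFunLike.congr_fun hv v)

/-- The covector `p` pulled back by a frame and the metric in that frame determine `ρ`. -/
theorem kinetic_eq (g : Metric I (M := M)) (x : Cotangent I M) {S T : Coord n →L[ℝ] Coord n}
    (h : S.comp T = ContinuousLinearMap.id ℝ (Coord n))
    (h' : T.comp S = ContinuousLinearMap.id ℝ (Coord n)) :
    kinetic g x = 1 / 2 * ((fib x).comp S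
      (((gform g x.1).bilinearComp S S).inverse ((fib x).comp S))) := by
  have hinv := isInvertible_bilinearComp (gform g x.1) (fun v ↦ gform_pos g x.1) h'
  have h1 := hinv.self_apply_inverse ((fib x).comp S)
  set v := ((gform g x.1).bilinearComp S S).inverse ((fib x).comp S)
  have h2 : gsharp g x = S v := by
    refine gsharp_eq g x (ContinuousLinearMap.ext fun w ↦ ?_)
    have h3 : S (T w) = w := DFunLike.congr_fun h w
    have h4 := DFunLike.congr_fun h1 (T w)
    simpa [h3] using h4
  rw [kinetic_eq_gsharp, h2]
  rfl

theorem contMDiff_kinetic (g : Metric I (M := M)) :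
    ContMDiff (coModel I) 𝓘(ℝ, ℝ) ∞ (kinetic g) := by
  intro x₀
  have h0 := eventually_frame_coframe (J := I) x₀.1
  have h1 := (smoothFormAt_gform g x₀.1).comp x₀ contMDiff_proj_cotangent.contMDiffAt
  have h2 := (ContinuousLinearMap.IsInvertible.contDiffAt_map_inverse (n := ∞)
    (isInvertible_bilinearComp (gform g x₀.1) (fun v ↦ gform_pos g x₀.1)
      h0.self_of_nhds.2)).contMDiffAt.comp x₀ h1
  have h3 := contMDiffAt_fib_frame x₀
  have h4 : ContMDiffAt (coModel I) 𝓘(ℝ, ℝ) ∞ (fun _ : Cotangent I M ↦ (1 / 2 : ℝ)) x₀ :=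
    contMDiffAt_const
  refine (h4.mul (h3.clm_apply (h2.clm_apply h3))).congr_of_eventuallyEq ?_
  filter_upwards [contMDiff_proj_cotangent.continuous.continuousAt.eventually h0] with x hx
  exact kinetic_eq g x hx.1 hx.2

end Cotangent

section CotangentChart

variable {n : ℕ} {H : Type*} [TopologicalSpace H] {I : ModelWithCorners ℝ (Coord n) H}
  {M : Type*} [TopologicalSpace M] [ChartedSpace H M] [IsManifold I ∞ M]

variable (I) in
/-- The inverse of the preferred chart of `T*M` at the points over `q`: it sends `(y, p)` to the
covector at `E⁻¹ y` with components `p`, where `E` is the preferred chart of `M` at `q`. -/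
def coChartSymm (q : M) (z : Coord n × (Coord n →L[ℝ] ℝ)) : Cotangent I M :=
  cov ((extChartAt I q).symm z.1) (z.2.comp (coframe I q ((extChartAt I q).symm z.1)))

theorem coChartSymm_self (q : M) (p : Coord n →L[ℝ] ℝ) :
    coChartSymm I q (extChartAt I q q, p) = cov q p := by
  have h : (extChartAt I q).symm (extChartAt I q q) = q :=
    (extChartAt I q).left_inv (mem_extChartAt_source q)
  simp only [coChartSymm]
  rw [h]
  congr 1
  ext v
  exact congrArg p (coframe_self q v)

theorem extChartAt_symm_cotangent (x : Cotangent I M) {z : Coord n × (Coord n →L[ℝ] ℝ)}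
    (hz : z.1 ∈ (extChartAt I x.1).target) :
    (extChartAt (coModel I) x).symm z = coChartSymm I x.1 z := by
  have h1 : (extChartAt I x.1).symm z.1 ∈ (chartAt H x.1).source := by
    rw [← extChartAt_source I]
    exact (extChartAt I x.1).map_target hz
  have h2 : coChartSymm I x.1 z ∈ (extChartAt (coModel I) x).source := by
    rw [extChartAt_source, mem_cotangent_chart_source]
    exact h1
  have h3 : extChartAt (coModel I) x (coChartSymm I x.1 z) = z := by
    rw [cotangent_extChartAt_apply]
    refine Prod.ext ((extChartAt I x.1).right_inv hz) ?_
    ext v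
    exact congrArg z.2 (coframe_frame h1 v)
  rw [← h3, (extChartAt (coModel I) x).left_inv h2, h3]

theorem range_coModel : range (coModel I) = range I ×ˢ (univ : Set (Coord n →L[ℝ] ℝ)) := by
  rw [ModelWithCorners.range_prod]
  simp

theorem extChartAt_self_cotangent (x : Cotangent I M) :
    extChartAt (coModel I) x x = (extChartAt I x.1 x.1, fib x) := by
  rw [cotangent_extChartAt_apply]
  congr 1
  ext v
  exact congrArg (fib x) (frame_self x.1 v)

/-- The differential of a function on `T*M`, read in the preferred chart. -/
theorem hasFDerivWithinAt_cotangent {V : Type*} [NormedAddCommGroup V] [NormedSpace ℝ V]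
    {f : Cotangent I M → V} {x : Cotangent I M} (hf : MDifferentiableAt (coModel I) 𝓘(ℝ, V) f x) :
    HasFDerivWithinAt (f ∘ coChartSymm I x.1) (vdiff (coModel I) f x)
      (range I ×ˢ (univ : Set (Coord n →L[ℝ] ℝ))) (extChartAt I x.1 x.1, fib x) := by
  have h := hf.hasMFDerivAt.2
  rw [extChartAt_self_cotangent, range_coModel] at h
  refine h.congr_of_eventuallyEq ?_ ?_
  · have h1 : (extChartAt I x.1).target ×ˢ (univ : Set (Coord n →L[ℝ] ℝ)) ∈
        𝓝[range I ×ˢ (univ : Set (Coord n →L[ℝ] ℝ))] (extChartAt I x.1 x.1, fib x) := by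
      rw [nhdsWithin_prod_eq, nhdsWithin_univ]
      exact Filter.prod_mem_prod (extChartAt_target_mem_nhdsWithin x.1) Filter.univ_mem
    filter_upwards [h1] with z hz
    rw [Function.comp_apply, ← extChartAt_symm_cotangent x hz.1]
    rfl
  · rw [Function.comp_apply, ← extChartAt_symm_cotangent x (mem_extChartAt_target x.1)]
    rfl

theorem uniqueDiffWithinAt_range_prod (x : Cotangent I M) :
    UniqueDiffWithinAt ℝ (range I ×ˢ (univ : Set (Coord n →L[ℝ] ℝ)))
      (extChartAt I x.1 x.1, fib x) :=
  (I.uniqueDiffOn.prod uniqueDiffOn_univ) _ ⟨extChartAt_target_subset_range x.1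
    (mem_extChartAt_target x.1), mem_univ _⟩

omit [IsManifold I ∞ M] in
/-- The differential of a function on `M`, read in the preferred chart. -/
theorem hasFDerivWithinAt_base {V : Type*} [NormedAddCommGroup V] [NormedSpace ℝ V]
    {f : M → V} {q : M} (hf : MDifferentiableAt I 𝓘(ℝ, V) f q) :
    HasFDerivWithinAt (f ∘ (extChartAt I q).symm) (vdiff I f q) (range I) (extChartAt I q q) :=
  hf.hasMFDerivAt.2

/-- The derivative of a function along the fibres of `T*M`. -/
theorem hasDerivAt_fibre {V : Type*} [NormedAddCommGroup V] [NormedSpace ℝ V]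
    {f : Cotangent I M → V} {x : Cotangent I M} (hf : MDifferentiableAt (coModel I) 𝓘(ℝ, V) f x)
    (p : Coord n →L[ℝ] ℝ) :
    HasDerivAt (fun t : ℝ ↦ f (cov x.1 (fib x + t • p))) (vdiff (coModel I) f x (0, p)) 0 := by
  have h := hasFDerivWithinAt_cotangent hf
  have h0 : ((extChartAt I x.1 x.1, fib x) : Coord n × (Coord n →L[ℝ] ℝ)) =
      (fun t : ℝ ↦ (extChartAt I x.1 x.1, fib x + t • p)) 0 := by simp
  rw [h0] at h
  have h1 : HasDerivAt (fun t : ℝ ↦ (extChartAt I x.1 x.1, fib x + t • p)) (0, p) 0 := by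
    refine (hasDerivAt_const _ _).prodMk ?_
    simpa using ((hasDerivAt_id (0 : ℝ)).smul_const p).const_add (fib x)
  have h2 := h.comp_hasDerivAt_of_eq (0 : ℝ) h1 (Filter.Eventually.of_forall fun t ↦
    ⟨extChartAt_target_subset_range x.1 (mem_extChartAt_target x.1), mem_univ _⟩) rfl
  refine h2.congr_of_eventuallyEq (Filter.Eventually.of_forall fun t ↦ ?_)
  simp only [Function.comp_apply, coChartSymm_self]

theorem vdiff_comp_proj {V : Type*} [NormedAddCommGroup V] [NormedSpace ℝ V]
    {f : M → V} {x : Cotangent I M} (hf : MDifferentiableAt I 𝓘(ℝ, V) f x.1)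
    (u : Coord n × (Coord n →L[ℝ] ℝ)) :
    vdiff (coModel I) (fun y : Cotangent I M ↦ f y.1) x u = vdiff I f x.1 u.1 := by
  have hd : MDifferentiableAt (coModel I) 𝓘(ℝ, V) (fun y : Cotangent I M ↦ f y.1) x :=
    MDifferentiableAt.comp x hf
      (contMDiff_proj_cotangent.contMDiffAt.mdifferentiableAt (by simp))
  have h1 := hasFDerivWithinAt_cotangent hd
  have h2 : HasFDerivWithinAt ((f ∘ (extChartAt I x.1).symm) ∘ Prod.fst)
      ((vdiff I f x.1).comp (ContinuousLinearMap.fst ℝ (Coord n) (Coord n →L[ℝ] ℝ)))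
      (range I ×ˢ (univ : Set (Coord n →L[ℝ] ℝ))) (extChartAt I x.1 x.1, fib x) :=
    HasFDerivWithinAt.comp (g := f ∘ (extChartAt I x.1).symm)
      (f := (Prod.fst : Coord n × (Coord n →L[ℝ] ℝ) → Coord n)) (t := range I)
      (extChartAt I x.1 x.1, fib x) (hasFDerivWithinAt_base hf) hasFDerivWithinAt_fst
      (fun _ hz ↦ hz.1)
  exact DFunLike.congr_fun ((uniqueDiffWithinAt_range_prod x).eq h1 h2) u

end CotangentChart

/-! ### First and second derivatives in the preferred charts -/

section Derivatives

variable {n : ℕ} {H : Type*} [TopologicalSpace H] {I : ModelWithCorners ℝ (Coord n) H}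
  {M : Type*} [TopologicalSpace M] [ChartedSpace H M] [IsManifold I ∞ M]
  {V : Type*} [NormedAddCommGroup V] [NormedSpace ℝ V]

omit [IsManifold I ∞ M] in
theorem chart_mem_range (q : M) : extChartAt I q q ∈ range I :=
  extChartAt_target_subset_range q (mem_extChartAt_target q)

omit [IsManifold I ∞ M] in
theorem uniqueDiffWithinAt_chart (q : M) : UniqueDiffWithinAt ℝ (range I) (extChartAt I q q) :=
  I.uniqueDiffOn _ (chart_mem_range q)

omit [IsManifold I ∞ M] in
/-- A property which holds near `q` holds near the image of `q` in the chart. -/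
theorem eventually_chart {q : M} {P : M → Prop} (h : ∀ᶠ q' in 𝓝 q, P q') :
    ∀ᶠ y in 𝓝[range I] (extChartAt I q q),
      P ((extChartAt I q).symm y) ∧ y ∈ (extChartAt I q).target := by
  have h1 : ∀ᶠ y in 𝓝[range I] (extChartAt I q q), y ∈ (extChartAt I q).target :=
    extChartAt_target_mem_nhdsWithin q
  have h2 : Filter.Tendsto (extChartAt I q).symm (𝓝[range I] (extChartAt I q q)) (𝓝 q) := by
    have h3 := (continuousAt_extChartAt_symm (I := I) q).tendsto
    rw [extChartAt_to_inv] at h3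
    exact h3.mono_left nhdsWithin_le_nhds
  exact (h2.eventually h).and h1

omit [IsManifold I ∞ M] in
theorem fderivWithin_chart {f : M → V} {q : M} (hf : MDifferentiableAt I 𝓘(ℝ, V) f q) :
    fderivWithin ℝ (f ∘ (extChartAt I q).symm) (range I) (extChartAt I q q) = vdiff I f q :=
  (hasFDerivWithinAt_base hf).fderivWithin (uniqueDiffWithinAt_chart q)

/-- The frame at `q` is the derivative of the inverse chart. -/
theorem frame_eq_mfderivWithin {q : M} {y : Coord n} (hy : y ∈ (extChartAt I q).target) :
    frame I q ((extChartAt I q).symm y) =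
      mfderivWithin 𝓘(ℝ, Coord n) I (extChartAt I q).symm (range I) y := by
  have h1 : (extChartAt I q).symm y ∈ (chartAt H q).source := by
    rw [← extChartAt_source I]
    exact (extChartAt I q).map_target hy
  rw [frame, TangentBundle.symmL_trivializationAt h1, (extChartAt I q).right_inv hy]

theorem vdiff_comp_frame {f : M → V} {q : M} {y : Coord n} (hy : y ∈ (extChartAt I q).target)
    (hf : MDifferentiableAt I 𝓘(ℝ, V) f ((extChartAt I q).symm y)) :
    (vdiff I f ((extChartAt I q).symm y)).comp (frame I q ((extChartAt I q).symm y)) =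
      fderivWithin ℝ (f ∘ (extChartAt I q).symm) (range I) y := by
  have h1 := mdifferentiableWithinAt_extChartAt_symm (I := I) hy
  have hu : UniqueMDiffWithinAt 𝓘(ℝ, Coord n) (range I) y :=
    (I.uniqueDiffOn _ (extChartAt_target_subset_range q hy)).uniqueMDiffWithinAt
  rw [← mfderivWithin_eq_fderivWithin, mfderiv_comp_mfderivWithin y hf h1 hu,
    frame_eq_mfderivWithin hy]
  rfl

/-- The second derivative at `q` of a map to a vector space, in the preferred chart at `q`. -/
def hess (I : ModelWithCorners ℝ (Coord n) H) {M : Type*} [TopologicalSpace M] [ChartedSpace H M]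
    [IsManifold I ∞ M] (f : M → V) (q : M) : Coord n →L[ℝ] Coord n →L[ℝ] V :=
  vdiff I (fun q' ↦ (vdiff I f q').comp (frame I q q')) q

theorem hess_eq_fderivWithin {f : M → V} {q : M}
    (hf : ∀ᶠ q' in 𝓝 q, ContMDiffAt I 𝓘(ℝ, V) ∞ f q') :
    hess I f q = fderivWithin ℝ (fderivWithin ℝ (f ∘ (extChartAt I q).symm) (range I)) (range I)
      (extChartAt I q q) := by
  rw [hess, ← fderivWithin_chart ((contMDiffAt_vdiff_frame hf.self_of_nhds).mdifferentiableAt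
    (by simp))]
  have h : (fun q' ↦ (vdiff I f q').comp (frame I q q')) ∘ (extChartAt I q).symm
      =ᶠ[𝓝[range I] (extChartAt I q q)] fderivWithin ℝ (f ∘ (extChartAt I q).symm) (range I) := by
    filter_upwards [eventually_chart hf] with y hy
    exact vdiff_comp_frame hy.2 (hy.1.mdifferentiableAt (by simp))
  exact h.fderivWithin_eq (h.self_of_nhdsWithin (chart_mem_range q))

/-- The symmetry of second derivatives. It holds up to the boundary, as the range of `I` is the
closure of its interior. -/
theorem hess_symm {f : M → V} {q : M} (hf : ∀ᶠ q' in 𝓝 q, ContMDiffAt I 𝓘(ℝ, V) ∞ f q')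
    (v w : Coord n) : hess I f q v w = hess I f q w v := by
  have h1 : ContDiffWithinAt ℝ ∞ (f ∘ (extChartAt I q).symm) (range I) (extChartAt I q q) := by
    have h2 := (contMDiffAt_iff.1 hf.self_of_nhds).2
    exact h2
  rw [hess_eq_fderivWithin hf]
  exact (h1.isSymmSndFDerivWithinAt (by
    rw [minSmoothness_of_isRCLikeNormedField]
    exact WithTop.coe_le_coe.2 le_top) I.uniqueDiffOn
    (I.range_subset_closure_interior (chart_mem_range q)) (chart_mem_range q)) v w

theorem chartHessian_eq_hess {φ : M → ℝ} (hφ : ContMDiff I 𝓘(ℝ, ℝ) ∞ φ) (q : M) :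
    chartHessian I φ q = hess I φ q :=
  (hess_eq_fderivWithin (Filter.Eventually.of_forall hφ)).symm

/-- The derivative at `q` of a vector field, in the preferred chart at `q`. -/
def dfield (I : ModelWithCorners ℝ (Coord n) H) {M : Type*} [TopologicalSpace M]
    [ChartedSpace H M] [IsManifold I ∞ M] (ν : M → Coord n) (q : M) : Coord n →L[ℝ] Coord n :=
  vdiff I (fun q' ↦ coframe I q q' (ν q')) q

/-- The derivative at `q` of the metric, in the preferred chart at `q`. -/
def dmetric (g : Metric I (M := M)) (q : M) : Coord n →L[ℝ] Coord n →L[ℝ] Coord n →L[ℝ] ℝ :=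
  vdiff I (fun q' ↦ (gform g q').bilinearComp (frame I q q') (frame I q q')) q

theorem hasFDerivWithinAt_metric (g : Metric I (M := M)) (q : M) :
    HasFDerivWithinAt (fun y ↦ (gform g ((extChartAt I q).symm y)).bilinearComp
      (frame I q ((extChartAt I q).symm y)) (frame I q ((extChartAt I q).symm y)))
      (dmetric g q) (range I) (extChartAt I q q) :=
  hasFDerivWithinAt_base (ContMDiffAt.mdifferentiableAt (smoothFormAt_gform g q) (by simp))

theorem fderivWithin_chartMetric (g : Metric I (M := M)) (q : M) :
    fderivWithin ℝ (chartMetric g q) (range I) (extChartAt I q q) = dmetric g q := by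
  have h : chartMetric g q =ᶠ[𝓝[range I] (extChartAt I q q)]
      (fun y ↦ (gform g ((extChartAt I q).symm y)).bilinearComp
        (frame I q ((extChartAt I q).symm y)) (frame I q ((extChartAt I q).symm y))) := by
    filter_upwards [extChartAt_target_mem_nhdsWithin (I := I) q] with y hy
    rw [frame_eq_mfderivWithin hy]
    rfl
  exact ((hasFDerivWithinAt_metric g q).congr_of_eventuallyEq h
    (h.self_of_nhdsWithin (chart_mem_range q))).fderivWithin (uniqueDiffWithinAt_chart q)

theorem dmetric_symm (g : Metric I (M := M)) (q : M) (u v w : Coord n) :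
    dmetric g q u v w = dmetric g q u w v := by
  have h := hasFDerivWithinAt_metric g q
  have h1 : ∀ a b : Coord n, HasFDerivWithinAt (fun y ↦ (gform g ((extChartAt I q).symm y))
      (frame I q ((extChartAt I q).symm y) a) (frame I q ((extChartAt I q).symm y) b))
      (((dmetric g q).flip a).flip b) (range I) (extChartAt I q q) := by
    intro a b
    have h2 := (h.clm_apply (hasFDerivWithinAt_const a _ _)).clm_apply
      (hasFDerivWithinAt_const b _ _)
    refine h2.congr_fderiv ?_
    ext u
    simp
  have h3 := h1 v w
  have h4 := h1 w v
  simp only [fun y ↦ gform_symm g ((extChartAt I q).symm y)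
    (frame I q ((extChartAt I q).symm y) v)] at h3
  exact DFunLike.congr_fun ((uniqueDiffWithinAt_chart q).eq h3 h4) u

theorem hasFDerivWithinAt_field {ν : M → Coord n} (hν : ∀ q, SmoothFieldAt I ν q) (q : M) :
    HasFDerivWithinAt (fun y ↦ coframe I q ((extChartAt I q).symm y) (ν ((extChartAt I q).symm y)))
      (dfield I ν q) (range I) (extChartAt I q q) :=
  hasFDerivWithinAt_base (ContMDiffAt.mdifferentiableAt (hν q) (by simp))

/-- The derivative of the relation `g(ν, ·) = dφ`. -/
theorem hess_eq_of_gradient {φ : M → ℝ} (hφ : ContMDiff I 𝓘(ℝ, ℝ) ∞ φ)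
    {ν : M → Coord n} (hν : ∀ q, SmoothFieldAt I ν q)
    (g : Metric I (M := M)) (hg : ∀ q, gform g q (ν q) = vdiff I φ q) (q : M) (u w : Coord n) :
    hess I φ q u w = dmetric g q u (ν q) w + gform g q (dfield I ν q u) w := by
  have h1 := (hasFDerivWithinAt_metric g q).clm_apply (hasFDerivWithinAt_field hν q)
  have h2 : HasFDerivWithinAt ((fun q' ↦ (vdiff I φ q').comp (frame I q q')) ∘
      (extChartAt I q).symm) (hess I φ q) (range I) (extChartAt I q q) :=
    hasFDerivWithinAt_base ((contMDiffAt_vdiff_frame (hφ q)).mdifferentiableAt (by simp))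
  have h3 : (fun y ↦ (gform g ((extChartAt I q).symm y)).bilinearComp
      (frame I q ((extChartAt I q).symm y)) (frame I q ((extChartAt I q).symm y))
      (coframe I q ((extChartAt I q).symm y) (ν ((extChartAt I q).symm y))))
      =ᶠ[𝓝[range I] (extChartAt I q q)] (fun q' ↦ (vdiff I φ q').comp (frame I q q')) ∘
      (extChartAt I q).symm := by
    filter_upwards [eventually_chart (eventually_frame_coframe (J := I) q)] with y hy
    ext w
    have h4 := DFunLike.congr_fun hy.1.1 (ν ((extChartAt I q).symm y))
    simp only [ContinuousLinearMap.comp_apply, ContinuousLinearMap.id_apply] at h4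
    simp only [Function.comp_apply, ContinuousLinearMap.bilinearComp_apply, ← hg,
      ContinuousLinearMap.comp_apply, h4]
  have h5 := (uniqueDiffWithinAt_chart q).eq
    (h2.congr_of_eventuallyEq h3 (h3.self_of_nhdsWithin (chart_mem_range q))) h1
  have h6 := DFunLike.congr_fun (DFunLike.congr_fun h5 u) w
  have h7 : ∀ v, frame I q q v = v := frame_self q
  have h8 : ∀ v, coframe I q q v = v := coframe_self q
  simp only [extChartAt_to_inv, add_apply, ContinuousLinearMap.comp_apply,
    ContinuousLinearMap.bilinearComp_apply, ContinuousLinearMap.flip_apply, h7, h8] at h6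
  rw [h6, add_comm]

/-- Where `ν` is the gradient of `φ`, the covariant Hessian is half the Lie derivative of the
metric along `ν`. -/
theorem covHessian_eq {φ : M → ℝ} (hφ : ContMDiff I 𝓘(ℝ, ℝ) ∞ φ)
    {ν : M → Coord n} (hν : ∀ q, SmoothFieldAt I ν q)
    (g : Metric I (M := M)) (hg : ∀ q, gform g q (ν q) = vdiff I φ q) (q : M) (v : Coord n) :
    covHessian g φ q v v = gform g q (dfield I ν q v) v + 1 / 2 * dmetric g q (ν q) v v := by
  have h1 : covHessian g φ q v v = chartHessian I φ q v v - vdiff I φ q (christoffel g q v v) :=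
    rfl
  have h2 : gform g q (christoffel g q v v) =
      christoffelForm (fderivWithin ℝ (chartMetric g q) (range I) (extChartAt I q q)) v v :=
    inner_sharp g q _
  generalize (christoffel g q v v : Coord n) = Γ at h1 h2
  rw [h1, chartHessian_eq_hess hφ, hess_eq_of_gradient hφ hν g hg, ← hg, gform_symm g q (ν q) Γ, h2,
    fderivWithin_chartMetric, christoffelForm_apply, dmetric_symm g q v (ν q) v]
  ring

end Derivatives

/-! ### Hamiltonian lifts and the kinetic energy -/

section Hamiltonian

variable {n : ℕ} {H : Type*} [TopologicalSpace H] {I : ModelWithCorners ℝ (Coord n) H}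
  {M : Type*} [TopologicalSpace M] [ChartedSpace H M] [IsManifold I ∞ M]
  {V : Type*} [NormedAddCommGroup V] [NormedSpace ℝ V]

/-- A property which holds near the base point of `x` holds near the image of `x` in the chart. -/
theorem eventually_coChart {x : Cotangent I M} {P : M → Prop} (h : ∀ᶠ q in 𝓝 x.1, P q) :
    ∀ᶠ z in 𝓝[range I ×ˢ (univ : Set (Coord n →L[ℝ] ℝ))] (extChartAt I x.1 x.1, fib x),
      P ((extChartAt I x.1).symm z.1) ∧ z.1 ∈ (extChartAt I x.1).target := by
  rw [nhdsWithin_prod_eq]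
  exact Filter.tendsto_fst.eventually (eventually_chart h)

theorem coChart_mem (x : Cotangent I M) : (extChartAt I x.1 x.1, fib x) ∈
    range I ×ˢ (univ : Set (Coord n →L[ℝ] ℝ)) := ⟨chart_mem_range x.1, mem_univ _⟩

/-- A function which depends only on the base point, read in the chart of `T*M`. -/
theorem hasFDerivWithinAt_fst_comp {f : Coord n → V} {f' : Coord n →L[ℝ] V} (x : Cotangent I M)
    (hf : HasFDerivWithinAt f f' (range I) (extChartAt I x.1 x.1)) :
    HasFDerivWithinAt (fun z : Coord n × (Coord n →L[ℝ] ℝ) ↦ f z.1)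
      (f'.comp (ContinuousLinearMap.fst ℝ (Coord n) (Coord n →L[ℝ] ℝ)))
      (range I ×ˢ (univ : Set (Coord n →L[ℝ] ℝ))) (extChartAt I x.1 x.1, fib x) :=
  HasFDerivWithinAt.comp (g := f) (f := (Prod.fst : Coord n × (Coord n →L[ℝ] ℝ) → Coord n))
    (t := range I) (extChartAt I x.1 x.1, fib x) hf hasFDerivWithinAt_fst (fun _ hz ↦ hz.1)

/-- The differential of a function on `T*M` is that of any expression for it in the chart. -/
theorem vdiff_eq_of_eventuallyEq {f : Cotangent I M → V} {x : Cotangent I M}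
    (hf : MDifferentiableAt (coModel I) 𝓘(ℝ, V) f x)
    {F : Coord n × (Coord n →L[ℝ] ℝ) → V} {F' : Coord n × (Coord n →L[ℝ] ℝ) →L[ℝ] V}
    (hF : HasFDerivWithinAt F F' (range I ×ˢ (univ : Set (Coord n →L[ℝ] ℝ)))
      (extChartAt I x.1 x.1, fib x))
    (h : ∀ᶠ z in 𝓝[range I ×ˢ (univ : Set (Coord n →L[ℝ] ℝ))] (extChartAt I x.1 x.1, fib x),
      f (coChartSymm I x.1 z) = F z) : vdiff (coModel I) f x = F' := by
  refine (uniqueDiffWithinAt_range_prod x).eq (hasFDerivWithinAt_cotangent hf)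
    (hF.congr_of_eventuallyEq h ?_)
  exact Filter.EventuallyEq.eq_of_nhdsWithin h (coChart_mem x)

/-- The differential of `⟨p, ν⟩` in the preferred chart. -/
theorem vdiff_mom {ν : M → Coord n} (hν : ∀ q, SmoothFieldAt I ν q) (x : Cotangent I M)
    (u : Coord n × (Coord n →L[ℝ] ℝ)) :
    vdiff (coModel I) (mom ν) x u = u.2 (ν x.1) + fib x (dfield I ν x.1 u.1) := by
  have h1 := (hasFDerivWithinAt_snd (𝕜 := ℝ) (p := (extChartAt I x.1 x.1, fib x))
    (s := range I ×ˢ (univ : Set (Coord n →L[ℝ] ℝ)))).clm_apply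
    (hasFDerivWithinAt_fst_comp x (hasFDerivWithinAt_field hν x.1))
  rw [vdiff_eq_of_eventuallyEq ((contMDiff_mom hν x).mdifferentiableAt (by simp)) h1
    (Filter.Eventually.of_forall fun z ↦ rfl)]
  have h8 : ∀ v, coframe I x.1 x.1 v = v := coframe_self x.1
  simp only [add_apply, ContinuousLinearMap.comp_apply, ContinuousLinearMap.flip_apply,
    ContinuousLinearMap.coe_fst', ContinuousLinearMap.coe_snd', extChartAt_to_inv, h8]
  exact add_comm _ _

/-- The differential of `ρ` in the preferred chart. -/
theorem vdiff_kinetic (g : Metric I (M := M)) (x : Cotangent I M)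
    (u : Coord n × (Coord n →L[ℝ] ℝ)) :
    vdiff (coModel I) (kinetic g) x u =
      u.2 (gsharp g x) - 1 / 2 * dmetric g x.1 u.1 (gsharp g x) (gsharp g x) := by
  have hf1 : ∀ v, frame I x.1 x.1 v = v := frame_self x.1
  have hfr := eventually_coChart (x := x) (eventually_frame_coframe (J := I) x.1)
  set G : Coord n → Coord n →L[ℝ] Coord n →L[ℝ] ℝ := fun y ↦
    (gform g ((extChartAt I x.1).symm y)).bilinearComp (frame I x.1 ((extChartAt I x.1).symm y))
      (frame I x.1 ((extChartAt I x.1).symm y)) with hG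
  have hGx : G (extChartAt I x.1 x.1) = gform g x.1 := by
    ext v w
    simp [hG, hf1]
  have hGi : ∀ᶠ z in 𝓝[range I ×ˢ (univ : Set (Coord n →L[ℝ] ℝ))] (extChartAt I x.1 x.1, fib x),
      (G z.1).IsInvertible := by
    filter_upwards [hfr] with z hz
    exact isInvertible_bilinearComp _ (fun v ↦ gform_pos g _) hz.1.2
  have h1 := hasFDerivWithinAt_fst_comp (V := Coord n →L[ℝ] Coord n →L[ℝ] ℝ) (f := G)
    (f' := dmetric g x.1) x (hasFDerivWithinAt_metric g x.1)
  have h2 := hasFDerivWithinAt_snd (𝕜 := ℝ) (p := (extChartAt I x.1 x.1, fib x))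
    (s := range I ×ˢ (univ : Set (Coord n →L[ℝ] ℝ)))
  have h3 : DifferentiableWithinAt ℝ (fun z : Coord n × (Coord n →L[ℝ] ℝ) ↦ (G z.1).inverse z.2)
      (range I ×ˢ (univ : Set (Coord n →L[ℝ] ℝ))) (extChartAt I x.1 x.1, fib x) := by
    have h4 : DifferentiableAt ℝ (ContinuousLinearMap.inverse :
        (Coord n →L[ℝ] Coord n →L[ℝ] ℝ) → _) (G (extChartAt I x.1 x.1, fib x).1) :=
      ((hGi.self_of_nhdsWithin (coChart_mem x)).contDiffAt_map_inverse
        (n := 1)).differentiableAt (by simp)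
    have h5 : DifferentiableWithinAt ℝ (ContinuousLinearMap.inverse ∘
        fun z : Coord n × (Coord n →L[ℝ] ℝ) ↦ G z.1)
        (range I ×ˢ (univ : Set (Coord n →L[ℝ] ℝ))) (extChartAt I x.1 x.1, fib x) :=
      DifferentiableAt.comp_differentiableWithinAt
        (g := (ContinuousLinearMap.inverse : (Coord n →L[ℝ] Coord n →L[ℝ] ℝ) → _))
        (f := fun z : Coord n × (Coord n →L[ℝ] ℝ) ↦ G z.1) _ h4 h1.differentiableWithinAt
    exact h5.clm_apply h2.differentiableWithinAt
  set w := fun z : Coord n × (Coord n →L[ℝ] ℝ) ↦ (G z.1).inverse z.2 with hw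
  have hwx : w (extChartAt I x.1 x.1, fib x) = gsharp g x := by
    have h5 := (hGi.self_of_nhdsWithin (coChart_mem x)).inverse_apply_self (gsharp g x)
    simp only [hGx, gform_gsharp] at h5
    simp only [hw, hGx, h5]
  -- `ρ = p w - ½ G (w, w)` with `w = p♯`, so that the derivative of `w` does not contribute
  have h6 := (h2.clm_apply h3.hasFDerivWithinAt).sub
    (((h1.clm_apply h3.hasFDerivWithinAt).clm_apply h3.hasFDerivWithinAt).const_mul (1 / 2 : ℝ))
  rw [vdiff_eq_of_eventuallyEq ((contMDiff_kinetic g x).mdifferentiableAt (by simp)) h6 ?_]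
  · generalize fderivWithin ℝ w _ _ = w'
    have hGx' : G ((extChartAt I x.1 x.1, fib x) : Coord n × (Coord n →L[ℝ] ℝ)).1 = gform g x.1 :=
      hGx
    simp only [hwx, hGx']
    have h7 := gform_gsharp g x
    have h8 : gform g x.1 (w' u) (gsharp g x) = fib x (w' u) := by rw [gform_symm, h7]
    simp [h8, h7]
    ring
  · filter_upwards [hfr, hGi] with z hz hi
    have h5 := hi.self_apply_inverse z.2
    have h9 : (fib (coChartSymm I x.1 z)).comp (frame I x.1 ((extChartAt I x.1).symm z.1)) =
        z.2 := by
      ext v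
      exact congrArg z.2 (DFunLike.congr_fun hz.1.2 v)
    rw [kinetic_eq g (coChartSymm I x.1 z) hz.1.1 hz.1.2]
    change 1 / 2 * ((fib (coChartSymm I x.1 z)).comp (frame I x.1 ((extChartAt I x.1).symm z.1)))
      ((G z.1).inverse ((fib (coChartSymm I x.1 z)).comp
        (frame I x.1 ((extChartAt I x.1).symm z.1)))) = z.2 (w z) - 1 / 2 * G z.1 (w z) (w z)
    rw [h9]
    simp only [hw]
    rw [h5]
    ring

/-- The Hamiltonian lift of `ν`, in the preferred chart. -/
def hlift (ν : M → Coord n) (x : Cotangent I M) : Coord n × (Coord n →L[ℝ] ℝ) :=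
  (ν x.1, -(fib x).comp (dfield I ν x.1))

theorem stdForm_hlift {ν : M → Coord n} (hν : ∀ q, SmoothFieldAt I ν q) (x : Cotangent I M) :
    stdForm (Coord n) (hlift ν x) = -vdiff (coModel I) (mom ν) x := by
  refine ContinuousLinearMap.ext fun u ↦ ?_
  rw [stdForm_apply, neg_apply, vdiff_mom hν]
  simp only [hlift, neg_apply, ContinuousLinearMap.comp_apply]
  ring

theorem stdForm_injective {u : Coord n × (Coord n →L[ℝ] ℝ)} (h : stdForm (Coord n) u = 0) :
    u = 0 := by
  have := (stdForm_isInvertible (E := Coord n)).inverse_apply_self u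
  rw [← this, h, map_zero]

theorem hamLift_eq {ν : ∀ q : M, TangentSpace I q} (hν : ∀ q, SmoothFieldAt I (W := M) ν q)
    (x : Cotangent I M) : hamLift ν x = hlift ν x := by
  have h : (stdForm (Coord n)).inverse (-vdiff (coModel I) (mom ν) x) = hlift ν x := by
    rw [← stdForm_hlift hν]
    exact stdForm_isInvertible.inverse_apply_self _
  exact h

/-- The derivative of the kinetic energy along the Hamiltonian lift of `ν`. -/
def dkin (g : Metric I (M := M)) (ν : M → Coord n) (x : Cotangent I M) : ℝ :=
  vdiff (coModel I) (kinetic g) x (hlift ν x)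

/-- The covariant Hessian is, up to sign, the derivative of the kinetic energy along the
Hamiltonian lift of the gradient. This makes it visibly smooth and independent of coordinates. -/
theorem covHessian_gsharp {φ : M → ℝ} (hφ : ContMDiff I 𝓘(ℝ, ℝ) ∞ φ)
    {ν : M → Coord n} (hν : ∀ q, SmoothFieldAt I ν q)
    (g : Metric I (M := M)) (hg : ∀ q, gform g q (ν q) = vdiff I φ q) (x : Cotangent I M) :
    covHessian g φ x.1 (gsharp g x) (gsharp g x) = -dkin g ν x := by
  rw [covHessian_eq hφ hν g hg, dkin, vdiff_kinetic, gform_symm, gform_gsharp]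
  simp only [hlift, neg_apply, ContinuousLinearMap.comp_apply]
  ring

/-! ### The Liouville field -/

theorem mfderiv_proj (x : Cotangent I M) (u : Coord n × (Coord n →L[ℝ] ℝ)) :
    (mfderiv (coModel I) I (TotalSpace.proj : Cotangent I M → M) x :
      Coord n × (Coord n →L[ℝ] ℝ) →L[ℝ] Coord n) u = u.1 := by
  have h1 : MDifferentiableAt (coModel I) I (TotalSpace.proj : Cotangent I M → M) x :=
    contMDiff_proj_cotangent.contMDiffAt.mdifferentiableAt (by simp)
  have h2 : MDifferentiableAt I 𝓘(ℝ, Coord n) (extChartAt I x.1) x.1 :=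
    mdifferentiableAt_extChartAt (mem_chart_source H x.1)
  have h3 := vdiff_comp_proj (x := x) h2 u
  have h4 := mfderiv_comp x h2 h1
  have h5 : vdiff I (extChartAt I x.1) x.1 u.1 = u.1 :=
    DFunLike.congr_fun (mfderiv_extChartAt_self (I := I) (x := x.1)) u.1
  have h6 : (mfderiv (coModel I) I (TotalSpace.proj : Cotangent I M → M) x :
      Coord n × (Coord n →L[ℝ] ℝ) →L[ℝ] Coord n) u =
      vdiff I (extChartAt I x.1) x.1 ((mfderiv (coModel I) I
        (TotalSpace.proj : Cotangent I M → M) x : Coord n × (Coord n →L[ℝ] ℝ) →L[ℝ] Coord n) u) :=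
    (DFunLike.congr_fun (mfderiv_extChartAt_self (I := I) (x := x.1)) _).symm
  rw [h6, ← h5, ← h3]
  exact (DFunLike.congr_fun h4 u).symm

theorem liouvilleField_eq (x : Cotangent I M) :
    liouvilleField x = ((0, fib x) : Coord n × (Coord n →L[ℝ] ℝ)) := by
  have h1 : stdForm (Coord n) (0, fib x) = liouvilleForm x := by
    refine ContinuousLinearMap.ext fun u ↦ ?_
    rw [stdForm_apply]
    simp only [map_zero, sub_zero]
    exact congrArg (fib x) (mfderiv_proj x u).symm
  have h : (stdForm (Coord n)).inverse (stdForm (Coord n) (0, fib x)) = (0, fib x) :=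
    stdForm_isInvertible.inverse_apply_self _
  rw [h1] at h
  exact h

end Hamiltonian

/-! ### Cotangent lifts of coordinates -/

section Lift

variable {n : ℕ} {H : Type*} [TopologicalSpace H] {I : ModelWithCorners ℝ (Coord n) H}
  {M : Type*} [TopologicalSpace M] [ChartedSpace H M] [IsManifold I ∞ M]

/-- The cotangent lift of the coordinates `e` on `M`: the point `(q, p)` is sent to
`(e q, p ∘ (de_q)⁻¹)`. -/
def coLift (e : M → Coord n) (x : Cotangent I M) : Coord n × (Coord n →L[ℝ] ℝ) :=
  (e x.1, (fib x).comp (vdiff I e x.1).inverse)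

theorem contMDiffAt_coLift {e : M → Coord n} {x : Cotangent I M}
    (he : ContMDiffAt I 𝓘(ℝ, Coord n) ∞ e x.1) (hi : (vdiff I e x.1).IsInvertible) :
    ContMDiffAt (coModel I) 𝓘(ℝ, Coord n × (Coord n →L[ℝ] ℝ)) ∞ (coLift e) x := by
  refine (he.comp x contMDiff_proj_cotangent.contMDiffAt).prodMk_space ?_
  have h1 : ContMDiffAt (coModel I) 𝓘(ℝ, Coord n →L[ℝ] Coord n) ∞
      (fun y : Cotangent I M ↦ (vdiff I e y.1).comp (frame I x.1 y.1)) x :=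
    ContMDiffAt.comp x (contMDiffAt_vdiff_frame he) contMDiff_proj_cotangent.contMDiffAt
  have hinv : ((vdiff I e x.1).comp (frame I x.1 x.1)).IsInvertible := by
    have : frame I x.1 x.1 = ContinuousLinearMap.id ℝ (Coord n) :=
      ContinuousLinearMap.ext (frame_self x.1)
    rwa [this]
  have h2 := (hinv.contDiffAt_map_inverse (n := ∞)).contMDiffAt.comp x h1
  refine (ContMDiffAt.clm_comp (contMDiffAt_fib_frame x) h2).congr_of_eventuallyEq ?_
  filter_upwards [contMDiff_proj_cotangent.continuous.continuousAt.eventually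
    (eventually_frame_coframe (J := I) x.1)] with y hy
  have h3 : (frame I x.1 y.1).IsInvertible := .of_inverse hy.1 hy.2
  have h4 : (frame I x.1 y.1).inverse = coframe I x.1 y.1 :=
    ContinuousLinearMap.inverse_eq hy.1 hy.2
  simp only [Function.comp_apply]
  rw [h3.inverse_comp_of_right, h4]
  ext v
  exact congrArg (fib y) (DFunLike.congr_fun hy.1 _).symm

theorem vdiff_coLift_fst {e : M → Coord n} {x : Cotangent I M}
    (he : ContMDiffAt I 𝓘(ℝ, Coord n) ∞ e x.1) (hi : (vdiff I e x.1).IsInvertible)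
    (u : Coord n × (Coord n →L[ℝ] ℝ)) :
    (vdiff (coModel I) (coLift e) x u).1 = vdiff I e x.1 u.1 := by
  have h := hasFDerivWithinAt_cotangent ((contMDiffAt_coLift he hi).mdifferentiableAt (by simp))
  have he' := he.mdifferentiableAt (by simp : (∞ : ℕ∞ω) ≠ 0)
  have h2 := hasFDerivWithinAt_fst_comp x (hasFDerivWithinAt_base he')
  exact DFunLike.congr_fun ((uniqueDiffWithinAt_range_prod x).eq h.fst h2) u

/-- The cotangent lift of coordinates is symplectic, because the second derivative of the coordinates
is symmetric. -/
theorem stdForm_vdiff_coLift {e : M → Coord n} {x : Cotangent I M}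
    (he : ∀ᶠ q in 𝓝 x.1, ContMDiffAt I 𝓘(ℝ, Coord n) ∞ e q ∧ (vdiff I e q).IsInvertible)
    (u v : Coord n × (Coord n →L[ℝ] ℝ)) :
    stdForm (Coord n) (vdiff (coModel I) (coLift e) x u) (vdiff (coModel I) (coLift e) x v) =
      stdForm (Coord n) u v := by
  obtain ⟨hex, hix⟩ := he.self_of_nhds
  have h := hasFDerivWithinAt_cotangent ((contMDiffAt_coLift hex hix).mdifferentiableAt (by simp))
  have hfst := vdiff_coLift_fst hex hix
  have hA : HasFDerivWithinAt ((fun q ↦ (vdiff I e q).comp (frame I x.1 q)) ∘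
      (extChartAt I x.1).symm) (hess I e x.1) (range I) (extChartAt I x.1 x.1) :=
    hasFDerivWithinAt_base ((contMDiffAt_vdiff_frame hex).mdifferentiableAt (by simp))
  have hA2 := hasFDerivWithinAt_fst_comp (V := Coord n →L[ℝ] Coord n) x hA
  have h3 := h.snd.clm_comp hA2
  have h4 : ∀ᶠ z in 𝓝[range I ×ˢ (univ : Set (Coord n →L[ℝ] ℝ))] (extChartAt I x.1 x.1, fib x),
      (coLift e (coChartSymm I x.1 z)).2.comp ((vdiff I e ((extChartAt I x.1).symm z.1)).comp
        (frame I x.1 ((extChartAt I x.1).symm z.1))) = z.2 := by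
    filter_upwards [eventually_coChart (he.and (eventually_frame_coframe (J := I) x.1))] with z hz
    ext w
    have h5 := hz.1.1.2.inverse_apply_self (frame I x.1 ((extChartAt I x.1).symm z.1) w)
    have h6 := DFunLike.congr_fun hz.1.2.2 w
    exact congrArg z.2 ((congrArg (coframe I x.1 ((extChartAt I x.1).symm z.1)) h5).trans h6)
  -- the derivative of the relation `P ∘ de = p` determines the fibre component of the differential
  have h7 := (uniqueDiffWithinAt_range_prod x).eq (h3.congr_of_eventuallyEq
    (Filter.EventuallyEq.symm h4) (h4.self_of_nhdsWithin (coChart_mem x)).symm)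
    hasFDerivWithinAt_snd
  have h8 : ∀ u w, (vdiff (coModel I) (coLift e) x u).2 (vdiff I e x.1 w) = u.2 w -
      (coLift e x).2 (hess I e x.1 u.1 w) := by
    intro u w
    have h9 := DFunLike.congr_fun (DFunLike.congr_fun h7 u) w
    have h10 : ∀ v, frame I x.1 x.1 v = v := frame_self x.1
    have h11 : coChartSymm I x.1 (extChartAt I x.1 x.1, fib x) = x := coChartSymm_self _ _
    simp only [add_apply, ContinuousLinearMap.comp_apply, ContinuousLinearMap.compL_apply,
      ContinuousLinearMap.flip_apply, Function.comp_apply, ContinuousLinearMap.coe_fst',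
      ContinuousLinearMap.coe_snd', h11, extChartAt_to_inv, h10] at h9
    linarith
  rw [stdForm_apply, stdForm_apply, hfst, hfst, h8, h8,
    hess_symm (he.mono fun q hq ↦ hq.1) u.1 v.1]
  ring

end Lift

/-! ### Smoothness of the lifts and of the first-order complexification -/

section Smoothness

variable {n : ℕ} {H : Type*} [TopologicalSpace H] {I : ModelWithCorners ℝ (Coord n) H}
  {M : Type*} [TopologicalSpace M] [ChartedSpace H M] [IsManifold I ∞ M]

theorem eventually_chart_coord (q : M) :
    ∀ᶠ q' in 𝓝 q, ContMDiffAt I 𝓘(ℝ, Coord n) ∞ (extChartAt I q) q' ∧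
      (vdiff I (extChartAt I q) q').IsInvertible := by
  filter_upwards [(chartAt H q).open_source.mem_nhds (mem_chart_source H q)] with q' hq'
  exact ⟨contMDiffAt_extChartAt' hq', isInvertible_mfderiv_extChartAt (by simpa using hq')⟩

/-- The canonical symplectic form is smooth. It is constant in the preferred chart at each point, but
these charts vary with the point: near `x₀` it is the pullback of a constant form by the cotangent
lift of a single chart. -/
theorem smoothFormAt_stdForm (x₀ : Cotangent I M) :
    SmoothFormAt (coModel I) (fun _ : Cotangent I M ↦ stdForm (Coord n)) x₀ := by
  have h0 := eventually_chart_coord (I := I) x₀.1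
  have h1 := smoothFormAt_pullback (V := Coord n × (Coord n →L[ℝ] ℝ))
    (B := fun _ : Cotangent I M ↦ stdForm (Coord n))
    (contMDiffAt_coLift h0.self_of_nhds.1 h0.self_of_nhds.2) contMDiffAt_const
  refine h1.congr_of_eventuallyEq ?_
  have h2 := contMDiff_proj_cotangent.continuous.continuousAt.eventually
    (eventually_eventually_nhds.2 h0)
  filter_upwards [h2] with x hx
  refine ContinuousLinearMap.ext fun u ↦ ContinuousLinearMap.ext fun v ↦ ?_
  exact (stdForm_vdiff_coLift hx _ _).symm

theorem smoothFieldAt_hlift {ν : M → Coord n} (hν : ∀ q, SmoothFieldAt I ν q)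
    (x₀ : Cotangent I M) : SmoothFieldAt (coModel I) (hlift (I := I) ν) x₀ := by
  refine SmoothFieldAt.of_form (L := fun _ ↦ stdForm (Coord n))
    (α := fun x ↦ -vdiff (coModel I) (mom ν) x) (smoothFormAt_stdForm x₀) ?_ (stdForm_hlift hν)
    fun x v hv ↦ stdForm_injective hv
  refine (contMDiffAt_vdiff_frame (contMDiff_mom hν x₀)).neg.congr_of_eventuallyEq
    (Filter.Eventually.of_forall fun x ↦ ?_)
  exact ContinuousLinearMap.neg_comp _ _

theorem smoothFieldAt_liouville (x₀ : Cotangent I M) :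
    SmoothFieldAt (coModel I) (fun x : Cotangent I M ↦ ((0, fib x) : Coord n × (Coord n →L[ℝ] ℝ)))
      x₀ := by
  have h0 := eventually_chart_coord (I := I) x₀.1
  have hc := contMDiffAt_coLift h0.self_of_nhds.1 h0.self_of_nhds.2
  refine SmoothFieldAt.of_form (L := fun _ ↦ stdForm (Coord n))
    (α := fun x ↦ (fib x).comp (ContinuousLinearMap.fst ℝ (Coord n) (Coord n →L[ℝ] ℝ)))
    (smoothFormAt_stdForm x₀) ?_ (fun x ↦ ?_) fun x v hv ↦ stdForm_injective hv
  · have h1 : ContMDiffAt (coModel I) 𝓘(ℝ, (Coord n × (Coord n →L[ℝ] ℝ)) →L[ℝ] ℝ) ∞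
        (fun x ↦ (coLift (extChartAt I x₀.1) x).2.comp
          (ContinuousLinearMap.fst ℝ (Coord n) (Coord n →L[ℝ] ℝ))) x₀ :=
      ContMDiffAt.clm_comp (contDiff_snd.contMDiff.contMDiffAt.comp x₀ hc) contMDiffAt_const
    refine (h1.clm_comp (contMDiffAt_vdiff_frame hc)).congr_of_eventuallyEq ?_
    filter_upwards [contMDiff_proj_cotangent.continuous.continuousAt.eventually h0] with x hx
    refine ContinuousLinearMap.ext fun u ↦ ?_
    have h2 := vdiff_coLift_fst hx.1 hx.2 (frame (coModel I) x₀ x u)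
    simp only [ContinuousLinearMap.comp_apply, ContinuousLinearMap.coe_fst', h2]
    exact congrArg (fib x) (hx.2.inverse_apply_self _).symm
  · refine ContinuousLinearMap.ext fun u ↦ ?_
    simp [stdForm_apply]

theorem contMDiff_dkin (g : Metric I (M := M)) {ν : M → Coord n} (hν : ∀ q, SmoothFieldAt I ν q) :
    ContMDiff (coModel I) 𝓘(ℝ, ℝ) ∞ (dkin g ν) := fun x₀ ↦
  (smoothFieldAt_hlift hν x₀).contMDiffAt_vdiff (contMDiff_kinetic g x₀)

/-- The function `φ + ½ χ dρ(ν̃)` on `T*M`, which is the real part of the first-order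
complexification. -/
def reCpx (g : Metric I (M := M)) (φ : M → ℝ) (ν : M → Coord n) (χ : M → ℝ)
    (x : Cotangent I M) : ℝ :=
  φ x.1 + 1 / 2 * χ x.1 * dkin g ν x

theorem contMDiff_reCpx (g : Metric I (M := M)) {φ χ : M → ℝ} (hφ : ContMDiff I 𝓘(ℝ, ℝ) ∞ φ)
    (hχ : ContMDiff I 𝓘(ℝ, ℝ) ∞ χ) {ν : M → Coord n} (hν : ∀ q, SmoothFieldAt I ν q) :
    ContMDiff (coModel I) 𝓘(ℝ, ℝ) ∞ (reCpx g φ ν χ) :=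
  (hφ.comp contMDiff_proj_cotangent).add (((contMDiff_const (c := (1 / 2 : ℝ))).mul
    (hχ.comp contMDiff_proj_cotangent)).mul (contMDiff_dkin g hν))

theorem complexification_eq {φ : M → ℝ} (hφ : ContMDiff I 𝓘(ℝ, ℝ) ∞ φ)
    {ν : ∀ q : M, TangentSpace I q} (hν : ∀ q, SmoothFieldAt I (W := M) ν q)
    (g : Metric I (M := M)) (hg : ∀ q, gform g q (ν q) = vdiff I φ q) (χ : M → ℝ) :
    complexification g φ ν χ =
      fun x ↦ (reCpx g φ ν χ x : ℂ) + Complex.I * (mom (I := I) ν x : ℝ) := by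
  funext x
  have h := covHessian_gsharp hφ hν g hg x
  have h1 : complexification g φ ν χ x = ((φ x.1 - (1 / 2) * χ x.1 *
      covHessian g φ x.1 (gsharp g x) (gsharp g x) : ℝ) : ℂ) +
        Complex.I * (mom (I := I) ν x : ℝ) := rfl
  rw [h1, h]
  simp only [reCpx]
  congr 2
  ring

theorem complexificationRe_eq {φ : M → ℝ} (hφ : ContMDiff I 𝓘(ℝ, ℝ) ∞ φ)
    {ν : ∀ q : M, TangentSpace I q} (hν : ∀ q, SmoothFieldAt I (W := M) ν q)
    (g : Metric I (M := M)) (hg : ∀ q, gform g q (ν q) = vdiff I φ q) (χ : M → ℝ) :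
    complexificationRe g φ ν χ = reCpx (I := I) g φ ν χ := by
  funext x
  rw [complexificationRe, complexification_eq hφ hν g hg]
  simp

/-! ### Fibrewise homogeneity -/

theorem gsharp_smul (g : Metric I (M := M)) (x : Cotangent I M) (s : ℝ) :
    gsharp g (cov x.1 (s • fib x)) = s • gsharp g x :=
  gsharp_eq g _ (by rw [map_smul]; exact congrArg (s • ·) (gform_gsharp g x))

theorem dkin_eq (g : Metric I (M := M)) (ν : M → Coord n) (x : Cotangent I M) :
    dkin g ν x = -fib x (dfield I ν x.1 (gsharp g x)) -
      1 / 2 * dmetric g x.1 (ν x.1) (gsharp g x) (gsharp g x) := by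
  rw [dkin, vdiff_kinetic]
  rfl

theorem dkin_smul (g : Metric I (M := M)) (ν : M → Coord n) (x : Cotangent I M) (s : ℝ) :
    dkin g ν (cov x.1 (s • fib x)) = s ^ 2 * dkin g ν x := by
  rw [dkin_eq, dkin_eq, gsharp_smul]
  simp only [fib_cov, cov_proj, map_smul, smul_apply, smul_eq_mul]
  ring

theorem kinetic_smul (g : Metric I (M := M)) (x : Cotangent I M) (s : ℝ) :
    kinetic g (cov x.1 (s • fib x)) = s ^ 2 * kinetic g x := by
  rw [kinetic_eq_gsharp, kinetic_eq_gsharp, gsharp_smul]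
  simp only [fib_cov, map_smul, smul_apply, smul_eq_mul]
  ring

/-- The derivative along the Liouville field of a function which is, along the fibres, the sum of
a constant and of a quadratic form. -/
theorem vdiff_liouville {f : Cotangent I M → ℝ} {x : Cotangent I M}
    (hf : MDifferentiableAt (coModel I) 𝓘(ℝ, ℝ) f x) {a b : ℝ}
    (h : ∀ s : ℝ, f (cov x.1 (s • fib x)) = a + s ^ 2 * b) :
    vdiff (coModel I) f x (0, fib x) = 2 * b := by
  have h1 := hasDerivAt_fibre hf (fib x)
  have h2 : (fun t : ℝ ↦ f (cov x.1 (fib x + t • fib x))) = fun t ↦ a + (1 + t) ^ 2 * b := by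
    funext t
    rw [← h, add_smul, one_smul]
  rw [h2] at h1
  have h3 : HasDerivAt (fun t : ℝ ↦ a + (1 + t) ^ 2 * b) (2 * b) 0 := by
    have := ((((hasDerivAt_id (0 : ℝ)).const_add 1).pow 2).mul_const b).const_add a
    simpa using this
  exact h1.unique h3

theorem vdiff_kinetic_liouville (g : Metric I (M := M)) (x : Cotangent I M) :
    vdiff (coModel I) (kinetic g) x (0, fib x) = 2 * kinetic g x := by
  refine vdiff_liouville (a := 0) ((contMDiff_kinetic g x).mdifferentiableAt (by simp)) fun s ↦ ?_
  rw [kinetic_smul, zero_add]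

theorem vdiff_reCpx_liouville (g : Metric I (M := M)) {φ χ : M → ℝ}
    (hφ : ContMDiff I 𝓘(ℝ, ℝ) ∞ φ) (hχ : ContMDiff I 𝓘(ℝ, ℝ) ∞ χ) {ν : M → Coord n}
    (hν : ∀ q, SmoothFieldAt I ν q) (x : Cotangent I M) :
    vdiff (coModel I) (reCpx g φ ν χ) x (0, fib x) = χ x.1 * dkin g ν x := by
  rw [vdiff_liouville (a := φ x.1) (b := 1 / 2 * χ x.1 * dkin g ν x)
    ((contMDiff_reCpx g hφ hχ hν x).mdifferentiableAt (by simp)) fun s ↦ ?_]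
  · ring
  · simp only [reCpx, dkin_smul, cov_proj]
    ring

theorem vdiff_mom_hlift {ν : M → Coord n} (hν : ∀ q, SmoothFieldAt I ν q) (x : Cotangent I M) :
    vdiff (coModel I) (mom ν) x (hlift ν x) = 0 := by
  rw [vdiff_mom hν]
  simp [hlift]

/-- Along the zero-section, `f⁰` has the same derivative as `φ` in the direction of `ν`. -/
theorem vdiff_reCpx_zero (g : Metric I (M := M)) {φ χ : M → ℝ}
    (hφ : ContMDiff I 𝓘(ℝ, ℝ) ∞ φ) (hχ : ContMDiff I 𝓘(ℝ, ℝ) ∞ χ) {ν : M → Coord n}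
    (hν : ∀ q, SmoothFieldAt I ν q) (q : M) :
    vdiff (coModel I) (reCpx g φ ν χ) (cov q 0)
      (hlift ν (cov q 0 : Cotangent I M)) = vdiff I φ q (ν q) := by
  have h := hasFDerivWithinAt_cotangent
    ((contMDiff_reCpx g hφ hχ hν (cov q 0)).mdifferentiableAt (by simp))
  have h1 : HasFDerivWithinAt (fun y : Coord n ↦ ((y, 0) : Coord n × (Coord n →L[ℝ] ℝ)))
      (ContinuousLinearMap.inl ℝ (Coord n) (Coord n →L[ℝ] ℝ)) (range I) (extChartAt I q q) :=
    (hasFDerivAt_prodMk_left _ _).hasFDerivWithinAt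
  have h2 := HasFDerivWithinAt.comp (f := fun y : Coord n ↦ ((y, 0) : Coord n × (Coord n →L[ℝ] ℝ)))
    (t := range I ×ˢ (univ : Set (Coord n →L[ℝ] ℝ))) (extChartAt I q q) h h1
    (fun y hy ↦ ⟨hy, mem_univ _⟩)
  have h3 := hasFDerivWithinAt_base ((hφ q).mdifferentiableAt (by simp))
  have h4 : ∀ q' : M, dkin g ν (cov q' 0) = 0 := fun q' ↦ by
    have := dkin_smul g ν (cov q' 0) 0
    simpa using this
  have h5 : ((reCpx g φ ν χ ∘ coChartSymm I q) ∘
      fun y : Coord n ↦ ((y, 0) : Coord n × (Coord n →L[ℝ] ℝ))) = φ ∘ (extChartAt I q).symm := by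
    funext y
    have h6 : coChartSymm I q (y, 0) = cov ((extChartAt I q).symm y) 0 := by
      simp [coChartSymm]
    simp [h6, reCpx, h4]
  simp only [cov_proj] at h2
  rw [h5] at h2
  have h7 := (uniqueDiffWithinAt_chart q).eq h2 h3
  have h8 : hlift ν (cov q 0 : Cotangent I M) = (ν q, 0) := by simp [hlift]
  rw [h8, ← h7]
  rfl

end Smoothness

/-! ### The topology of the cotangent bundle -/

section Tubes

variable {n : ℕ} {H : Type*} [TopologicalSpace H] {I : ModelWithCorners ℝ (Coord n) H}
  {M : Type*} [TopologicalSpace M] [ChartedSpace H M] [IsManifold I ∞ M]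

theorem t2Space_cotangent [T2Space M] : T2Space (Cotangent I M) := by
  refine ⟨fun x y hxy ↦ ?_⟩
  by_cases h : x.1 = y.1
  · set e := trivializationAt (Coord n →L[ℝ] ℝ) (fun q : M ↦ TangentSpace I q →L[ℝ] ℝ) x.1
    have hx : x ∈ e.source := e.mem_source.2 (mem_baseSet_trivializationAt _ _ _)
    have hy : y ∈ e.source := e.mem_source.2 (h ▸ mem_baseSet_trivializationAt _ _ _)
    obtain ⟨u, v, hu, hv, hxu, hyv, huv⟩ := t2_separation (e.injOn.ne hx hy hxy)
    exact ⟨e.source ∩ e ⁻¹' u, e.source ∩ e ⁻¹' v,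
      e.toOpenPartialHomeomorph.isOpen_inter_preimage hu,
      e.toOpenPartialHomeomorph.isOpen_inter_preimage hv, ⟨hx, hxu⟩, ⟨hy, hyv⟩,
      (huv.preimage e).mono inter_subset_right inter_subset_right⟩
  · exact separated_by_continuous contMDiff_proj_cotangent.continuous h

theorem fib_gsharp_nonneg (g : Metric I (M := M)) (x : Cotangent I M) : 0 ≤ fib x (gsharp g x) := by
  rw [← gform_gsharp g x]
  by_cases h : gsharp g x = 0
  · simp [h]
  · exact (gform_pos g x.1 h).le

theorem kinetic_nonneg (g : Metric I (M := M)) (x : Cotangent I M) : 0 ≤ kinetic g x := by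
  rw [kinetic_eq_gsharp]
  linarith [fib_gsharp_nonneg g x]

theorem fib_eq_zero_of_kinetic (g : Metric I (M := M)) {x : Cotangent I M} (h : kinetic g x = 0) :
    fib x = 0 := by
  rw [kinetic_eq_gsharp, ← gform_gsharp g x] at h
  rw [← gform_gsharp g x]
  by_cases h0 : gsharp g x = 0
  · simp [h0]
  · linarith [gform_pos g x.1 h0]

theorem coNorm_eq (g : Metric I (M := M)) (x : Cotangent I M) :
    coNorm g x = √(2 * kinetic g x) := by
  rw [kinetic_eq_gsharp, ← mul_assoc]
  norm_num
  rfl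

theorem mem_tube (g : Metric I (M := M)) {r : ℝ} (hr : 0 ≤ r) {x : Cotangent I M} :
    x ∈ tube g r ↔ 2 * kinetic g x ≤ r ^ 2 := by
  change coNorm g x ≤ r ↔ _
  rw [coNorm_eq, Real.sqrt_le_left hr]

theorem mem_sphereBundle (g : Metric I (M := M)) {r : ℝ} (hr : 0 ≤ r) {x : Cotangent I M} :
    x ∈ sphereBundle g r ↔ 2 * kinetic g x = r ^ 2 := by
  change coNorm g x = r ↔ _
  rw [coNorm_eq, Real.sqrt_eq_iff_eq_sq (by linarith [kinetic_nonneg g x]) hr]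

theorem continuous_coNorm (g : Metric I (M := M)) : Continuous (coNorm g) := by
  rw [funext (coNorm_eq g)]
  exact (continuous_const.mul (contMDiff_kinetic g).continuous).sqrt

theorem isClosed_tube (g : Metric I (M := M)) (r : ℝ) : IsClosed (tube g r) :=
  isClosed_le (continuous_coNorm g) continuous_const

theorem isClosed_sphereBundle (g : Metric I (M := M)) (r : ℝ) : IsClosed (sphereBundle g r) :=
  isClosed_eq (continuous_coNorm g) continuous_const

/-- The Cauchy-Schwarz inequality `p(v)² ≤ |p|² g(v, v)`. -/
theorem fib_sq_le (g : Metric I (M := M)) (x : Cotangent I M) (v : Coord n) :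
    fib x v ^ 2 ≤ 2 * kinetic g x * gform g x.1 v v := by
  by_cases hv : v = 0
  · simp [hv]
  have hv := gform_pos g x.1 hv
  set a := gsharp g x
  have h1 : fib x v = gform g x.1 a v := (DFunLike.congr_fun (gform_gsharp g x) v).symm
  have h2 : 2 * kinetic g x = gform g x.1 a a := by
    rw [gform_gsharp, kinetic_eq_gsharp]
    ring
  have h3 : 0 ≤ gform g x.1 (gform g x.1 v v • a - fib x v • v)
      (gform g x.1 v v • a - fib x v • v) := by
    by_cases h : gform g x.1 v v • a - fib x v • v = 0
    · simp [h]
    · exact (gform_pos g x.1 h).le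
  simp only [map_sub, map_smul, sub_apply, smul_apply, smul_eq_mul,
    gform_symm g x.1 v a, ← h1] at h3
  rw [h2]
  have h4 : 0 ≤ gform g x.1 v v * (gform g x.1 a a * gform g x.1 v v - fib x v ^ 2) := by linarith
  linarith [nonneg_of_mul_nonneg_right h4 hv]

/-- Over a compact neighbourhood of any point, the tubes are relatively compact. -/
theorem exists_compact_tube_local [CompactSpace M] [T2Space M] (g : Metric I (M := M)) {r : ℝ}
    (hr : 0 ≤ r) (q₀ : M) : ∃ N ∈ 𝓝 q₀, ∃ K : Set (Cotangent I M), IsCompact K ∧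
      ∀ x ∈ tube g r, x.1 ∈ N → x ∈ K := by
  set e := trivializationAt (Coord n →L[ℝ] ℝ) (fun q : M ↦ TangentSpace I q →L[ℝ] ℝ) q₀ with he
  have h1 : ∀ᶠ q in 𝓝 q₀, ‖(gform g q).bilinearComp (frame I q₀ q) (frame I q₀ q)‖ <
      ‖(gform g q₀).bilinearComp (frame I q₀ q₀) (frame I q₀ q₀)‖ + 1 := by
    have hc : ContinuousAt (fun q ↦ (gform g q).bilinearComp (frame I q₀ q) (frame I q₀ q)) q₀ :=
      (smoothFormAt_gform g q₀).continuousAt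
    have hn : Continuous fun L : Coord n →L[ℝ] Coord n →L[ℝ] ℝ ↦ ‖L‖ :=
      continuous_norm (E := Coord n →L[ℝ] Coord n →L[ℝ] ℝ)
    exact (hn.continuousAt.comp hc).eventually_lt continuousAt_const (lt_add_one _)
  set C := ‖(gform g q₀).bilinearComp (frame I q₀ q₀) (frame I q₀ q₀)‖ + 1
  have hC : 0 ≤ C := by positivity
  obtain ⟨N, hN, hNs, hNc⟩ := local_compact_nhds (Filter.inter_mem h1
    (e.open_baseSet.mem_nhds (mem_baseSet_trivializationAt _ _ _)))
  refine ⟨N, hN, e.toOpenPartialHomeomorph.symm '' (N ×ˢ Metric.closedBall 0 (r * √C)),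
    (hNc.prod (isCompact_closedBall _ _)).image_of_continuousOn ?_, fun x hx hxN ↦ ?_⟩
  · refine e.toOpenPartialHomeomorph.continuousOn_symm.mono fun z hz ↦ ?_
    exact e.mem_target.2 (hNs hz.1).2
  · have hxs : x ∈ e.source := e.mem_source.2 (hNs hxN).2
    refine ⟨e x, ⟨?_, ?_⟩, e.toOpenPartialHomeomorph.left_inv hxs⟩
    · rwa [e.coe_fst hxs]
    · rw [he, cotangent_trivializationAt_apply, mem_closedBall_zero_iff]
      refine ContinuousLinearMap.opNorm_le_bound _ (by positivity) fun v ↦ ?_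
      rw [ContinuousLinearMap.comp_apply, Real.norm_eq_abs]
      refine abs_le_of_sq_le_sq ?_ (by positivity)
      refine (fib_sq_le g x _).trans ?_
      have h2 := (((gform g x.1).bilinearComp (frame I q₀ x.1) (frame I q₀ x.1)).le_opNorm₂ v v)
      have h3 : gform g x.1 (frame I q₀ x.1 v) (frame I q₀ x.1 v) ≤ C * ‖v‖ ^ 2 := by
        refine (le_abs_self _).trans (h2.trans ?_)
        have h4 : ‖(gform g x.1).bilinearComp (frame I q₀ x.1) (frame I q₀ x.1)‖ ≤ C :=
            le_of_lt (hNs hxN).1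
        rw [mul_assoc, ← sq]
        gcongr
      have h5 := (mem_tube g hr).1 hx
      calc _ ≤ r ^ 2 * (C * ‖v‖ ^ 2) := by
            refine mul_le_mul h5 h3 ?_ (by positivity)
            by_cases h : frame I q₀ x.1 v = 0
            · simp [h]
            · exact (gform_pos g x.1 h).le
        _ = _ := by rw [mul_pow, mul_pow, Real.sq_sqrt hC]; ring

theorem isCompact_tube [CompactSpace M] [T2Space M] (g : Metric I (M := M)) {r : ℝ} (hr : 0 ≤ r) :
    IsCompact (tube g r) := by
  choose N hN K hK h using exists_compact_tube_local g hr
  obtain ⟨t, ht⟩ := CompactSpace.elim_nhds_subcover N hN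
  refine (t.isCompact_biUnion fun q _ ↦ hK q).of_isClosed_subset (isClosed_tube g r) fun x hx ↦ ?_
  have h1 : x.1 ∈ ⋃ q ∈ t, N q := by rw [ht]; trivial
  obtain ⟨q, hq, hxq⟩ := mem_iUnion₂.1 h1
  exact mem_iUnion₂.2 ⟨q, hq, h q x hx hxq⟩

theorem sigmaCompactSpace_cotangent [CompactSpace M] [T2Space M] (g : Metric I (M := M)) :
    SigmaCompactSpace (Cotangent I M) := by
  refine ⟨⟨fun k ↦ tube g k, fun k ↦ isCompact_tube g k.cast_nonneg, eq_univ_of_forall fun x ↦ ?_⟩⟩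
  obtain ⟨k, hk⟩ := exists_nat_ge (coNorm g x)
  exact mem_iUnion.2 ⟨k, hk⟩

/-- A neighbourhood of the zero-section contains a tube. -/
theorem exists_tube_subset [CompactSpace M] [T2Space M] (g : Metric I (M := M))
    {O : Set (Cotangent I M)} (hO : IsOpen O) (h0 : ∀ q, cov q 0 ∈ O) :
    ∃ δ, 0 < δ ∧ tube g δ ⊆ O := by
  have hK : IsCompact (tube g 1 \ O) := (isCompact_tube g zero_le_one).diff hO
  rcases (tube g 1 \ O).eq_empty_or_nonempty with h | h
  · exact ⟨1, one_pos, sdiff_eq_empty.1 h⟩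
  obtain ⟨x, hx, hmin⟩ := hK.exists_isMinOn h (continuous_coNorm g).continuousOn
  have hpos : 0 < coNorm g x := by
    rw [coNorm_eq]
    refine Real.sqrt_pos.2 (mul_pos two_pos ((kinetic_nonneg g x).lt_of_ne fun h1 ↦ hx.2 ?_))
    have h2 := h0 x.1
    rwa [← fib_eq_zero_of_kinetic g h1.symm, cov_fib] at h2
  refine ⟨min 1 (coNorm g x / 2), by positivity, fun y hy ↦ by_contra fun hyO ↦ ?_⟩
  have h1 : coNorm g y ≤ min 1 (coNorm g x / 2) := hy
  have h2 : coNorm g x ≤ coNorm g y := hmin ⟨h1.trans (min_le_left _ _), hyO⟩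
  linarith [h1.trans (min_le_right _ _)]

/-- The function `dρ(ν̃)`, being quadratic along the fibres, is bounded by a multiple of `ρ`. -/
theorem exists_dkin_le [CompactSpace M] [T2Space M] (g : Metric I (M := M)) {ν : M → Coord n}
    (hν : ∀ q, SmoothFieldAt I ν q) :
    ∃ C, 0 ≤ C ∧ ∀ x : Cotangent I M, |dkin g ν x| ≤ C * kinetic g x := by
  obtain ⟨C, hC⟩ := (isCompact_tube g (zero_le_one)).exists_bound_of_continuousOn
    (contMDiff_dkin g hν).continuous.continuousOn
  refine ⟨2 * |C|, by positivity, fun x ↦ ?_⟩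
  rcases (kinetic_nonneg g x).eq_or_lt with h | h
  · have h1 := dkin_smul g ν x 0
    rw [zero_smul, ← fib_eq_zero_of_kinetic g h.symm, cov_fib] at h1
    have h2 : dkin g ν x = 0 := by rw [h1]; ring
    simp [h2, ← h]
  -- the fibre of `x` meets the unit sphere bundle at `s p`
  · set s := 1 / √(2 * kinetic g x) with hs
    have hs2 : s ^ 2 * (2 * kinetic g x) = 1 := by
      rw [hs, div_pow, Real.sq_sqrt (by positivity)]
      field_simp
    have h1 : cov x.1 (s • fib x) ∈ tube g 1 := by
      rw [mem_tube g zero_le_one, kinetic_smul]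
      linarith
    have h2 := hC _ h1
    rw [dkin_smul, norm_mul, Real.norm_eq_abs, Real.norm_eq_abs, abs_of_nonneg (sq_nonneg s)] at h2
    calc |dkin g ν x| = s ^ 2 * |dkin g ν x| * (2 * kinetic g x) := by
          linear_combination -hs2 * |dkin g ν x|
      _ ≤ |C| * (2 * kinetic g x) := by
          gcongr
          exact h2.trans (le_abs_self C)
      _ = _ := by ring

end Tubes

/-! ### The contact lift -/

section Contact

variable {n : ℕ} {H : Type*} [TopologicalSpace H] {I : ModelWithCorners ℝ (Coord n) H}
  {M : Type*} [TopologicalSpace M] [ChartedSpace H M] [IsManifold I ∞ M]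

/-- The contact lift in the preferred chart, `ν̃ - (dρ(ν̃) / 2ρ) p ∂_p`. -/
def clift (g : Metric I (M := M)) (ν : M → Coord n) (x : Cotangent I M) :
    Coord n × (Coord n →L[ℝ] ℝ) :=
  hlift ν x - (dkin g ν x / (2 * kinetic g x)) • ((0, fib x) : Coord n × (Coord n →L[ℝ] ℝ))

theorem contactLift_eq {ν : ∀ q : M, TangentSpace I q}
    (hν : ∀ q, SmoothFieldAt I (W := M) ν q) (g : Metric I (M := M)) (x : Cotangent I M) :
    contactLift g ν x = clift g ν x := by
  have h : clift g ν x = hlift ν x - (vdiff (coModel I) (kinetic g) x (hlift ν x) /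
      vdiff (coModel I) (kinetic g) x (0, fib x)) •
        ((0, fib x) : Coord n × (Coord n →L[ℝ] ℝ)) := by
    rw [vdiff_kinetic_liouville]
    rfl
  rw [contactLift, hamLift_eq hν, liouvilleField_eq]
  exact h.symm

theorem smoothFieldAt_clift {ν : M → Coord n} (hν : ∀ q, SmoothFieldAt I ν q)
    (g : Metric I (M := M)) {x : Cotangent I M} (hx : kinetic g x ≠ 0) :
    SmoothFieldAt (coModel I) (clift g ν) x := by
  refine SmoothFieldAt.sub_smul (smoothFieldAt_hlift hν x) (smoothFieldAt_liouville x) ?_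
  exact (contMDiff_dkin g hν x).div₀ ((contMDiff_const (c := (2 : ℝ))).mul (contMDiff_kinetic g) x)
    (mul_ne_zero two_ne_zero hx)

theorem vdiff_kinetic_clift {ν : M → Coord n} (g : Metric I (M := M)) {x : Cotangent I M}
    (hx : kinetic g x ≠ 0) : vdiff (coModel I) (kinetic g) x (clift g ν x) = 0 := by
  rw [clift, map_sub, map_smul, vdiff_kinetic_liouville, smul_eq_mul,
    div_mul_cancel₀ _ (mul_ne_zero two_ne_zero hx)]
  exact sub_self _

/-- The radial correction in the contact lift costs a term of order `ρ`. -/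
theorem vdiff_reCpx_clift (g : Metric I (M := M)) {φ χ : M → ℝ}
    (hφ : ContMDiff I 𝓘(ℝ, ℝ) ∞ φ) (hχ : ContMDiff I 𝓘(ℝ, ℝ) ∞ χ) {ν : M → Coord n}
    (hν : ∀ q, SmoothFieldAt I ν q) (x : Cotangent I M) :
    vdiff (coModel I) (reCpx g φ ν χ) x (clift g ν x) =
      vdiff (coModel I) (reCpx g φ ν χ) x (hlift ν x) -
        χ x.1 * dkin g ν x ^ 2 / (2 * kinetic g x) := by
  rw [clift, map_sub, map_smul, vdiff_reCpx_liouville g hφ hχ hν, smul_eq_mul]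
  ring

end Contact

/-! ### Cotangent coordinates associated with coordinates of the base -/

section CotangentCoordinates

/-- The identification of `ℝⁿ` with its dual given by the Euclidean scalar product. -/
def flat (n : ℕ) : Coord n ≃L[ℝ] (Coord n →L[ℝ] ℝ) :=
  LinearEquiv.toContinuousLinearEquiv
    { toFun := InnerProductSpace.toDual ℝ (Coord n)
      invFun := (InnerProductSpace.toDual ℝ (Coord n)).symm
      map_add' := map_add _
      map_smul' := fun c v ↦ by simp
      left_inv := (InnerProductSpace.toDual ℝ (Coord n)).symm_apply_apply
      right_inv := (InnerProductSpace.toDual ℝ (Coord n)).apply_symm_apply }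

theorem flat_apply {n : ℕ} (P v : Coord n) : flat n P v = inner ℝ P v := rfl

theorem inner_flat_symm {n : ℕ} (p : Coord n →L[ℝ] ℝ) (v : Coord n) :
    inner ℝ ((flat n).symm p) v = p v := by
  rw [← flat_apply, ContinuousLinearEquiv.apply_symm_apply]

variable {n : ℕ} {H : Type*} [TopologicalSpace H] {I : ModelWithCorners ℝ (Coord n) H}
  {M : Type*} [TopologicalSpace M] [ChartedSpace H M] [IsManifold I ∞ M]

omit [IsManifold I ∞ M] in
theorem IsSmoothCoord.contMDiffAt {e : OpenPartialHomeomorph M (Coord n)} (he : IsSmoothCoord I e)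
    {q : M} (hq : q ∈ e.source) : ContMDiffAt I 𝓘(ℝ, Coord n) ∞ e q :=
  he.1.contMDiffAt (e.open_source.mem_nhds hq)

/-- The differential of smooth coordinates is invertible. -/
theorem IsSmoothCoord.isInvertible {F : Type*} [NormedAddCommGroup F] [NormedSpace ℝ F]
    {K : Type*} [TopologicalSpace K] {J : ModelWithCorners ℝ F K}
    {W : Type*} [TopologicalSpace W] [ChartedSpace K W] [IsManifold J ∞ W]
    {G : Type*} [NormedAddCommGroup G] [NormedSpace ℝ G] {e : OpenPartialHomeomorph W G}
    (he : IsSmoothCoord J e) {x : W} (hx : x ∈ e.source) : (vdiff J e x).IsInvertible := by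
  have h : e.MDifferentiable J 𝓘(ℝ, G) :=
    ⟨he.1.mdifferentiableOn (by simp), he.2.mdifferentiableOn (by simp)⟩
  exact ⟨h.mfderiv hx, rfl⟩

/-- The differential of a function expressed through smooth coordinates. -/
theorem IsSmoothCoord.vdiff_eq {F : Type*} [NormedAddCommGroup F] [NormedSpace ℝ F]
    {K : Type*} [TopologicalSpace K] {J : ModelWithCorners ℝ F K}
    {W : Type*} [TopologicalSpace W] [ChartedSpace K W]
    {G : Type*} [NormedAddCommGroup G] [NormedSpace ℝ G] {e : OpenPartialHomeomorph W G}
    (he : IsSmoothCoord J e) {x : W} (hx : x ∈ e.source) {f : W → ℝ} {Φ : G → ℝ}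
    {Φ' : G →L[ℝ] ℝ} (hΦ : HasFDerivAt Φ Φ' (e x)) (hf : ∀ y ∈ e.source, f y = Φ (e y)) (u : F) :
    vdiff J f x u = Φ' (vdiff J e x u) := by
  have hd : MDifferentiableAt J 𝓘(ℝ, G) e x :=
    (he.1.contMDiffAt (e.open_source.mem_nhds hx)).mdifferentiableAt (by simp)
  have h1 : HasMFDerivAt J 𝓘(ℝ, ℝ) (Φ ∘ e) x (Φ'.comp (vdiff J e x)) :=
    HasMFDerivAt.comp x hΦ.hasMFDerivAt hd.hasMFDerivAt
  have h2 : vdiff J f x = Φ'.comp (vdiff J e x) := by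
    refine (h1.congr_of_eventuallyEq ?_).mfderiv
    filter_upwards [e.open_source.mem_nhds hx] with y hy
    exact hf y hy
  rw [h2]
  rfl

theorem IsSmoothCoord.eventually {e : OpenPartialHomeomorph M (Coord n)} (he : IsSmoothCoord I e)
    {q : M} (hq : q ∈ e.source) : ∀ᶠ q' in 𝓝 q, ContMDiffAt I 𝓘(ℝ, Coord n) ∞ e q' ∧
      (vdiff I e q').IsInvertible := by
  filter_upwards [e.open_source.mem_nhds hq] with q' hq'
  exact ⟨he.contMDiffAt hq', he.isInvertible hq'⟩

/-- The covector `P` at `e⁻¹ y`, where `P` is seen as a covector through the coordinates `e`. -/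
def coLiftSymm (I : ModelWithCorners ℝ (Coord n) H) [IsManifold I ∞ M]
    (e : OpenPartialHomeomorph M (Coord n)) (z : Coord n × Coord n) : Cotangent I M :=
  cov (e.symm z.1) ((flat n z.2).comp (vdiff I e (e.symm z.1)))

theorem contMDiffAt_coLiftSymm {e : OpenPartialHomeomorph M (Coord n)} (he : IsSmoothCoord I e)
    {z : Coord n × Coord n} (hz : z.1 ∈ e.target) :
    ContMDiffAt 𝓘(ℝ, Coord n × Coord n) (coModel I) ∞ (coLiftSymm I e) z := by
  have h1 : ContMDiffAt 𝓘(ℝ, Coord n × Coord n) I ∞ (fun z ↦ e.symm z.1) z :=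
    ContMDiffAt.comp (I' := 𝓘(ℝ, Coord n)) (g := e.symm) (f := Prod.fst) z
      (he.2.contMDiffAt (e.open_target.mem_nhds hz)) contDiff_fst.contMDiff.contMDiffAt
  refine ContMDiffWithinAt.contMDiffAt (contMDiffWithinAt_cotangent.2
    ⟨h1.contMDiffWithinAt, ContMDiffAt.contMDiffWithinAt (s := univ) ?_⟩) Filter.univ_mem
  have h2 := (contMDiffAt_vdiff_frame (he.contMDiffAt (e.map_target hz))).comp
    (g := fun q ↦ (vdiff I e q).comp (frame I (e.symm z.1) q)) (f := fun z ↦ e.symm z.1) z h1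
  have h3 : ContMDiffAt 𝓘(ℝ, Coord n × Coord n) 𝓘(ℝ, Coord n →L[ℝ] ℝ) ∞
      (fun z : Coord n × Coord n ↦ flat n z.2) z :=
    ((flat n).contDiff.comp contDiff_snd).contMDiff.contMDiffAt
  exact h3.clm_comp h2

/-- The cotangent coordinates `(y, P)` of `T*M` associated with the coordinates `y` of `M`, with the
covectors identified with vectors of `ℝⁿ`. -/
def coCoord (e : OpenPartialHomeomorph M (Coord n)) (he : IsSmoothCoord I e) :
    OpenPartialHomeomorph (Cotangent I M) (Coord n × Coord n) where
  toFun x := ((coLift e x).1, (flat n).symm (coLift e x).2)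
  invFun := coLiftSymm I e
  source := TotalSpace.proj ⁻¹' e.source
  target := e.target ×ˢ univ
  map_source' x hx := ⟨e.map_source hx, mem_univ _⟩
  map_target' z hz := e.map_target hz.1
  left_inv' x hx := by
    have h1 : e.symm (e x.1) = x.1 := e.left_inv hx
    simp only [coLiftSymm, coLift, ContinuousLinearEquiv.apply_symm_apply]
    rw [h1, ContinuousLinearMap.comp_assoc, (he.isInvertible hx).inverse_comp_self]
    rfl
  right_inv' z hz := by
    refine Prod.ext (e.right_inv hz.1) ?_
    simp only [coLiftSymm, coLift, cov_proj, fib_cov]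
    rw [ContinuousLinearMap.comp_assoc, (he.isInvertible (e.map_target hz.1)).self_comp_inverse]
    exact (flat n).symm_apply_apply z.2
  open_source := e.open_source.preimage contMDiff_proj_cotangent.continuous
  open_target := e.open_target.prod isOpen_univ
  continuousOn_toFun x hx := by
    have h := (contMDiffAt_coLift (he.contMDiffAt hx) (he.isInvertible hx)).continuousAt
    exact (h.fst.prodMk ((flat n).symm.continuous.continuousAt.comp h.snd)).continuousWithinAt
  continuousOn_invFun z hz := (contMDiffAt_coLiftSymm he hz.1).continuousAt.continuousWithinAt

theorem coCoord_apply {e : OpenPartialHomeomorph M (Coord n)} (he : IsSmoothCoord I e)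
    (x : Cotangent I M) :
    coCoord e he x = (e x.1, (flat n).symm ((fib x).comp (vdiff I e x.1).inverse)) := rfl

theorem isSmoothCoord_coCoord {e : OpenPartialHomeomorph M (Coord n)} (he : IsSmoothCoord I e) :
    IsSmoothCoord (coModel I) (coCoord e he) := by
  refine ⟨fun x hx ↦ ContMDiffAt.contMDiffWithinAt ?_,
    fun z hz ↦ (contMDiffAt_coLiftSymm he hz.1).contMDiffWithinAt⟩
  have h := contMDiffAt_coLift (he.contMDiffAt hx) (he.isInvertible hx)
  have h1 : ContDiff ℝ ∞ fun z : Coord n × (Coord n →L[ℝ] ℝ) ↦ (z.1, (flat n).symm z.2) := by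
    fun_prop
  exact h1.contMDiff.contMDiffAt.comp x h

theorem fib_eq_inner {e : OpenPartialHomeomorph M (Coord n)} (he : IsSmoothCoord I e)
    {x : Cotangent I M} (hx : x.1 ∈ e.source) (v : Coord n) :
    fib x v = inner ℝ (coCoord e he x).2 (vdiff I e x.1 v) := by
  rw [coCoord_apply, inner_flat_symm]
  exact congrArg (fib x) ((he.isInvertible hx).inverse_apply_self v).symm

/-- The differential of the coordinates `coCoord`. -/
theorem vdiff_coCoord {e : OpenPartialHomeomorph M (Coord n)} (he : IsSmoothCoord I e)
    {x : Cotangent I M} (hx : x.1 ∈ e.source) (u : Coord n × (Coord n →L[ℝ] ℝ)) :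
    vdiff (coModel I) (coCoord e he) x u = ((vdiff (coModel I) (coLift e) x u).1,
      (flat n).symm (vdiff (coModel I) (coLift e) x u).2) := by
  have h := (contMDiffAt_coLift (he.contMDiffAt hx) (he.isInvertible hx)).mdifferentiableAt
    (by simp)
  set A : Coord n × (Coord n →L[ℝ] ℝ) →L[ℝ] Coord n × Coord n :=
    (ContinuousLinearMap.fst ℝ _ _).prod ((flat n).symm.toContinuousLinearMap.comp
      (ContinuousLinearMap.snd ℝ _ _)) with hA
  have h1 : HasMFDerivAt (coModel I) 𝓘(ℝ, Coord n × Coord n) (A ∘ coLift e) x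
      (A.comp (vdiff (coModel I) (coLift e) x)) :=
    HasMFDerivAt.comp x A.hasMFDerivAt h.hasMFDerivAt
  exact DFunLike.congr_fun h1.mfderiv u

theorem vdiff_coCoord_fst {e : OpenPartialHomeomorph M (Coord n)} (he : IsSmoothCoord I e)
    {x : Cotangent I M} (hx : x.1 ∈ e.source) (u : Coord n × (Coord n →L[ℝ] ℝ)) :
    (vdiff (coModel I) (coCoord e he) x u).1 = vdiff I e x.1 u.1 := by
  rw [vdiff_coCoord he hx]
  exact vdiff_coLift_fst (he.contMDiffAt hx) (he.isInvertible hx) u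

/-- Cotangent coordinates are symplectic. -/
theorem stdForm_eq_coCoord {e : OpenPartialHomeomorph M (Coord n)} (he : IsSmoothCoord I e)
    {x : Cotangent I M} (hx : x.1 ∈ e.source) (u v : Coord n × (Coord n →L[ℝ] ℝ)) :
    stdForm (Coord n) u v =
      inner ℝ (vdiff (coModel I) (coCoord e he) x u).2 (vdiff (coModel I) (coCoord e he) x v).1 -
      inner ℝ (vdiff (coModel I) (coCoord e he) x v).2
        (vdiff (coModel I) (coCoord e he) x u).1 := by
  rw [vdiff_coCoord he hx, vdiff_coCoord he hx, inner_flat_symm, inner_flat_symm,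
    ← stdForm_vdiff_coLift (he.eventually hx), stdForm_apply]

end CotangentCoordinates

/-! ### Adapted coordinates near a critical point -/

section SignOperator

variable {n : ℕ}

/-- The diagonal operator `y ↦ (ε₁ y₁, …, εₙ yₙ)`. -/
def signOp (ε : Fin n → ℝ) : Coord n →L[ℝ] Coord n :=
  LinearMap.toContinuousLinearMap
    { toFun := fun y ↦ WithLp.toLp 2 fun j ↦ ε j * y j
      map_add' := fun y z ↦ by ext j; simp [mul_add]
      map_smul' := fun c y ↦ by ext j; simp [mul_left_comm] }

@[simp] theorem signOp_apply (ε : Fin n → ℝ) (y : Coord n) (j : Fin n) :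
    signOp ε y j = ε j * y j := rfl

theorem inner_signOp (ε : Fin n → ℝ) (y z : Coord n) :
    inner ℝ (signOp ε y) z = ∑ j, ε j * (y j * z j) := by
  rw [PiLp.inner_apply]
  refine Finset.sum_congr rfl fun j _ ↦ ?_
  simp
  ring

theorem inner_signOp_left (ε : Fin n → ℝ) (y z : Coord n) :
    inner ℝ (signOp ε y) z = inner ℝ y (signOp ε z) := by
  rw [inner_signOp, real_inner_comm, inner_signOp]
  simp only [mul_comm (y _)]

theorem signOp_signOp {ε : Fin n → ℝ} (hε : ∀ j, ε j = 1 ∨ ε j = -1) (y : Coord n) :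
    signOp ε (signOp ε y) = y := by
  ext j
  rcases hε j with h | h <;> simp [h]

end SignOperator

section AdaptedCoordinates

variable {n : ℕ} {H : Type*} [TopologicalSpace H] {I : ModelWithCorners ℝ (Coord n) H}
  {M : Type*} [TopologicalSpace M] [ChartedSpace H M] [IsManifold I ∞ M]

/-- Morse coordinates `e` at the critical point `a` in which the metric is Euclidean, on a domain
where the cut-off function is equal to `1`. The last condition, on `ν`, follows from the
others when `ν` is the gradient of `φ`. -/
structure IsAdaptedCoord (g : Metric I (M := M)) (φ : M → ℝ) (ν : M → Coord n) (χ : M → ℝ) (a : M)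
    (e : OpenPartialHomeomorph M (Coord n)) (ε : Fin n → ℝ) : Prop where
  smooth : IsSmoothCoord I e
  mem : a ∈ e.source
  map_centre : e a = 0
  sign : ∀ j, ε j = 1 ∨ ε j = -1
  morse : ∀ q ∈ e.source, φ q = φ a + inner ℝ (signOp ε (e q)) (e q)
  cutoff : ∀ q ∈ e.source, χ q = 1
  metric : ∀ q ∈ e.source, ∀ v w, gform g q v w = inner ℝ (vdiff I e q v) (vdiff I e q w)
  gradient : ∀ q ∈ e.source, vdiff I e q (ν q) = (2 : ℝ) • signOp ε (e q)

theorem hasFDerivAt_quadratic (D : Coord n →L[ℝ] Coord n)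
    (hD : ∀ v w, inner ℝ (D v) w = inner ℝ v (D w)) (y : Coord n) :
    HasFDerivAt (fun y ↦ (inner ℝ (D y) y : ℝ)) ((2 : ℝ) • innerSL ℝ (D y)) y := by
  have h := (D.hasFDerivAt (x := y)).inner ℝ (hasFDerivAt_id y)
  refine h.congr_fderiv (ContinuousLinearMap.ext fun v ↦ ?_)
  simp [fderivInnerCLM_apply, hD v y, two_mul, real_inner_comm (D y) v]

/-- Morse coordinates in which the metric is Euclidean, restricted to a domain where `χ = 1`, are
adapted: the gradient of `∑ εⱼ yⱼ²` for the Euclidean metric is `2 ∑ εⱼ yⱼ ∂_{yⱼ}`. -/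
theorem exists_isAdaptedCoord {g : Metric I (M := M)} {φ : M → ℝ} {ν : M → Coord n}
    {χ : M → ℝ} {a : M} (hg : ∀ q, gform g q (ν q) = vdiff I φ q) (hχ : ∀ᶠ q in 𝓝 a, χ q = 1)
    (he : ∃ e ε, IsMorseCoord I φ a e ε ∧ ∀ q ∈ e.source, ∀ v w,
      gform g q v w = inner ℝ (vdiff I e q v) (vdiff I e q w)) :
    ∃ e ε, IsAdaptedCoord g φ ν χ a e ε := by
  obtain ⟨e, ε, ⟨⟨hs, hs'⟩, hmem, h0, hε, hφ⟩, hm⟩ := he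
  obtain ⟨U, hU, hUo, haU⟩ := eventually_nhds_iff.1 hχ
  have hr : IsSmoothCoord I (e.restrOpen U hUo) := by
    refine ⟨hs.mono inter_subset_left, hs'.mono fun z hz ↦ ?_⟩
    simp only [mfld_simps] at hz
    exact hz.1
  have hsum : ∀ q, ∑ j, ε j * e q j ^ 2 = inner ℝ (signOp ε (e q)) (e q) := fun q ↦ by
    rw [inner_signOp]
    simp only [sq]
  have hmet : ∀ q ∈ (e.restrOpen U hUo).source, ∀ v w : Coord n,
      gform g q v w = inner ℝ (vdiff I e q v) (vdiff I e q w) := fun q hq v w ↦ hm q hq.1 v w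
  have hmor : ∀ q ∈ (e.restrOpen U hUo).source, φ q = φ a + inner ℝ (signOp ε (e q)) (e q) :=
    fun q hq ↦ by rw [← hsum]; exact hφ q hq.1
  refine ⟨e.restrOpen U hUo, ε, ⟨hr, ⟨hmem, haU⟩, h0, hε, hmor, fun q hq ↦ hU q hq.2, hmet,
    fun q hq ↦ ?_⟩⟩
  have h2 : ∀ w, vdiff I φ q w = ((2 : ℝ) • innerSL ℝ (signOp ε (e q))) (vdiff I e q w) :=
    hr.vdiff_eq hq ((hasFDerivAt_quadratic (signOp ε) (inner_signOp_left ε) (e q)).const_add (φ a))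
      hmor
  refine ext_inner_right ℝ fun w ↦ ?_
  have hA := (hr.isInvertible hq).self_apply_inverse w
  have h3 : gform g q (ν q) ((vdiff I e q).inverse w) = vdiff I φ q ((vdiff I e q).inverse w) :=
    DFunLike.congr_fun (hg q) _
  have hA' : vdiff I e q ((vdiff I e q).inverse w) = w := hA
  rw [hmet q hq, h2, hA'] at h3
  refine h3.trans ?_
  simp [inner_smul_left]

namespace IsAdaptedCoord

variable {g : Metric I (M := M)} {φ χ : M → ℝ} {ν : M → Coord n} {a : M}
  {e : OpenPartialHomeomorph M (Coord n)} {ε : Fin n → ℝ}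

theorem kinetic_eq (h : IsAdaptedCoord g φ ν χ a e ε) {x : Cotangent I M} (hx : x.1 ∈ e.source) :
    kinetic g x = 1 / 2 * inner ℝ (coCoord e h.smooth x).2 (coCoord e h.smooth x).2 := by
  have h1 : vdiff I e x.1 (gsharp g x) = (coCoord e h.smooth x).2 := by
    refine ext_inner_right ℝ fun w ↦ ?_
    have hA : vdiff I e x.1 ((vdiff I e x.1).inverse w) = w :=
      (h.smooth.isInvertible hx).self_apply_inverse w
    rw [← hA, ← h.metric _ hx, gform_gsharp, fib_eq_inner h.smooth hx]
  rw [kinetic_eq_gsharp, fib_eq_inner h.smooth hx, h1]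

theorem mom_eq (h : IsAdaptedCoord g φ ν χ a e ε) {x : Cotangent I M} (hx : x.1 ∈ e.source) :
    mom ν x = 2 * inner ℝ (coCoord e h.smooth x).2 (signOp ε (coCoord e h.smooth x).1) := by
  rw [mom, fib_eq_inner h.smooth hx, h.gradient _ hx, inner_smul_right]
  rfl

theorem surjective_vdiff (h : IsAdaptedCoord g φ ν χ a e ε) {x : Cotangent I M}
    (hx : x.1 ∈ e.source) (w : Coord n × Coord n) :
    ∃ u, vdiff (coModel I) (coCoord e h.smooth) x u = w :=
  ⟨_, ((isSmoothCoord_coCoord h.smooth).isInvertible (x := x) hx).self_apply_inverse w⟩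

theorem vdiff_injective (h : IsAdaptedCoord g φ ν χ a e ε) {x : Cotangent I M}
    (hx : x.1 ∈ e.source) {u : Coord n × (Coord n →L[ℝ] ℝ)}
    (hu : vdiff (coModel I) (coCoord e h.smooth) x u = 0) : u = 0 := by
  have h1 := ((isSmoothCoord_coCoord h.smooth).isInvertible (x := x) hx).inverse_apply_self u
  rw [← h1, hu, map_zero]

theorem vdiff_mom (h : IsAdaptedCoord g φ ν χ a e ε) {x : Cotangent I M} (hx : x.1 ∈ e.source)
    (u : Coord n × (Coord n →L[ℝ] ℝ)) :
    vdiff (coModel I) (mom ν) x u =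
      2 * (inner ℝ (vdiff (coModel I) (coCoord e h.smooth) x u).2
        (signOp ε (coCoord e h.smooth x).1) +
      inner ℝ (coCoord e h.smooth x).2
        (signOp ε (vdiff (coModel I) (coCoord e h.smooth) x u).1)) := by
  have h1 := ((hasFDerivAt_snd (𝕜 := ℝ) (p := coCoord e h.smooth x)).inner ℝ
    ((signOp ε).hasFDerivAt.comp (coCoord e h.smooth x) hasFDerivAt_fst)).const_mul 2
  rw [(isSmoothCoord_coCoord h.smooth).vdiff_eq hx h1 fun y hy ↦ h.mom_eq hy]
  simp [fderivInnerCLM_apply]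
  ring

/-- In adapted coordinates, the Hamiltonian lift is `2 ∑ εⱼ (yⱼ ∂_{yⱼ} - Pⱼ ∂_{Pⱼ})`. -/
theorem vdiff_hlift (h : IsAdaptedCoord g φ ν χ a e ε) (hν : ∀ q, SmoothFieldAt I ν q)
    {x : Cotangent I M} (hx : x.1 ∈ e.source) :
    vdiff (coModel I) (coCoord e h.smooth) x (hlift ν x) =
      ((2 : ℝ) • signOp ε (coCoord e h.smooth x).1, -(2 : ℝ) • signOp ε (coCoord e h.smooth x).2) := by
  have h1 : (vdiff (coModel I) (coCoord e h.smooth) x (hlift ν x)).1 =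
      (2 : ℝ) • signOp ε (coCoord e h.smooth x).1 := by
    rw [vdiff_coCoord_fst h.smooth hx]
    exact h.gradient _ hx
  -- the fibre component is determined by pairing, through `ω`, with the horizontal vectors
  refine Prod.ext h1 (ext_inner_right ℝ fun w ↦ ?_)
  obtain ⟨u, hu⟩ := h.surjective_vdiff hx (w, 0)
  have h2 := DFunLike.congr_fun (stdForm_hlift hν x) u
  rw [stdForm_eq_coCoord h.smooth hx, neg_apply, h.vdiff_mom hx, hu] at h2
  simp only [inner_zero_left, sub_zero, zero_add] at h2
  rw [h2, ← inner_signOp_left, inner_smul_left]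
  simp

theorem vdiff_kinetic (h : IsAdaptedCoord g φ ν χ a e ε) {x : Cotangent I M} (hx : x.1 ∈ e.source)
    (u : Coord n × (Coord n →L[ℝ] ℝ)) :
    vdiff (coModel I) (kinetic g) x u =
      inner ℝ (coCoord e h.smooth x).2 (vdiff (coModel I) (coCoord e h.smooth) x u).2 := by
  have h1 := ((hasFDerivAt_snd (𝕜 := ℝ) (p := coCoord e h.smooth x)).inner ℝ
    hasFDerivAt_snd).const_mul (1 / 2 : ℝ)
  rw [(isSmoothCoord_coCoord h.smooth).vdiff_eq hx h1 fun y hy ↦ h.kinetic_eq hy]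
  simp [fderivInnerCLM_apply, real_inner_comm]
  ring

theorem dkin_eq (h : IsAdaptedCoord g φ ν χ a e ε) (hν : ∀ q, SmoothFieldAt I ν q)
    {x : Cotangent I M} (hx : x.1 ∈ e.source) :
    dkin g ν x = -2 * inner ℝ (signOp ε (coCoord e h.smooth x).2) (coCoord e h.smooth x).2 := by
  rw [dkin, h.vdiff_kinetic hx, h.vdiff_hlift hν hx, inner_smul_right, real_inner_comm]

theorem reCpx_eq (h : IsAdaptedCoord g φ ν χ a e ε) (hν : ∀ q, SmoothFieldAt I ν q)
    {x : Cotangent I M} (hx : x.1 ∈ e.source) :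
    reCpx g φ ν χ x = φ a + inner ℝ (signOp ε (coCoord e h.smooth x).1) (coCoord e h.smooth x).1 -
      inner ℝ (signOp ε (coCoord e h.smooth x).2) (coCoord e h.smooth x).2 := by
  rw [reCpx, h.dkin_eq hν hx, h.morse _ hx, h.cutoff _ hx]
  simp only [coCoord_apply]
  ring

/-- In adapted coordinates, `f⁰` is the potential of the Hamiltonian lift for the Euclidean
metric. -/
theorem vdiff_reCpx (h : IsAdaptedCoord g φ ν χ a e ε) (hν : ∀ q, SmoothFieldAt I ν q)
    {x : Cotangent I M} (hx : x.1 ∈ e.source) (u : Coord n × (Coord n →L[ℝ] ℝ)) :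
    vdiff (coModel I) (reCpx g φ ν χ) x u =
      2 * inner ℝ (signOp ε (coCoord e h.smooth x).1)
        (vdiff (coModel I) (coCoord e h.smooth) x u).1 -
      2 * inner ℝ (signOp ε (coCoord e h.smooth x).2)
        (vdiff (coModel I) (coCoord e h.smooth) x u).2 := by
  have hq := hasFDerivAt_quadratic (signOp ε) (inner_signOp_left ε)
  have h1 := (((hq (coCoord e h.smooth x).1).comp (coCoord e h.smooth x)
    (hasFDerivAt_fst (𝕜 := ℝ))).const_add (φ a)).sub
    ((hq (coCoord e h.smooth x).2).comp (coCoord e h.smooth x) (hasFDerivAt_snd (𝕜 := ℝ)))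
  rw [(isSmoothCoord_coCoord h.smooth).vdiff_eq hx h1 fun y hy ↦ h.reCpx_eq hν hy]
  simp

/-- In adapted coordinates, the Liouville field is `∑ Pⱼ ∂_{Pⱼ}`. -/
theorem vdiff_liouville (h : IsAdaptedCoord g φ ν χ a e ε) {x : Cotangent I M}
    (hx : x.1 ∈ e.source) :
    vdiff (coModel I) (coCoord e h.smooth) x (0, fib x) = (0, (coCoord e h.smooth x).2) := by
  have h1 : (vdiff (coModel I) (coCoord e h.smooth) x (0, fib x)).1 = 0 := by
    rw [vdiff_coCoord_fst h.smooth hx]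
    exact map_zero _
  refine Prod.ext h1 (ext_inner_right ℝ fun w ↦ ?_)
  obtain ⟨u, hu⟩ := h.surjective_vdiff hx (w, 0)
  have h2 := stdForm_eq_coCoord h.smooth hx (0, fib x) u
  rw [hu, stdForm_apply, fib_eq_inner h.smooth hx, ← vdiff_coCoord_fst h.smooth hx, hu] at h2
  simpa using h2.symm

end IsAdaptedCoord

end AdaptedCoordinates

/-! ### Lyapunov forms near the zero-section -/

section ZeroSection

variable {n : ℕ} {H : Type*} [TopologicalSpace H] {I : ModelWithCorners ℝ (Coord n) H}
  {M : Type*} [TopologicalSpace M] [ChartedSpace H M] [IsManifold I ∞ M]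

/-- The data `(g, φ, ν, χ)`: the vector field `ν` is the gradient of `φ` for `g`, and there are
adapted coordinates near each critical point. -/
structure IsGradientData (g : Metric I (M := M)) (φ : M → ℝ) (ν : M → Coord n) (χ : M → ℝ) :
    Prop where
  contMDiff : ContMDiff I 𝓘(ℝ, ℝ) ∞ φ
  contMDiff_cutoff : ContMDiff I 𝓘(ℝ, ℝ) ∞ χ
  cutoff_mem : ∀ q, χ q ∈ Icc (0 : ℝ) 1
  smooth : ∀ q, SmoothFieldAt I ν q
  gradient : ∀ q, gform g q (ν q) = vdiff I φ q
  exists_coord : ∀ a, vdiff I φ a = 0 → ∃ e ε, IsAdaptedCoord g φ ν χ a e ε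

/-- The Euclidean scalar product of `ℝⁿ × ℝⁿ`. -/
def prodInner (n : ℕ) : Coord n × Coord n →L[ℝ] Coord n × Coord n →L[ℝ] ℝ :=
  (flat n).toContinuousLinearMap.bilinearComp (ContinuousLinearMap.fst ℝ _ _)
    (ContinuousLinearMap.fst ℝ _ _) +
  (flat n).toContinuousLinearMap.bilinearComp (ContinuousLinearMap.snd ℝ _ _)
    (ContinuousLinearMap.snd ℝ _ _)

theorem prodInner_apply (u v : Coord n × Coord n) :
    prodInner n u v = inner ℝ u.1 v.1 + inner ℝ u.2 v.2 := rfl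

theorem prodInner_pos {u : Coord n × Coord n} (hu : u ≠ 0) : 0 < prodInner n u u := by
  rw [prodInner_apply]
  by_cases h : u.1 = 0
  · have h2 : u.2 ≠ 0 := fun h2 ↦ hu (Prod.ext h h2)
    have := real_inner_self_pos.2 h2
    simpa [h] using this
  · linarith [real_inner_self_pos.2 h, real_inner_self_nonneg (x := u.2)]

section Adapted

variable {g : Metric I (M := M)} {φ χ : M → ℝ} {ν : M → Coord n} {a : M}
  {e : OpenPartialHomeomorph M (Coord n)} {ε : Fin n → ℝ}

/-- The Euclidean metric of `T*M` in adapted coordinates. -/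
def euclForm (e : OpenPartialHomeomorph M (Coord n)) (he : IsSmoothCoord I e)
    (x : Cotangent I M) :
    Coord n × (Coord n →L[ℝ] ℝ) →L[ℝ] Coord n × (Coord n →L[ℝ] ℝ) →L[ℝ] ℝ :=
  (prodInner n).bilinearComp (vdiff (coModel I) (coCoord e he) x)
    (vdiff (coModel I) (coCoord e he) x)

theorem euclForm_apply (he : IsSmoothCoord I e) (x : Cotangent I M)
    (u v : Coord n × (Coord n →L[ℝ] ℝ)) : euclForm e he x u v =
      inner ℝ (vdiff (coModel I) (coCoord e he) x u).1 (vdiff (coModel I) (coCoord e he) x v).1 +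
      inner ℝ (vdiff (coModel I) (coCoord e he) x u).2
        (vdiff (coModel I) (coCoord e he) x v).2 := rfl

theorem smoothFormAt_euclForm (he : IsSmoothCoord I e) {x : Cotangent I M} (hx : x.1 ∈ e.source) :
    SmoothFormAt (coModel I) (euclForm e he) x :=
  smoothFormAt_pullback (V := Coord n × Coord n) (f := coCoord e he)
    (B := fun _ : Cotangent I M ↦ prodInner n)
    ((isSmoothCoord_coCoord he).1.contMDiffAt ((coCoord e he).open_source.mem_nhds hx))
    contMDiffAt_const

theorem IsAdaptedCoord.euclForm_pos (h : IsAdaptedCoord g φ ν χ a e ε) {x : Cotangent I M}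
    (hx : x.1 ∈ e.source) {η : Coord n × (Coord n →L[ℝ] ℝ)} (hη : η ≠ 0) :
    0 < euclForm e h.smooth x η η :=
  prodInner_pos fun h0 ↦ hη (h.vdiff_injective hx h0)

theorem IsAdaptedCoord.euclForm_hlift (h : IsAdaptedCoord g φ ν χ a e ε)
    (hν : ∀ q, SmoothFieldAt I ν q) {x : Cotangent I M} (hx : x.1 ∈ e.source) :
    euclForm e h.smooth x (hlift ν x) = vdiff (coModel I) (reCpx g φ ν χ) x := by
  refine ContinuousLinearMap.ext fun u ↦ ?_
  rw [h.vdiff_reCpx hν hx]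
  rw [euclForm_apply, h.vdiff_hlift hν hx, inner_smul_left, inner_smul_left]
  simp
  ring

/-- The radial field is orthogonal to the spheres for the Euclidean metric, so that passing from
`ν̃` to `ν̄` does not change the restriction of the associated covector to the spheres. -/
theorem IsAdaptedCoord.euclForm_clift (h : IsAdaptedCoord g φ ν χ a e ε)
    (hν : ∀ q, SmoothFieldAt I ν q) {x : Cotangent I M} (hx : x.1 ∈ e.source)
    {w : Coord n × (Coord n →L[ℝ] ℝ)} (hw : vdiff (coModel I) (kinetic g) x w = 0) :
    euclForm e h.smooth x (clift g ν x) w = vdiff (coModel I) (reCpx g φ ν χ) x w := by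
  have h1 : euclForm e h.smooth x (0, fib x) w = 0 := by
    rw [euclForm_apply, h.vdiff_liouville hx, ← h.vdiff_kinetic hx, hw]
    simp
  rw [clift, map_sub, map_smul, h.euclForm_hlift hν hx, sub_apply, smul_apply, h1, smul_zero,
    sub_zero]

end Adapted

/-- The points of `T*M` which either lie over adapted coordinates or where the derivatives of `f⁰`
along the Hamiltonian lift and (when `C` bounds `dρ(ν̃) / ρ`) along the contact lift are
positive. -/
def goodSet (g : Metric I (M := M)) (φ : M → ℝ) (ν : M → Coord n) (χ : M → ℝ) (C : ℝ) :
    Set (Cotangent I M) :=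
  {x | ∃ a e ε, IsAdaptedCoord g φ ν χ a e ε ∧ x.1 ∈ e.source} ∪
    {x | C ^ 2 / 2 * kinetic g x < vdiff (coModel I) (reCpx g φ ν χ) x (hlift ν x)}

namespace IsGradientData

variable {g : Metric I (M := M)} {φ χ : M → ℝ} {ν : M → Coord n} {C : ℝ}

theorem continuous_hlift_reCpx (h : IsGradientData g φ ν χ) :
    Continuous fun x : Cotangent I M ↦ vdiff (coModel I) (reCpx g φ ν χ) x (hlift ν x) :=
  continuous_iff_continuousAt.2 fun x ↦ ((smoothFieldAt_hlift h.smooth x).contMDiffAt_vdiff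
    (contMDiff_reCpx g h.contMDiff h.contMDiff_cutoff h.smooth x)).continuousAt

theorem isOpen_goodSet (h : IsGradientData g φ ν χ) (C : ℝ) : IsOpen (goodSet g φ ν χ C) := by
  refine IsOpen.union ?_ (isOpen_lt (continuous_const.mul (contMDiff_kinetic g).continuous)
    h.continuous_hlift_reCpx)
  refine isOpen_iff_mem_nhds.2 fun x ⟨a, e, ε, he, hx⟩ ↦ ?_
  filter_upwards [(e.open_source.preimage contMDiff_proj_cotangent.continuous).mem_nhds hx]
    with y hy
  exact ⟨a, e, ε, he, hy⟩

theorem field_eq_zero_iff (h : IsGradientData g φ ν χ) {q : M} : ν q = 0 ↔ vdiff I φ q = 0 := by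
  rw [← h.gradient]
  exact ⟨fun h0 ↦ by rw [h0, map_zero], gform_injective g q _⟩

theorem zero_mem_goodSet (h : IsGradientData g φ ν χ) (C : ℝ) (q : M) :
    cov q 0 ∈ goodSet g φ ν χ C := by
  by_cases hq : vdiff I φ q = 0
  · obtain ⟨e, ε, he⟩ := h.exists_coord q hq
    exact Or.inl ⟨q, e, ε, he, he.mem⟩
  · refine Or.inr ?_
    have h0 : kinetic g (cov q 0) = 0 := by
      rw [kinetic_eq_gsharp, fib_cov]
      simp
    change C ^ 2 / 2 * kinetic g (cov q 0) < vdiff (coModel I) (reCpx g φ ν χ) (cov q 0)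
      (hlift ν (cov q 0 : Cotangent I M))
    rw [vdiff_reCpx_zero g h.contMDiff h.contMDiff_cutoff h.smooth, h0, mul_zero, ← h.gradient]
    exact gform_pos g q fun h1 ↦ hq (h.field_eq_zero_iff.1 h1)

theorem pos_clift (h : IsGradientData g φ ν χ)
    (hC : ∀ x : Cotangent I M, |dkin g ν x| ≤ C * kinetic g x)
    {x : Cotangent I M} (hx : C ^ 2 / 2 * kinetic g x <
      vdiff (coModel I) (reCpx g φ ν χ) x (hlift ν x)) (h0 : kinetic g x ≠ 0) :
    0 < vdiff (coModel I) (reCpx g φ ν χ) x (clift g ν x) := by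
  rw [vdiff_reCpx_clift g h.contMDiff h.contMDiff_cutoff h.smooth]
  have hk : 0 < kinetic g x := (kinetic_nonneg g x).lt_of_ne' h0
  have h1 : dkin g ν x ^ 2 ≤ (C * kinetic g x) ^ 2 :=
    sq_le_sq' (neg_le_of_abs_le (hC x)) (le_of_abs_le (hC x))
  have h2 : χ x.1 * dkin g ν x ^ 2 ≤ (C * kinetic g x) ^ 2 :=
    (mul_le_of_le_one_left (sq_nonneg _) (h.cutoff_mem x.1).2).trans h1
  have h3 : χ x.1 * dkin g ν x ^ 2 / (2 * kinetic g x) ≤ C ^ 2 / 2 * kinetic g x := by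
    rw [div_le_iff₀ (by positivity)]
    refine h2.trans (le_of_eq ?_)
    ring
  linarith

/-- A local solution of `L ν̃ = df⁰`. -/
theorem exists_form_hlift (h : IsGradientData g φ ν χ) {x₀ : Cotangent I M}
    (hx₀ : x₀ ∈ goodSet g φ ν χ C) : ∃ V ∈ 𝓝 x₀, ∃ L : Cotangent I M →
      Coord n × (Coord n →L[ℝ] ℝ) →L[ℝ] Coord n × (Coord n →L[ℝ] ℝ) →L[ℝ] ℝ, ∀ x ∈ V,
      SmoothFormAt (coModel I) L x ∧ (∀ η, η ≠ 0 → 0 < L x η η) ∧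
        L x (hlift ν x) = vdiff (coModel I) (reCpx g φ ν χ) x := by
  rcases hx₀ with ⟨a, e, ε, he, hx⟩ | hx
  · exact ⟨_, (e.open_source.preimage contMDiff_proj_cotangent.continuous).mem_nhds hx,
      euclForm e he.smooth, fun x hx ↦ ⟨smoothFormAt_euclForm he.smooth hx,
        fun η hη ↦ he.euclForm_pos hx hη, he.euclForm_hlift h.smooth hx⟩⟩
  · refine exists_lyapForm_of_pos (U := {x | 0 < vdiff (coModel I) (reCpx g φ ν χ) x (hlift ν x)})
      (isOpen_lt continuous_const h.continuous_hlift_reCpx)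
      (fun x _ ↦ contMDiff_reCpx g h.contMDiff h.contMDiff_cutoff h.smooth x)
      (fun x _ ↦ smoothFieldAt_hlift h.smooth x) (fun x hx ↦ hx) ?_
    exact (mul_nonneg (by positivity) (kinetic_nonneg g x₀)).trans_lt hx

/-- A local solution of `L ν̄ = d(f⁰|_{V_r})`. -/
theorem exists_form_clift (h : IsGradientData g φ ν χ)
    (hC : ∀ x : Cotangent I M, |dkin g ν x| ≤ C * kinetic g x) {x₀ : Cotangent I M}
    (hx₀ : x₀ ∈ goodSet g φ ν χ C) (h0 : kinetic g x₀ ≠ 0) : ∃ V ∈ 𝓝 x₀, ∃ L : Cotangent I M →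
      Coord n × (Coord n →L[ℝ] ℝ) →L[ℝ] Coord n × (Coord n →L[ℝ] ℝ) →L[ℝ] ℝ, ∀ x ∈ V,
      SmoothFormAt (coModel I) L x ∧ (∀ η, η ≠ 0 → 0 < L x η η) ∧
        ∀ w, vdiff (coModel I) (kinetic g) x w = 0 →
          L x (clift g ν x) w = vdiff (coModel I) (reCpx g φ ν χ) x w := by
  rcases hx₀ with ⟨a, e, ε, he, hx⟩ | hx
  · exact ⟨_, (e.open_source.preimage contMDiff_proj_cotangent.continuous).mem_nhds hx,
      euclForm e he.smooth, fun x hx ↦ ⟨smoothFormAt_euclForm he.smooth hx,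
        fun η hη ↦ he.euclForm_pos hx hη, fun w hw ↦ he.euclForm_clift h.smooth hx hw⟩⟩
  · obtain ⟨V, hV, L, hL⟩ := exists_lyapForm_of_pos (J := coModel I)
      (f := reCpx g φ ν χ) (X := clift g ν) (x₀ := x₀)
      (U := {x | C ^ 2 / 2 * kinetic g x < vdiff (coModel I) (reCpx g φ ν χ) x (hlift ν x)} ∩
        {x | kinetic g x ≠ 0})
      ((isOpen_lt (continuous_const.mul (contMDiff_kinetic g).continuous)
        h.continuous_hlift_reCpx).inter (isOpen_ne_fun (contMDiff_kinetic g).continuous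
          continuous_const))
      (fun x _ ↦ contMDiff_reCpx g h.contMDiff h.contMDiff_cutoff h.smooth x)
      (fun x hx ↦ smoothFieldAt_clift h.smooth g hx.2) (fun x hx ↦ h.pos_clift hC hx.1 hx.2)
      ⟨hx, h0⟩
    exact ⟨V, hV, L, fun x hx ↦ ⟨(hL x hx).1, (hL x hx).2.1, fun w _ ↦
      DFunLike.congr_fun (hL x hx).2.2 w⟩⟩

/-- The zeros of the Hamiltonian lift near the zero-section. -/
theorem hlift_eq_zero_iff (h : IsGradientData g φ ν χ) {x : Cotangent I M}
    (hx : x ∈ goodSet g φ ν χ C) : hlift ν x = 0 ↔ vdiff I φ x.1 = 0 ∧ fib x = 0 := by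
  refine ⟨fun h0 ↦ ?_, fun h0 ↦ ?_⟩
  · refine ⟨h.field_eq_zero_iff.1 (congrArg Prod.fst h0), ?_⟩
    rcases hx with ⟨a, e, ε, he, hx⟩ | hx
    · have h1 := he.vdiff_hlift h.smooth hx
      rw [h0, map_zero] at h1
      have h2 : signOp ε (coCoord e he.smooth x).2 = 0 := by
        have := (congrArg Prod.snd h1).symm
        simpa using this
      have h3 : (coCoord e he.smooth x).2 = 0 := by
        rw [← signOp_signOp he.sign (coCoord e he.smooth x).2, h2, map_zero]
      refine fib_eq_zero_of_kinetic g ?_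
      rw [he.kinetic_eq hx, h3, inner_zero_left, mul_zero]
    · have h1 := (mul_nonneg (by positivity) (kinetic_nonneg g x)).trans_lt hx
      rw [h0, map_zero] at h1
      exact absurd h1 (lt_irrefl 0)
  · have h1 : ν x.1 = 0 := h.field_eq_zero_iff.2 h0.1
    simp [hlift, h1, h0.2]

theorem isLyapunovOn_tube (h : IsGradientData g φ ν χ) [T2Space M] [CompactSpace M] {δ : ℝ}
    (hδ : tube g δ ⊆ goodSet g φ ν χ C) :
    IsLyapunovOn (J := coModel I) (tube g δ) (fun _ ↦ ⊤) (hlift (I := I) ν) (reCpx g φ ν χ) := by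
  have := t2Space_cotangent (I := I) (M := M)
  have := sigmaCompactSpace_cotangent g
  refine isLyapunovOn_of_local (isClosed_tube g δ)
    (contMDiff_reCpx g h.contMDiff h.contMDiff_cutoff h.smooth) (fun x _ ↦ Submodule.mem_top)
    fun x₀ hx₀ ↦ ?_
  obtain ⟨V, hV, L, hL⟩ := h.exists_form_hlift (hδ hx₀)
  exact ⟨V, hV, L, fun x hx ↦ ⟨(hL x hx).1, fun _ ↦ ⟨fun η _ hη ↦ (hL x hx).2.1 η hη,
    fun w _ ↦ DFunLike.congr_fun (hL x hx).2.2 w⟩⟩⟩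

theorem kinetic_ne_zero_of_mem {r : ℝ} (hr : 0 < r) {x : Cotangent I M}
    (hx : x ∈ sphereBundle g r) : kinetic g x ≠ 0 := by
  have := (mem_sphereBundle g hr.le).1 hx
  have h2 : 0 < r ^ 2 := by positivity
  intro h3
  rw [h3] at this
  linarith

theorem sphereBundle_subset {r δ : ℝ} (hr : r ≤ δ) : sphereBundle g r ⊆ tube g δ :=
  fun x (hx : coNorm g x = r) ↦ hx.le.trans hr

theorem isLyapunovOn_sphereBundle (h : IsGradientData g φ ν χ) [T2Space M] [CompactSpace M]
    {r : ℝ} (hr : 0 < r) (hC : ∀ x : Cotangent I M, |dkin g ν x| ≤ C * kinetic g x)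
    (hS : sphereBundle g r ⊆ goodSet g φ ν χ C) :
    IsLyapunovOn (J := coModel I) (sphereBundle g r) (sphereTangent g) (clift (I := I) g ν)
      (reCpx g φ ν χ) := by
  have := t2Space_cotangent (I := I) (M := M)
  have := sigmaCompactSpace_cotangent g
  refine isLyapunovOn_of_local (isClosed_sphereBundle g r)
    (contMDiff_reCpx g h.contMDiff h.contMDiff_cutoff h.smooth)
    (fun x hx ↦ vdiff_kinetic_clift g (kinetic_ne_zero_of_mem hr hx)) fun x₀ hx₀ ↦ ?_
  obtain ⟨V, hV, L, hL⟩ := h.exists_form_clift hC (hS hx₀) (kinetic_ne_zero_of_mem hr hx₀)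
  exact ⟨V, hV, L, fun x hx ↦ ⟨(hL x hx).1, fun _ ↦ ⟨fun η _ hη ↦ (hL x hx).2.1 η hη,
    fun w hw ↦ (hL x hx).2.2 w hw⟩⟩⟩

/-- A point of `V_r` where the differential of `f⁰|_{V_r}` vanishes is a zero of the contact
lift. -/
theorem clift_eq_zero (h : IsGradientData g φ ν χ)
    (hC : ∀ x : Cotangent I M, |dkin g ν x| ≤ C * kinetic g x) {x : Cotangent I M}
    (hx : x ∈ goodSet g φ ν χ C) (h0 : kinetic g x ≠ 0)
    (hcrit : ∀ w, vdiff (coModel I) (kinetic g) x w = 0 →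
      vdiff (coModel I) (reCpx g φ ν χ) x w = 0) : clift g ν x = 0 := by
  obtain ⟨V, hV, L, hL⟩ := h.exists_form_clift hC hx h0
  obtain ⟨-, h1, h2⟩ := hL x (mem_of_mem_nhds hV)
  by_contra h3
  have h4 := vdiff_kinetic_clift (ν := ν) g h0
  have h5 := h1 _ h3
  rw [h2 _ h4, hcrit _ h4] at h5
  exact lt_irrefl 0 h5

end IsGradientData

end ZeroSection

/-! ### Critical points of the first-order complexification -/

section SmoothCoord

variable {F : Type*} [NormedAddCommGroup F] [NormedSpace ℝ F]
  {K : Type*} [TopologicalSpace K] {J : ModelWithCorners ℝ F K}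
  {W : Type*} [TopologicalSpace W] [ChartedSpace K W]
  {G G' : Type*} [NormedAddCommGroup G] [NormedSpace ℝ G] [NormedAddCommGroup G']
  [NormedSpace ℝ G'] {e : OpenPartialHomeomorph W G}

theorem IsSmoothCoord.trans (he : IsSmoothCoord J e) {e' : OpenPartialHomeomorph G G'}
    (h1 : ContDiffOn ℝ ∞ e' e'.source) (h2 : ContDiffOn ℝ ∞ e'.symm e'.target) :
    IsSmoothCoord J (e.trans e') := by
  refine ⟨?_, ?_⟩
  · refine ContMDiffOn.comp (I' := 𝓘(ℝ, G)) (t := e'.source) h1.contMDiffOn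
      (he.1.mono fun x hx ↦ ?_) fun x hx ↦ ?_
    · exact (by simpa using hx : x ∈ e.source ∧ e x ∈ e'.source).1
    · exact (by simpa using hx : x ∈ e.source ∧ e x ∈ e'.source).2
  · refine ContMDiffOn.comp (I' := 𝓘(ℝ, G)) (t := e.target) he.2
      (h2.contMDiffOn.mono fun x hx ↦ ?_) fun x hx ↦ ?_
    · exact (by simpa using hx : x ∈ e'.target ∧ e'.symm x ∈ e.target).1
    · exact (by simpa using hx : x ∈ e'.target ∧ e'.symm x ∈ e.target).2

variable (J) in
/-- The differential at `z` of a map from a vector space to a manifold. -/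
def tdiff (f : G → W) (z : G) : G →L[ℝ] F := mfderiv 𝓘(ℝ, G) J f z

theorem IsSmoothCoord.vdiff_tdiff_symm [IsManifold J ∞ W] (he : IsSmoothCoord J e) {z : G}
    (hz : z ∈ e.target) (ξ : G) :
    vdiff J e (e.symm z) (tdiff J e.symm z ξ) = ξ := by
  have h : e.MDifferentiable J 𝓘(ℝ, G) :=
    ⟨he.1.mdifferentiableOn (by simp), he.2.mdifferentiableOn (by simp)⟩
  have h1 := h.comp_symm_deriv hz
  exact DFunLike.congr_fun h1 ξ

end SmoothCoord

section ComplexCoordinates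

/-- The number `1` or `i`, a square root of the sign `ε`. -/
def signRoot (ε : ℝ) : ℂ := if ε = 1 then 1 else Complex.I

theorem signRoot_ne_zero (ε : ℝ) : signRoot ε ≠ 0 := by
  rw [signRoot]
  split_ifs
  · exact one_ne_zero
  · exact Complex.I_ne_zero

theorem signRoot_sq {ε : ℝ} (hε : ε = 1 ∨ ε = -1) : signRoot ε ^ 2 = (ε : ℂ) := by
  rcases hε with rfl | rfl
  · simp [signRoot]
  · rw [signRoot, if_neg (by norm_num)]
    simp

theorem conj_signRoot_mul (ε : ℝ) : starRingEnd ℂ (signRoot ε) * signRoot ε = 1 := by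
  rw [signRoot]
  split_ifs <;> simp

/-- The complex coordinates `zⱼ = yⱼ + i Pⱼ` if `εⱼ = 1`, `zⱼ = i (yⱼ + i Pⱼ)` otherwise. -/
def complexCoord {n : ℕ} (ε : Fin n → ℝ) : (Coord n × Coord n) ≃L[ℝ] (Fin n → ℂ) :=
  LinearEquiv.toContinuousLinearEquiv
    { toFun := fun z j ↦ signRoot (ε j) * ⟨z.1 j, z.2 j⟩
      invFun := fun ξ ↦ (WithLp.toLp 2 fun j ↦ ((signRoot (ε j))⁻¹ * ξ j).re,
        WithLp.toLp 2 fun j ↦ ((signRoot (ε j))⁻¹ * ξ j).im)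
      map_add' := fun z w ↦ by
        ext j
        rw [Pi.add_apply, ← mul_add]
        rfl
      map_smul' := fun c z ↦ by
        ext j
        have : (⟨(c • z).1 j, (c • z).2 j⟩ : ℂ) = c * ⟨z.1 j, z.2 j⟩ := by
          apply Complex.ext <;> simp
        simp only [this, RingHom.id_apply, Pi.smul_apply, Complex.real_smul]
        ring
      left_inv := fun z ↦ by
        refine Prod.ext ?_ ?_ <;> ext j <;> simp [signRoot_ne_zero]
      right_inv := fun ξ ↦ by
        ext j
        simp only [Complex.eta]
        exact mul_inv_cancel_left₀ (signRoot_ne_zero _) _ }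

theorem complexCoord_apply {n : ℕ} (ε : Fin n → ℝ) (z : Coord n × Coord n) (j : Fin n) :
    complexCoord ε z j = signRoot (ε j) * ⟨z.1 j, z.2 j⟩ := rfl

/-- The standard symplectic form in the complex coordinates. -/
theorem sum_conj_complexCoord {n : ℕ} (ε : Fin n → ℝ) (u v : Coord n × Coord n) :
    ∑ j, (starRingEnd ℂ (complexCoord ε u j) * complexCoord ε v j).im =
      inner ℝ v.2 u.1 - inner ℝ u.2 v.1 := by
  rw [PiLp.inner_apply, PiLp.inner_apply, ← Finset.sum_sub_distrib]
  refine Finset.sum_congr rfl fun j _ ↦ ?_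
  have h1 : starRingEnd ℂ (complexCoord ε u j) * complexCoord ε v j =
      starRingEnd ℂ ⟨u.1 j, u.2 j⟩ * ⟨v.1 j, v.2 j⟩ := by
    rw [complexCoord_apply, complexCoord_apply, map_mul]
    linear_combination (starRingEnd ℂ ⟨u.1 j, u.2 j⟩ * ⟨v.1 j, v.2 j⟩) * conj_signRoot_mul (ε j)
  rw [h1]
  simp
  ring

theorem sum_complexCoord_sq {n : ℕ} {ε : Fin n → ℝ} (hε : ∀ j, ε j = 1 ∨ ε j = -1)
    (z : Coord n × Coord n) :
    ∑ j, complexCoord ε z j ^ 2 =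
      ((inner ℝ (signOp ε z.1) z.1 - inner ℝ (signOp ε z.2) z.2 : ℝ) : ℂ) +
        Complex.I * ((2 * inner ℝ z.2 (signOp ε z.1) : ℝ) : ℂ) := by
  rw [inner_signOp, inner_signOp, real_inner_comm (signOp ε z.1) z.2, inner_signOp]
  push_cast
  rw [← Finset.sum_sub_distrib, Finset.mul_sum, Finset.mul_sum, ← Finset.sum_add_distrib]
  refine Finset.sum_congr rfl fun j _ ↦ ?_
  have h1 : (⟨z.1 j, z.2 j⟩ : ℂ) = z.1 j + Complex.I * z.2 j := by
    apply Complex.ext <;> simp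
  rw [complexCoord_apply, mul_pow, signRoot_sq (hε j), h1]
  linear_combination (ε j : ℂ) * (z.2 j : ℂ) ^ 2 * Complex.I_sq

end ComplexCoordinates

section Critical

variable {n : ℕ} {H : Type*} [TopologicalSpace H] {I : ModelWithCorners ℝ (Coord n) H}
  {M : Type*} [TopologicalSpace M] [ChartedSpace H M] [IsManifold I ∞ M]
  {g : Metric I (M := M)} {φ χ : M → ℝ} {ν : M → Coord n} {C : ℝ}

/-- The first-order complexification `f⁰ + i ⟨p, ν⟩`. -/
def cpx (g : Metric I (M := M)) (φ : M → ℝ) (ν : M → Coord n) (χ : M → ℝ)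
    (x : Cotangent I M) : ℂ :=
  (reCpx g φ ν χ x : ℂ) + Complex.I * (mom (I := I) ν x : ℝ)

theorem vdiff_cpx (h : IsGradientData g φ ν χ) (x : Cotangent I M)
    (u : Coord n × (Coord n →L[ℝ] ℝ)) :
    vdiff (coModel I) (cpx g φ ν χ) x u =
      ⟨vdiff (coModel I) (reCpx g φ ν χ) x u, vdiff (coModel I) (mom ν) x u⟩ := by
  have h1 := ((contMDiff_reCpx g h.contMDiff h.contMDiff_cutoff h.smooth x).mdifferentiableAt
    (by simp)).hasMFDerivAt
  have h2 := ((contMDiff_mom h.smooth x).mdifferentiableAt (by simp)).hasMFDerivAt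
  have h3 := HasMFDerivAt.comp x Complex.ofRealCLM.hasMFDerivAt h1
  have h4 := HasMFDerivAt.comp x (Complex.I • Complex.ofRealCLM).hasMFDerivAt h2
  have h5 : vdiff (coModel I) (cpx g φ ν χ) x u =
      (vdiff (coModel I) (reCpx g φ ν χ) x u : ℂ) +
        Complex.I • (vdiff (coModel I) (mom ν) x u : ℂ) :=
    DFunLike.congr_fun (h3.add h4).mfderiv u
  rw [h5]
  apply Complex.ext <;> simp

/-- Near the zero-section, the complexification is a submersion precisely where the Hamiltonian
lift does not vanish. -/
theorem surjective_vdiff_cpx (h : IsGradientData g φ ν χ) {x : Cotangent I M}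
    (hx : x ∈ goodSet g φ ν χ C) :
    Function.Surjective (vdiff (coModel I) (cpx g φ ν χ) x) ↔ hlift ν x ≠ 0 := by
  refine ⟨fun hs h0 ↦ ?_, fun h0 c ↦ ?_⟩
  · obtain ⟨u, hu⟩ := hs Complex.I
    have h1 := stdForm_hlift h.smooth x
    rw [h0, map_zero] at h1
    have h2 := congrArg Complex.im hu
    rw [vdiff_cpx h] at h2
    have h3 : 0 = -vdiff (coModel I) (mom ν) x u := DFunLike.congr_fun h1 u
    rw [neg_eq_zero.1 h3.symm] at h2
    simp at h2
  · obtain ⟨V, hV, L, hL⟩ := h.exists_form_hlift hx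
    obtain ⟨-, h1, h2⟩ := hL x (mem_of_mem_nhds hV)
    have h3 := h1 _ h0
    rw [h2] at h3
    have h4 := vdiff_mom_hlift h.smooth x
    obtain ⟨u, hu⟩ : ∃ u, vdiff (coModel I) (mom ν) x u ≠ 0 := by
      by_contra! hc
      refine h0 (stdForm_injective ?_)
      rw [stdForm_hlift h.smooth]
      refine ContinuousLinearMap.ext fun u ↦ ?_
      rw [neg_apply, hc, neg_zero]
      rfl
    -- `ν̃` spans the real direction of the range, and a vector `u` with `d⟨p, ν⟩(u) ≠ 0` the other one
    set α := vdiff (coModel I) (reCpx g φ ν χ) x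
    set β := vdiff (coModel I) (mom ν) x
    refine ⟨((c.re - c.im / β u * α u) / α (hlift ν x)) • hlift ν x + (c.im / β u) • u, ?_⟩
    rw [vdiff_cpx h]
    apply Complex.ext
    · change α _ = _
      rw [map_add, map_smul, map_smul, smul_eq_mul, smul_eq_mul]
      field_simp [h3.ne']
      ring
    · change β _ = _
      rw [map_add, map_smul, map_smul, smul_eq_mul, smul_eq_mul, h4]
      field_simp
      ring

/-- In adapted coordinates, `h⁰ = φ(a) + ∑ εⱼ (yⱼ + i Pⱼ)²`. -/
theorem IsAdaptedCoord.isComplexMorsePoint {a : M} {e : OpenPartialHomeomorph M (Coord n)}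
    {ε : Fin n → ℝ} (h : IsAdaptedCoord g φ ν χ a e ε) (hν : ∀ q, SmoothFieldAt I ν q) :
    IsComplexMorsePoint (J := coModel I) n (fun x ↦ -omega x) (cpx g φ ν χ) (zeroSec a) := by
  set Λ := (complexCoord ε).toHomeomorph.toOpenPartialHomeomorph
  have hc := isSmoothCoord_coCoord h.smooth
  have hz : IsSmoothCoord (coModel I) ((coCoord e h.smooth).trans Λ) :=
    hc.trans (complexCoord ε).contDiff.contDiffOn (complexCoord ε).symm.contDiff.contDiffOn
  set z := (coCoord e h.smooth).trans Λ with hzdef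
  have hsrc : ∀ y : Cotangent I M, y ∈ z.source ↔ y.1 ∈ e.source := fun y ↦
    ⟨fun hy ↦ hy.1, fun hy ↦ ⟨hy, mem_univ _⟩⟩
  have happ : ∀ y, z y = complexCoord ε (coCoord e h.smooth y) := fun y ↦ rfl
  have hcen : coCoord e h.smooth (zeroSec a : Cotangent I M) = 0 := by
    rw [coCoord_apply]
    refine Prod.ext h.map_centre ?_
    change (flat n).symm ((0 : Coord n →L[ℝ] ℝ).comp _) = 0
    rw [ContinuousLinearMap.zero_comp, map_zero]
  have hcpx : ∀ y : Cotangent I M, y.1 ∈ e.source → cpx g φ ν χ y = φ a + ∑ j, z y j ^ 2 := by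
    intro y hy
    rw [happ, sum_complexCoord_sq h.sign, cpx, h.reCpx_eq hν hy, h.mom_eq hy]
    push_cast
    ring
  have ha : (zeroSec a : Cotangent I M) ∈ z.source := (hsrc _).2 h.mem
  have hz0 : z (zeroSec a) = 0 := by rw [happ, hcen, map_zero]
  refine ⟨z, hz, ha, hz0, fun y hy ↦ ?_, ?_⟩
  · rw [hcpx y ((hsrc y).1 hy), hcpx _ h.mem, hz0]
    simp
  have ht : (0 : Fin n → ℂ) ∈ z.target := hz0 ▸ z.map_source ha
  have hs0 : z.symm 0 = zeroSec a := by rw [← hz0]; exact z.left_inv ha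
  have key : ∀ ξ η : Fin n → ℂ, -stdForm (Coord n)
      (tdiff (coModel I) z.symm 0 ξ) (tdiff (coModel I) z.symm 0 η) =
      ∑ j, (starRingEnd ℂ (ξ j) * η j).im := by
    have hT : ∀ ξ : Fin n → ℂ, complexCoord ε (vdiff (coModel I) (coCoord e h.smooth) (zeroSec a)
        (tdiff (coModel I) z.symm 0 ξ)) = ξ := by
      intro ξ
      have h1 := hz.vdiff_tdiff_symm ht ξ
      rw [hs0] at h1
      refine Eq.trans ?_ h1
      have hd : MDifferentiableAt (coModel I) 𝓘(ℝ, Coord n × Coord n) (coCoord e h.smooth)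
          (zeroSec a : Cotangent I M) :=
        (hc.1.contMDiffAt ((coCoord e h.smooth).open_source.mem_nhds h.mem)).mdifferentiableAt
          (by simp)
      have h2 := HasMFDerivAt.comp (zeroSec a : Cotangent I M)
        (complexCoord ε).toContinuousLinearMap.hasMFDerivAt hd.hasMFDerivAt
      exact (DFunLike.congr_fun h2.mfderiv _).symm
    intro ξ η
    rw [stdForm_eq_coCoord (x := zeroSec a) h.smooth h.mem, neg_sub,
      ← sum_conj_complexCoord ε, hT, hT]
  refine ⟨fun ξ η ↦ ?_, fun ξ hξ ↦ ?_⟩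
  · refine (key _ _).trans (Eq.trans ?_ (key _ _).symm)
    refine Finset.sum_congr rfl fun j _ ↦ ?_
    simp
  · refine lt_of_lt_of_eq ?_ (key _ _).symm
    obtain ⟨k, hk⟩ := Function.ne_iff.1 hξ
    have hj : ∀ j, (starRingEnd ℂ (ξ j) * (Complex.I • ξ) j).im = Complex.normSq (ξ j) := fun j ↦ by
      simp [Complex.normSq_apply]
    simp only [hj]
    exact Finset.sum_pos' (fun j _ ↦ Complex.normSq_nonneg _)
      ⟨k, Finset.mem_univ k, Complex.normSq_pos.2 hk⟩

end Critical

/-! ### The Morse--Bott property on the sphere bundles -/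

section SphereChart

variable {E : Type*} [NormedAddCommGroup E] [InnerProductSpace ℝ E]

/-- Coordinates of a Euclidean space, on the half space `⟨u, P⟩ > 0`, in which the sphere of radius
`r` is the hyperplane orthogonal to the unit vector `u`: the component of `P` along `u` is replaced
with `½ (|P|² - r²)`. -/
def sphereChart (u : E) (hu : ‖u‖ = 1) (r : ℝ) : OpenPartialHomeomorph E E where
  toFun P := P + (1 / 2 * (‖P‖ ^ 2 - r ^ 2) - inner ℝ u P) • u
  invFun w := w + (√(r ^ 2 + 2 * inner ℝ u w - ‖w‖ ^ 2 + inner ℝ u w ^ 2) - inner ℝ u w) • u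
  source := {P | 0 < inner ℝ u P}
  target := {w | 0 < r ^ 2 + 2 * inner ℝ u w - ‖w‖ ^ 2 + inner ℝ u w ^ 2}
  map_source' P hP := by
    have hP : 0 < inner ℝ u P := hP
    rw [mem_ofPred_eq]
    simp only [norm_add_sq_real, inner_add_right, inner_smul_right, real_inner_self_eq_norm_sq, hu,
      norm_smul, mul_pow, Real.norm_eq_abs, sq_abs, real_inner_comm u P]
    have : 0 < inner ℝ u P ^ 2 := by positivity
    nlinarith
  map_target' w hw := by
    have hw : 0 < r ^ 2 + 2 * inner ℝ u w - ‖w‖ ^ 2 + inner ℝ u w ^ 2 := hw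
    rw [mem_ofPred_eq]
    simp only [inner_add_right, inner_smul_right, real_inner_self_eq_norm_sq, hu]
    have := Real.sqrt_pos.2 hw
    linarith
  left_inv' P hP := by
    have hP : 0 < inner ℝ u P := hP
    have h1 : inner ℝ u (P + (1 / 2 * (‖P‖ ^ 2 - r ^ 2) - inner ℝ u P) • u) =
        1 / 2 * (‖P‖ ^ 2 - r ^ 2) := by
      simp only [inner_add_right, inner_smul_right, real_inner_self_eq_norm_sq, hu]
      ring
    have h2 : r ^ 2 + 2 * (1 / 2 * (‖P‖ ^ 2 - r ^ 2)) -
        ‖P + (1 / 2 * (‖P‖ ^ 2 - r ^ 2) - inner ℝ u P) • u‖ ^ 2 +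
        (1 / 2 * (‖P‖ ^ 2 - r ^ 2)) ^ 2 = inner ℝ u P ^ 2 := by
      simp only [norm_add_sq_real, inner_smul_right, hu, norm_smul, mul_pow, Real.norm_eq_abs,
        sq_abs, real_inner_comm u P]
      ring
    simp only [h1, h2, Real.sqrt_sq hP.le, add_assoc, ← add_smul]
    simp
  right_inv' w hw := by
    have hw : 0 < r ^ 2 + 2 * inner ℝ u w - ‖w‖ ^ 2 + inner ℝ u w ^ 2 := hw
    set q := √(r ^ 2 + 2 * inner ℝ u w - ‖w‖ ^ 2 + inner ℝ u w ^ 2) with hq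
    have hq2 : q ^ 2 = r ^ 2 + 2 * inner ℝ u w - ‖w‖ ^ 2 + inner ℝ u w ^ 2 := Real.sq_sqrt hw.le
    have h1 : inner ℝ u (w + (q - inner ℝ u w) • u) = q := by
      simp only [inner_add_right, inner_smul_right, real_inner_self_eq_norm_sq, hu]
      ring
    have h2 : ‖w + (q - inner ℝ u w) • u‖ ^ 2 = r ^ 2 + 2 * inner ℝ u w := by
      simp only [norm_add_sq_real, inner_smul_right, hu, norm_smul, mul_pow, Real.norm_eq_abs,
        sq_abs, real_inner_comm u w]
      linear_combination hq2
    simp only [h1, h2, add_assoc, ← add_smul]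
    have h3 : q - inner ℝ u w + (1 / 2 * (r ^ 2 + 2 * inner ℝ u w - r ^ 2) - q) = 0 := by ring
    rw [h3, zero_smul, add_zero]
  open_source := isOpen_lt continuous_const (by fun_prop)
  open_target := isOpen_lt continuous_const (by fun_prop)
  continuousOn_toFun := by fun_prop
  continuousOn_invFun := by fun_prop

theorem sphereChart_apply (u : E) (hu : ‖u‖ = 1) (r : ℝ) (P : E) :
    sphereChart u hu r P = P + (1 / 2 * (‖P‖ ^ 2 - r ^ 2) - inner ℝ u P) • u := rfl

theorem inner_sphereChart (u : E) (hu : ‖u‖ = 1) (r : ℝ) (P : E) :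
    inner ℝ u (sphereChart u hu r P) = 1 / 2 * (‖P‖ ^ 2 - r ^ 2) := by
  simp only [sphereChart_apply, inner_add_right, inner_smul_right, real_inner_self_eq_norm_sq, hu]
  ring

/-- A quadratic form of which `u` is an eigenvector, in the coordinates `sphereChart`. -/
theorem inner_eq_sphereChart {u : E} (hu : ‖u‖ = 1) (r : ℝ) {D : E →L[ℝ] E}
    (hD : ∀ v w, inner ℝ (D v) w = inner ℝ v (D w)) {σ : ℝ} (hσ : D u = σ • u) (P : E) :
    inner ℝ (D P) P = inner ℝ (D (sphereChart u hu r P)) (sphereChart u hu r P) -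
      σ * inner ℝ (sphereChart u hu r P) (sphereChart u hu r P) + σ * r ^ 2 +
      2 * σ * inner ℝ u (sphereChart u hu r P) := by
  rw [inner_sphereChart]
  have h1 : inner ℝ (D P) u = σ * inner ℝ u P := by
    rw [hD, hσ, inner_smul_right, real_inner_comm]
  simp only [sphereChart_apply, map_add, map_smul, hσ, inner_add_left, inner_add_right,
    inner_smul_left, inner_smul_right, h1, real_inner_self_eq_norm_sq, hu, real_inner_comm u P,
    RCLike.conj_to_real]
  ring

theorem contDiff_sphereChart (u : E) (hu : ‖u‖ = 1) (r : ℝ) :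
    ContDiff ℝ ∞ (sphereChart u hu r) := by
  have h : ContDiff ℝ ∞ fun P : E ↦ P + (1 / 2 * (‖P‖ ^ 2 - r ^ 2) - inner ℝ u P) • u := by
    have h1 : ContDiff ℝ ∞ fun P : E ↦ ‖P‖ ^ 2 := contDiff_norm_sq ℝ
    have h2 : ContDiff ℝ ∞ fun P : E ↦ (inner ℝ u P : ℝ) := contDiff_const.inner ℝ contDiff_id
    fun_prop
  exact h

theorem contDiffOn_sphereChart_symm (u : E) (hu : ‖u‖ = 1) (r : ℝ) :
    ContDiffOn ℝ ∞ (sphereChart u hu r).symm (sphereChart u hu r).target := by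
  have h1 : ContDiff ℝ ∞ fun P : E ↦ ‖P‖ ^ 2 := contDiff_norm_sq ℝ
  have h2 : ContDiff ℝ ∞ fun P : E ↦ (inner ℝ u P : ℝ) := contDiff_const.inner ℝ contDiff_id
  have h3 : ContDiff ℝ ∞ fun w : E ↦ r ^ 2 + 2 * inner ℝ u w - ‖w‖ ^ 2 + inner ℝ u w ^ 2 := by
    fun_prop
  intro w hw
  exact (contDiffAt_id.add (((h3.contDiffAt.sqrt (ne_of_gt hw)).sub h2.contDiffAt).smul
    contDiffAt_const)).contDiffWithinAt

end SphereChart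

section Hessian

variable {F : Type*} [NormedAddCommGroup F] [NormedSpace ℝ F]

theorem hasFDerivAt_quadratic_polynomial (c : ℝ) (ℓ : F →L[ℝ] ℝ) (B : F →L[ℝ] F →L[ℝ] ℝ)
    (hB : ∀ v w, B v w = B w v) (z : F) :
    HasFDerivAt (fun z ↦ c + ℓ z + 1 / 2 * B z z) (ℓ + B z) z := by
  have h := (ℓ.hasFDerivAt.const_add c).add
    (((B.hasFDerivAt (x := z)).clm_apply (hasFDerivAt_id z)).const_mul (1 / 2))
  refine h.congr_fderiv (ContinuousLinearMap.ext fun v ↦ ?_)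
  simp [hB v z]
  ring

theorem fderiv_fderiv_quadratic_polynomial {f : F → ℝ} {c : ℝ} {ℓ : F →L[ℝ] ℝ}
    {B : F →L[ℝ] F →L[ℝ] ℝ} (hB : ∀ v w, B v w = B w v) {z₀ : F}
    (hf : ∀ᶠ z in 𝓝 z₀, f z = c + ℓ z + 1 / 2 * B z z) : fderiv ℝ (fderiv ℝ f) z₀ = B := by
  have h1 : fderiv ℝ f =ᶠ[𝓝 z₀] fun z ↦ ℓ + B z := by
    refine (Filter.EventuallyEq.fderiv (𝕜 := ℝ) hf).trans (Filter.Eventually.of_forall fun z ↦ ?_)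
    exact (hasFDerivAt_quadratic_polynomial c ℓ B hB z).fderiv
  rw [h1.fderiv_eq]
  exact (B.hasFDerivAt.const_add ℓ).fderiv

end Hessian

section MorseBott

variable {n : ℕ} {H : Type*} [TopologicalSpace H] {I : ModelWithCorners ℝ (Coord n) H}
  {M : Type*} [TopologicalSpace M] [ChartedSpace H M] [IsManifold I ∞ M]

/-- The identification of `ℝⁿ × ℝⁿ` with the model space of `T*M`. -/
def prodFlat (n : ℕ) : (Coord n × Coord n) ≃L[ℝ] (Coord n × (Coord n →L[ℝ] ℝ)) :=
  (ContinuousLinearEquiv.refl ℝ (Coord n)).prodCongr (flat n)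

/-- The bilinear form `2 ⟨D y, y'⟩ - 2 ⟨(D - σ) w, w'⟩`. -/
def normalForm (D : Coord n →L[ℝ] Coord n) (σ : ℝ) :
    Coord n × Coord n →L[ℝ] Coord n × Coord n →L[ℝ] ℝ :=
  (2 : ℝ) • ((flat n).toContinuousLinearMap.bilinearComp (D.comp (ContinuousLinearMap.fst ℝ _ _))
    (ContinuousLinearMap.fst ℝ _ _) -
  (flat n).toContinuousLinearMap.bilinearComp
    ((D - σ • ContinuousLinearMap.id ℝ (Coord n)).comp (ContinuousLinearMap.snd ℝ _ _))
    (ContinuousLinearMap.snd ℝ _ _))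

theorem normalForm_apply (D : Coord n →L[ℝ] Coord n) (σ : ℝ) (v w : Coord n × Coord n) :
    normalForm D σ v w = 2 * (inner ℝ (D v.1) w.1 - inner ℝ (D v.2 - σ • v.2) w.2) := rfl

theorem normalForm_symm {D : Coord n →L[ℝ] Coord n}
    (hD : ∀ v w, inner ℝ (D v) w = inner ℝ v (D w)) (σ : ℝ) (v w : Coord n × Coord n) :
    normalForm D σ v w = normalForm D σ w v := by
  rw [normalForm_apply, normalForm_apply, hD v.1, inner_sub_left, inner_sub_left, hD v.2,
    inner_smul_left, inner_smul_left, real_inner_comm _ v.1, real_inner_comm _ v.2,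
    real_inner_comm w.2 v.2]

/-- The hyperplane `⟨u, w⟩ = 0` of the space of the `(y, w)`. -/
def orthHyperplane (u : Coord n) : Submodule ℝ (Coord n × Coord n) :=
  LinearMap.ker ((flat n u).comp (ContinuousLinearMap.snd ℝ (Coord n) (Coord n))).toLinearMap

theorem mem_orthHyperplane {u : Coord n} {v : Coord n × Coord n} :
    v ∈ orthHyperplane u ↔ inner ℝ u v.2 = 0 := Iff.rfl

/-- The kernel of `normalForm D σ` on the hyperplane orthogonal to `u`. -/
def normalKernel (D : Coord n →L[ℝ] Coord n) (σ : ℝ) (u : Coord n) :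
    Submodule ℝ (Coord n × Coord n) :=
  orthHyperplane u ⊓ (LinearMap.ker (ContinuousLinearMap.fst ℝ (Coord n) (Coord n)).toLinearMap ⊓
    LinearMap.ker ((D - σ • ContinuousLinearMap.id ℝ (Coord n)).comp
      (ContinuousLinearMap.snd ℝ (Coord n) (Coord n))).toLinearMap)

theorem mem_normalKernel {D : Coord n →L[ℝ] Coord n} {σ : ℝ} {u : Coord n}
    {v : Coord n × Coord n} :
    v ∈ normalKernel D σ u ↔ v ∈ orthHyperplane u ∧ v.1 = 0 ∧ D v.2 - σ • v.2 = 0 := Iff.rfl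

theorem normalForm_eq_zero_iff {D : Coord n →L[ℝ] Coord n}
    (hD : ∀ v w, inner ℝ (D v) w = inner ℝ v (D w)) (hinj : ∀ v, D v = 0 → v = 0) {σ : ℝ}
    {u : Coord n} (hσ : D u = σ • u) {v : Coord n × Coord n} (hv : v ∈ orthHyperplane u) :
    (∀ w ∈ orthHyperplane u, normalForm D σ v w = 0) ↔ v ∈ normalKernel D σ u := by
  refine ⟨fun h ↦ mem_normalKernel.2 ⟨hv, hinj _ ?_, ?_⟩, fun h w _ ↦ ?_⟩
  · have h1 := h (D v.1, 0) (by simp [mem_orthHyperplane])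
    rw [normalForm_apply] at h1
    simpa using h1
  · have h0 : inner ℝ u (D v.2 - σ • v.2) = 0 := by
      rw [inner_sub_right, ← hD, hσ, inner_smul_left, inner_smul_right]
      simp
    have h1 := h (0, D v.2 - σ • v.2) (mem_orthHyperplane.2 h0)
    rw [normalForm_apply] at h1
    have h2 : inner ℝ (D v.2 - σ • v.2) (D v.2 - σ • v.2) = 0 := by
      simp only [inner_zero_right, zero_sub] at h1
      linarith
    exact inner_self_eq_zero.1 h2
  · obtain ⟨-, h1, h2⟩ := mem_normalKernel.1 h
    rw [normalForm_apply, h1, h2]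
    simp

section Adapted

variable {g : Metric I (M := M)} {φ χ : M → ℝ} {ν : M → Coord n} {a : M}
  {e : OpenPartialHomeomorph M (Coord n)} {ε : Fin n → ℝ}

/-- The coordinates of `T*M` in which `V_r` is the linear hyperplane `orthHyperplane u`. -/
def sphereCoord (e : OpenPartialHomeomorph M (Coord n)) (he : IsSmoothCoord I e) (u : Coord n)
    (hu : ‖u‖ = 1) (r : ℝ) : OpenPartialHomeomorph (Cotangent I M) (Coord n × Coord n) :=
  (coCoord e he).trans ((OpenPartialHomeomorph.refl (Coord n)).prod (sphereChart u hu r))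

theorem sphereCoord_apply (he : IsSmoothCoord I e) (u : Coord n) (hu : ‖u‖ = 1) (r : ℝ)
    (x : Cotangent I M) : sphereCoord e he u hu r x =
      ((coCoord e he x).1, sphereChart u hu r (coCoord e he x).2) := rfl

theorem mem_sphereCoord_source (he : IsSmoothCoord I e) {u : Coord n} (hu : ‖u‖ = 1) (r : ℝ)
    {x : Cotangent I M} : x ∈ (sphereCoord e he u hu r).source ↔
      x.1 ∈ e.source ∧ 0 < inner ℝ u (coCoord e he x).2 := by
  refine ⟨fun h ↦ ⟨h.1, h.2.2⟩, fun h ↦ ⟨h.1, mem_univ _, h.2⟩⟩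

theorem isSmoothCoord_sphereCoord (he : IsSmoothCoord I e) (u : Coord n) (hu : ‖u‖ = 1) (r : ℝ) :
    IsSmoothCoord (coModel I) (sphereCoord e he u hu r) := by
  refine (isSmoothCoord_coCoord he).trans ?_ ?_
  · exact (contDiff_fst.prodMk ((contDiff_sphereChart u hu r).comp contDiff_snd)).contDiffOn
  · exact contDiff_fst.contDiffOn.prodMk ((contDiffOn_sphereChart_symm u hu r).comp
      contDiff_snd.contDiffOn fun z hz ↦ hz.2)

namespace IsAdaptedCoord

theorem kinetic_eq_sphereCoord (h : IsAdaptedCoord g φ ν χ a e ε) {u : Coord n} (hu : ‖u‖ = 1)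
    (r : ℝ) {x : Cotangent I M} (hx : x.1 ∈ e.source) :
    kinetic g x = inner ℝ u (sphereCoord e h.smooth u hu r x).2 + r ^ 2 / 2 := by
  rw [h.kinetic_eq hx, sphereCoord_apply, inner_sphereChart, real_inner_self_eq_norm_sq]
  ring

/-- When `u` is an eigenvector of the operator of signs, `f⁰` is a quadratic polynomial in the
coordinates `sphereCoord`. -/
theorem reCpx_eq_sphereCoord (h : IsAdaptedCoord g φ ν χ a e ε) (hν : ∀ q, SmoothFieldAt I ν q)
    {u : Coord n} (hu : ‖u‖ = 1) {σ : ℝ} (hσ : signOp ε u = σ • u) (r : ℝ) {x : Cotangent I M}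
    (hx : x.1 ∈ e.source) :
    reCpx g φ ν χ x = φ a - σ * r ^ 2 + (-(2 * σ)) * inner ℝ u (sphereCoord e h.smooth u hu r x).2 +
      1 / 2 * normalForm (signOp ε) σ (sphereCoord e h.smooth u hu r x)
        (sphereCoord e h.smooth u hu r x) := by
  rw [h.reCpx_eq hν hx, inner_eq_sphereChart hu r (inner_signOp_left ε) hσ
    (coCoord e h.smooth x).2, normalForm_apply,
    inner_sub_left, inner_smul_left, sphereCoord_apply]
  simp only [RCLike.conj_to_real]
  ring

end IsAdaptedCoord

end Adapted

/-- Near a critical point of `f⁰|_{V_r}`, the critical locus and the sphere bundle are linear in the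
coordinates `sphereCoord` whose axis `u` is the direction of the momentum of that point. -/
theorem IsGradientData.isMorseBottOn_sphereBundle {g : Metric I (M := M)} {φ χ : M → ℝ}
    {ν : M → Coord n} {C : ℝ} (h : IsGradientData g φ ν χ) {r : ℝ} (hr : 0 < r)
    (hC : ∀ x : Cotangent I M, |dkin g ν x| ≤ C * kinetic g x)
    (hS : sphereBundle g r ⊆ goodSet g φ ν χ C) :
    IsMorseBottOn (J := coModel I) (sphereBundle g r) (sphereTangent g) (reCpx g φ ν χ) := by
  refine ⟨(contMDiff_reCpx g h.contMDiff h.contMDiff_cutoff h.smooth).contMDiffOn,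
    fun c ⟨hcS, hc⟩ ↦ ?_⟩
  have hk := kinetic_ne_zero_of_mem hr hcS
  have h0 : clift g ν c = 0 := h.clift_eq_zero hC (hS hcS) hk hc
  have hνc : ν c.1 = 0 := by
    have h1 := congrArg Prod.fst h0
    simpa [clift, hlift] using h1
  obtain ⟨e, ε, he⟩ := h.exists_coord c.1 (h.field_eq_zero_iff.1 hνc)
  have hce := he.mem
  set P₀ := (coCoord e he.smooth c).2 with hP₀
  have hnorm : ‖P₀‖ = r := by
    have h1 := (mem_sphereBundle g hr.le).1 hcS
    rw [he.kinetic_eq hce, real_inner_self_eq_norm_sq] at h1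
    exact (sq_eq_sq₀ (norm_nonneg _) hr.le).1 (by linarith)
  -- the momentum of a critical point is an eigenvector of the operator of signs
  obtain ⟨σ, hσ⟩ : ∃ σ : ℝ, signOp ε P₀ = σ • P₀ := by
    have h1 : vdiff (coModel I) (coCoord e he.smooth) c (clift g ν c) = 0 := by
      rw [h0, map_zero]
    rw [clift, map_sub, map_smul, he.vdiff_hlift h.smooth hce, he.vdiff_liouville hce] at h1
    have h2 := congrArg Prod.snd h1
    simp only [Prod.snd_sub, Prod.smul_snd, Prod.snd_zero] at h2
    refine ⟨-(1 / 2) * (dkin g ν c / (2 * kinetic g c)), ?_⟩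
    rw [mul_smul, ← sub_eq_zero.1 h2, smul_smul]
    norm_num
    rfl
  set u := r⁻¹ • P₀ with hu_def
  have hu : ‖u‖ = 1 := by
    rw [hu_def, norm_smul, hnorm, norm_inv, Real.norm_eq_abs, abs_of_pos hr,
      inv_mul_cancel₀ hr.ne']
  have hσu : signOp ε u = σ • u := by rw [hu_def, map_smul, hσ, smul_comm]
  have huP : inner ℝ u P₀ = r := by
    rw [hu_def, inner_smul_left, real_inner_self_eq_norm_sq, hnorm]
    simp
    field_simp
  set D := signOp ε
  have hD := inner_signOp_left ε
  have hinj : ∀ v, D v = 0 → v = 0 := fun v hv ↦ by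
    rw [← signOp_signOp he.sign v]
    exact (congrArg D hv).trans (map_zero D)
  set s := sphereCoord e he.smooth u hu r with hs
  have hsm : IsSmoothCoord (coModel I) s := isSmoothCoord_sphereCoord he.smooth u hu r
  have hsrc : ∀ x ∈ s.source, x.1 ∈ e.source := fun x hx ↦ hx.1
  have hcs : c ∈ s.source :=
    (mem_sphereCoord_source he.smooth hu r).2 ⟨hce, by rw [← hP₀, huP]; exact hr⟩
  have hs0 : s c = 0 := by
    refine Prod.ext he.map_centre ?_
    change sphereChart u hu r P₀ = 0
    rw [sphereChart_apply, hnorm, huP, hu_def, smul_smul]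
    have : (1 / 2 * (r ^ 2 - r ^ 2) - r) * r⁻¹ = -1 := by field_simp; ring
    rw [this, neg_one_smul, add_neg_cancel]
  have hmemS : ∀ x ∈ s.source, x ∈ sphereBundle g r ↔ s x ∈ orthHyperplane u := fun x hx ↦ by
    rw [mem_sphereBundle g hr.le, he.kinetic_eq_sphereCoord hu r (hsrc x hx), mem_orthHyperplane]
    constructor <;> intro h <;> linarith
  -- the differentials of `ρ` and `f⁰` in these coordinates
  set ℓ : Coord n × Coord n →L[ℝ] ℝ := (flat n u).comp (ContinuousLinearMap.snd ℝ _ _) with hℓ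
  have hdk : ∀ x ∈ s.source, ∀ w, vdiff (coModel I) (kinetic g) x w =
      inner ℝ u (vdiff (coModel I) s x w).2 := fun x hx w ↦
    hsm.vdiff_eq hx (ℓ.hasFDerivAt.add_const (r ^ 2 / 2))
      (fun y hy ↦ he.kinetic_eq_sphereCoord hu r (hsrc y hy)) w
  have hdf : ∀ x ∈ s.source, ∀ w, vdiff (coModel I) (reCpx g φ ν χ) x w =
      (-(2 * σ)) * inner ℝ u (vdiff (coModel I) s x w).2 +
        normalForm D σ (s x) (vdiff (coModel I) s x w) := fun x hx w ↦
    hsm.vdiff_eq hx (hasFDerivAt_quadratic_polynomial (φ c.1 - σ * r ^ 2) ((-(2 * σ)) • ℓ)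
      (normalForm D σ) (normalForm_symm hD σ) (s x))
      (fun y hy ↦ he.reCpx_eq_sphereCoord h.smooth hu hσu r (hsrc y hy)) w
  have hcrit : ∀ x ∈ s.source, x ∈ critOn (J := coModel I) (sphereBundle g r) (sphereTangent g)
      (reCpx g φ ν χ) ↔ s x ∈ normalKernel D σ u := fun x hx ↦ by
    have h1 : x ∈ critOn (J := coModel I) (sphereBundle g r) (sphereTangent g) (reCpx g φ ν χ) ↔
        x ∈ sphereBundle g r ∧ ∀ w, vdiff (coModel I) (kinetic g) x w = 0 →
          vdiff (coModel I) (reCpx g φ ν χ) x w = 0 := Iff.rfl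
    rw [h1, hmemS x hx]
    refine ⟨fun ⟨h2, h3⟩ ↦ (normalForm_eq_zero_iff hD hinj hσu h2).1 fun w hw ↦ ?_,
      fun h2 ↦ ⟨(mem_normalKernel.1 h2).1, fun w hw ↦ ?_⟩⟩
    · have h4 : vdiff (coModel I) s x ((vdiff (coModel I) s x).inverse w) = w :=
        (hsm.isInvertible hx).self_apply_inverse w
      have hw' : inner ℝ u w.2 = 0 := hw
      have h5 := h3 ((vdiff (coModel I) s x).inverse w) (by rw [hdk x hx, h4]; exact hw')
      rw [hdf x hx, h4, hw'] at h5
      simpa using h5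
    · rw [hdk x hx] at hw
      rw [hdf x hx, hw, mul_zero, zero_add]
      exact (normalForm_eq_zero_iff hD hinj hσu (mem_normalKernel.1 h2).1).2 h2 _
        (mem_orthHyperplane.2 hw)
  set κ := prodFlat n
  set t := s.trans κ.toHomeomorph.toOpenPartialHomeomorph with ht
  have htsrc : ∀ x ∈ t.source, x ∈ s.source := fun x hx ↦ hx.1
  have happ : ∀ x, κ.symm (t x) = s x := fun x ↦ κ.symm_apply_apply (s x)
  have hct : c ∈ t.source := ⟨hcs, mem_univ _⟩
  have ht0 : t c = 0 := (congrArg κ hs0).trans (map_zero κ)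
  refine ⟨t, (orthHyperplane u).comap κ.symm.toLinearEquiv.toLinearMap,
    (normalKernel D σ u).comap κ.symm.toLinearEquiv.toLinearMap,
    hsm.trans κ.contDiff.contDiffOn κ.symm.contDiff.contDiffOn, hct, ht0,
    fun v hv ↦ (mem_normalKernel.1 hv).1, fun x hx ↦ ?_, fun x hx ↦ ?_, fun v hv ↦ ?_⟩
  · rw [hmemS x (htsrc x hx), ← happ]
    rfl
  · rw [hcrit x (htsrc x hx), ← happ]
    rfl
  · have hquad : ∀ᶠ z in 𝓝 (0 : Coord n × (Coord n →L[ℝ] ℝ)), (reCpx g φ ν χ ∘ t.symm) z =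
        φ c.1 - σ * r ^ 2 + ((-(2 * σ)) • ℓ).comp κ.symm.toContinuousLinearMap z +
          1 / 2 * (normalForm D σ).bilinearComp κ.symm.toContinuousLinearMap
            κ.symm.toContinuousLinearMap z z := by
      filter_upwards [t.open_target.mem_nhds (ht0 ▸ t.map_source hct)] with z hz
      have h1 := he.reCpx_eq_sphereCoord h.smooth hu hσu r (hsrc _ (htsrc _ (t.map_target hz)))
      have h2 : sphereCoord e he.smooth u hu r (t.symm z) = κ.symm z := by
        rw [← hs, ← happ, t.right_inv hz]
      rw [h2] at h1
      exact h1
    rw [fderiv_fderiv_quadratic_polynomial (B := (normalForm D σ).bilinearComp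
      κ.symm.toContinuousLinearMap κ.symm.toContinuousLinearMap) (fun v w ↦ normalForm_symm hD σ _ _) hquad]
    have h1 := normalForm_eq_zero_iff hD hinj hσu (v := κ.symm v) hv
    refine Iff.trans ⟨fun h2 w hw ↦ ?_, fun h2 w hw ↦ h2 (κ.symm w) hw⟩ h1
    have h3 := h2 (κ w) (by
      change κ.symm (κ w) ∈ orthHyperplane u
      rwa [κ.symm_apply_apply])
    have h4 : normalForm D σ (κ.symm v) (κ.symm (κ w)) = 0 := h3
    rwa [κ.symm_apply_apply] at h4

end MorseBott

end CoarseComplexification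

end

open CoarseComplexification in
theorem lemmal {n : ℕ} {H : Type*} [TopologicalSpace H]
    (I : ModelWithCorners ℝ (EuclideanSpace ℝ (Fin n)) H)
    (hI : range I = univ ∨
      ∃ v : EuclideanSpace ℝ (Fin n), v ≠ 0 ∧ range I = {y | 0 ≤ inner ℝ v y})
    {M : Type*} [TopologicalSpace M] [T2Space M] [CompactSpace M]
    [ChartedSpace H M] [IsManifold I ∞ M]
    (φ : M → ℝ) (hφ : IsMorse I φ)
    (ν : ∀ q : M, TangentSpace I q) (hν : IsAdaptedGradient I φ ν)
    (g : ContMDiffRiemannianMetric I ∞ (EuclideanSpace ℝ (Fin n)) (fun q : M ↦ TangentSpace I q))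
    (hg : IsAdaptedMetric g φ ν)
    (χ : M → ℝ) (hχ : IsCutoff I φ χ) :
    ∃ δ : ℝ, 0 < δ ∧
      -- the critical points of `h⁰` in `W_δ` are those of `φ` and are of complex Morse type
      ({x ∈ tube g δ | ¬ Function.Surjective
          (mfderiv (coModel I) 𝓘(ℝ, ℂ) (complexification g φ ν χ) x)} = zeroSec '' critSet I φ ∧
        ∀ a ∈ critSet I φ, IsComplexMorsePoint (J := coModel I) n (fun x ↦ -omega x)
          (complexification g φ ν χ) (zeroSec a)) ∧
      -- in `W_δ`, the real part `f⁰` is a Lyapunov function for the Hamiltonian lift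
      IsLyapunovOn (J := coModel I) (tube g δ) (fun _ ↦ ⊤) (hamLift ν)
        (complexificationRe g φ ν χ) ∧
      -- on `V_r`, the restriction of `f⁰` is a Morse--Bott Lyapunov function for the contact lift
      ∀ r : ℝ, 0 < r → r ≤ δ →
        IsMorseBottOn (J := coModel I) (sphereBundle g r) (sphereTangent g)
          (complexificationRe g φ ν χ) ∧
        IsLyapunovOn (J := coModel I) (sphereBundle g r) (sphereTangent g) (contactLift g ν)
          (complexificationRe g φ ν χ) ∧
        -- (boundary behaviour of `f⁰` on `V_r` when `χ` vanishes near `∂M`)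
        ((∀ q ∈ I.boundary M, ∀ᶠ q' in 𝓝 q, χ q' = 0) →
          ∀ x ∈ sphereBundle g r, x.1 ∈ I.boundary M →
            ∀ᶠ y in 𝓝 x, y ∈ sphereBundle g r → y.1 ∈ I.boundary M →
              complexificationRe g φ ν χ y = complexificationRe g φ ν χ x) := by
  have hν' : ∀ q, SmoothFieldAt I (W := M) ν q := smoothFieldAt_of_contMDiff hν.smooth
  have hgrad : ∀ q, gform g q (ν q) = vdiff I φ q := fun q ↦
    ContinuousLinearMap.ext fun w ↦ hg.gradient q w
  have hdata : IsGradientData g φ ν χ :=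
    { contMDiff := hφ.smooth
      contMDiff_cutoff := hχ.smooth
      cutoff_mem := hχ.mem_Icc
      smooth := hν'
      gradient := hgrad
      exists_coord := fun a ha ↦ exists_isAdaptedCoord hgrad (hχ.eq_one a ha) (hg.euclidean a ha) }
  have hcpx : complexification g φ ν χ = cpx (I := I) g φ ν χ :=
    complexification_eq hφ.smooth hν' g hgrad χ
  have hre : complexificationRe g φ ν χ = reCpx (I := I) g φ ν χ :=
    complexificationRe_eq hφ.smooth hν' g hgrad χ
  have hham : hamLift (I := I) ν = hlift (I := I) ν := funext (hamLift_eq hν')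
  have hcon : contactLift g ν = clift (I := I) g ν := funext (contactLift_eq hν' g)
  obtain ⟨C, -, hC⟩ := exists_dkin_le g hν'
  obtain ⟨δ, hδ, hsub⟩ := exists_tube_subset g (hdata.isOpen_goodSet C) (hdata.zero_mem_goodSet C)
  rw [hcpx, hre, hham, hcon]
  refine ⟨δ, hδ, ⟨?_, fun a ha ↦ ?_⟩, hdata.isLyapunovOn_tube hsub, fun r hr hrδ ↦ ⟨?_, ?_, ?_⟩⟩
  · ext x
    have h1 : ∀ x ∈ tube g δ, ¬ Function.Surjective (vdiff (coModel I) (cpx g φ ν χ) x) ↔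
        vdiff I φ x.1 = 0 ∧ fib x = 0 := fun x hx ↦ by
      rw [surjective_vdiff_cpx hdata (hsub hx), not_not, hdata.hlift_eq_zero_iff (hsub hx)]
    constructor
    · rintro ⟨hx, hs⟩
      obtain ⟨h2, h3⟩ := (h1 x hx).1 hs
      refine ⟨x.1, h2, ?_⟩
      rw [← cov_fib x, h3]
      rfl
    · rintro ⟨a, ha, rfl⟩
      have h2 : (zeroSec a : Cotangent I M) ∈ tube g δ := by
        rw [mem_tube g hδ.le, kinetic_eq_gsharp]
        have h3 : fib (zeroSec a : Cotangent I M) = 0 := rfl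
        rw [h3, zero_apply, mul_zero, mul_zero]
        positivity
      exact ⟨h2, (h1 _ h2).2 ⟨ha, rfl⟩⟩
  · obtain ⟨e, ε, he⟩ := hdata.exists_coord a ha
    exact he.isComplexMorsePoint hν'
  · exact hdata.isMorseBottOn_sphereBundle hr hC
      ((IsGradientData.sphereBundle_subset hrδ).trans hsub)
  · exact hdata.isLyapunovOn_sphereBundle hr hC
      ((IsGradientData.sphereBundle_subset hrδ).trans hsub)
  · intro hχ0 x _ hx
    have hproj := (contMDiff_proj_cotangent (I := I) (M := M)).continuous.continuousAt (x := x)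
    have hx0 : χ x.1 = 0 := (hχ0 x.1 hx).self_of_nhds
    filter_upwards [hproj.eventually (hχ0 x.1 hx), hproj.eventually
      (eventually_nhdsWithin_iff.1 (hφ.locallyConst_boundary x.1 hx))] with y hy1 hy2 _ hy
    simp only [reCpx]
    rw [hy1, hx0, hy2 hy]
    ring
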